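/- Let $n\ge 0$ be an integer and let $J$ be the block diagonal matrix of size $2n+2$ with diagonal blocks $\begin{pmatrix}0&-1\\1&0\end{pmatrix}$. For $\mathbb K=\mathbb R$ or $\mathbb C$ let $\mathcal D_n(\mathbb K)$ be the set of all matrices $R$ of size $(1+1+2n)\times(1+1+2n)$ over $\mathbb K$ with $$R=\begin{pmatrix}1&0&*\\0&1&0\\0&*&*\end{pmatrix},\qquad J^{-1}R^tJ=R,\qquad R+R^*\gg0$$ ($\gg0$ means hermitian positive definite). This is a model of the symmetric space $\mathrm O(2n+1,\mathbb C)/\mathrm O(2n+1)$ for $\mathbb K=\mathbb R$ and of $\mathrm{SO}^*(4n+2)/\mathrm U(2n+1)$ for $\mathbb K=\mathbb C$. Since $JR$ is antisymmetric with first row $(0,-1,0,\dots,0)$, such an $R$ is given by its independent entries, which up to sign are the entries of $JR$ above the diagonal and outside the first row; $dR$ denotes the product Lebesgue measure in these entries. Write $[A]_p$ for the left upper $p\times p$ block of $A$. For a matrix $A$ with $A+A^*\gg0$ and eigenvalues $\mu_1,\dots,\mu_N$ (with multiplicity) put $\ell(A)=\sum_i\ln\mu_i$ (principal logarithms), $\det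 A^{\tau}=e^{\tau\ell(A)}$ and $\det A^{\{\sigma\|\tau\}}=e^{\sigma\ell(A)+\tau\overline{\ell(A)}}$ for $\sigma,\tau\in\mathbb C$. Below, $\lambda_k,\sigma_k,\tau_k\in\mathbb C$ for $1\le k\le n$, and $\lambda_{n+1}=\sigma_{n+1}=\tau_{n+1}=0$. (a) If $\operatorname{Re}\lambda_k>n+k-1$ and $\operatorname{Re}(\sigma_k-\lambda_k)>n-k$ for $1\le k\le n$, then the following integral converges absolutely and $$\int_{\mathcal D_n(\mathbb R)}\prod_{j=1}^n\frac{\det[R+R^t]_{2j+2}^{(\lambda_j-\lambda_{j+1})/2}}{\det[1+R]_{2j+2}^{(\sigma_j-\sigma_{j+1})/2}}\,\det(R+R^*)^{-n}\,dR =C_1\prod_{k=1}^n\pi^{2k-1}\frac{\Gamma(\lambda_k-(n+k)+1)\,\Gamma(\sigma_k-\lambda_k-(n-k))}{\Gamma(\sigma_k-2(n-k))},$$ where $C_1=2^{\lambda_1-\sigma_1+\sum_{k=1}^n\lambda_k-n(n+1)}$. (b) If $\operatorname{Re}\lambda_k>2(n+k)-1$ and $\operatorname{Re}(\sigma_k+\tau_k-\lambda_k)>2(n-k)$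 for $1\le k\le n$, then the following integral converges absolutely and $$\int_{\mathcal D_n(\mathbb C)}\prod_{j=1}^n\frac{\det[R+R^*]_{2j+2}^{(\lambda_j-\lambda_{j+1})/2}}{\det[1+R]_{2j+2}^{\{(\sigma_j-\sigma_{j+1})/2\|(\tau_j-\tau_{j+1})/2\}}}\,\det(R+R^*)^{-2n}\,dR =C_2\prod_{k=1}^n\pi^{4k-1}\frac{\Gamma(\lambda_k-2(n+k)+1)\,\Gamma(\sigma_k+\tau_k-\lambda_k-2(n-k))}{\Gamma(\sigma_k-2(n-k))\,\Gamma(\tau_k-2(n-k))},$$ where $C_2=2^{\lambda_1-\sigma_1-\tau_1+\sum_{k=1}^n(\lambda_k-\sigma_k-\tau_k)-2n}$, and $1/\Gamma$ is read as $0$ at the poles of $\Gamma$. -/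

import Mathlib

open MeasureTheory Matrix
open scoped ComplexOrder

namespace MatrixBeta

noncomputable section

/-! ### Powers of determinants -/

/-- The logarithm of the determinant of a matrix whose eigenvalues have positive real parts:
the sum of the principal logarithms of the eigenvalues, with algebraic multiplicity. -/
def logDet {m : Type*} [Fintype m] [DecidableEq m] (A : Matrix m m ℂ) : ℂ :=
  (A.charpoly.roots.map Complex.log).sum

/-- `det A ^ τ = exp (τ ∑ log λⱼ)`, where the `λⱼ` are the eigenvalues of the dissipative
matrix `A`. -/
def detPow {m : Type*} [Fintype m] [DecidableEq m] (A : Matrix m m ℂ) (τ : ℂ) : ℂ :=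
  Complex.exp (τ * logDet A)

/-- The double power `det A ^ {σ‖τ} = (det A) ^ σ * (conj (det A)) ^ τ`. -/
def detPowConj {m : Type*} [Fintype m] [DecidableEq m] (A : Matrix m m ℂ) (σ τ : ℂ) : ℂ :=
  Complex.exp (σ * logDet A) * Complex.exp (τ * (starRingEnd ℂ) (logDet A))

/-- The left upper `p × p` block `[A]_p` of a matrix `A` of size `N ≥ p`. -/
def upperLeft {N : ℕ} {α : Type*} (A : Matrix (Fin N) (Fin N) α) (p : ℕ) :
    Matrix {i : Fin N // (i : ℕ) < p} {i : Fin N // (i : ℕ) < p} α :=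
  A.toSquareBlockProp (fun i => (i : ℕ) < p)

/-! ### The sections of wedges -/

/-- The block diagonal matrix `J` of size `2n+2` with diagonal blocks `(0, -1; 1, 0)`. -/
def J (n : ℕ) (𝕜 : Type*) [CommRing 𝕜] : Matrix (Fin (2 * n + 2)) (Fin (2 * n + 2)) 𝕜 :=
  Matrix.of fun i j =>
    if Even (i : ℕ) ∧ (j : ℕ) = i + 1 then -1
    else if Even (j : ℕ) ∧ (i : ℕ) = j + 1 then 1
    else 0

/-- The affine space of the matrices of size `2n+2` with `J⁻¹ Rᵗ J = R` that have the
`(1+1+2n)`-block structure `(1, 0, *; 0, 1, 0; 0, *, *)`. -/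
def affineSection (n : ℕ) (𝕜 : Type*) [CommRing 𝕜] :
    Set (Matrix (Fin (2 * n + 2)) (Fin (2 * n + 2)) 𝕜) :=
  {R | (J n 𝕜)⁻¹ * Rᵀ * J n 𝕜 = R ∧ R 0 1 = 0 ∧
    (∀ i, R i 0 = if i = 0 then 1 else 0) ∧ (∀ j, R 1 j = if j = 1 then 1 else 0)}

/-- The model: all `R` in the affine space above that are dissipative, `R + R* ≫ 0`. It is the
model of `O(2n+1,ℂ)/O(2n+1)` for `𝕜 = ℝ` and of `SO*(4n+2)/U(2n+1)` for `𝕜 = ℂ`. -/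
def wedgeSection (n : ℕ) (𝕜 : Type*) [RCLike 𝕜] :
    Set (Matrix (Fin (2 * n + 2)) (Fin (2 * n + 2)) 𝕜) :=
  {R | R ∈ affineSection n 𝕜 ∧ (R + Rᴴ).PosDef}

/-- Positions (counted from `0`) of the free entries of the antisymmetric matrix `J R`: those
above the diagonal, outside the row `0`. -/
abbrev Coord (n : ℕ) : Type :=
  {p : Fin (2 * n + 2) × Fin (2 * n + 2) // 1 ≤ (p.1 : ℕ) ∧ p.1 < p.2}

/-- The antisymmetric matrix with entries `x (i, j)` for `1 ≤ i < j` and with row `0` equal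
to `(0, -1, 0, …, 0)`. -/
def skew {n : ℕ} {𝕜 : Type*} [CommRing 𝕜] (x : Coord n → 𝕜) :
    Matrix (Fin (2 * n + 2)) (Fin (2 * n + 2)) 𝕜 :=
  Matrix.of fun i j =>
    if h : 1 ≤ (i : ℕ) ∧ i < j then x ⟨(i, j), h⟩
    else if h : 1 ≤ (j : ℕ) ∧ j < i then -x ⟨(j, i), h⟩
    else if i = 0 ∧ j = 1 then -1
    else if i = 1 ∧ j = 0 then 1
    else 0

/-- The linear coordinates on the affine section: `R = J⁻¹ X`, where `X` is the antisymmetric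
matrix with free entries `x`. Up to signs, the coordinates `x` are the independent entries of `R`,
so that `dR` is the product Lebesgue measure `dx`. -/
def ofCoord {n : ℕ} {𝕜 : Type*} [CommRing 𝕜] (x : Coord n → 𝕜) :
    Matrix (Fin (2 * n + 2)) (Fin (2 * n + 2)) 𝕜 :=
  (J n 𝕜)⁻¹ * skew x

/-! ### The integrands -/

/-- The integrand of the integral over `O(2n+1,ℂ)/O(2n+1)`. -/
def integrandReal (n : ℕ) (lam sig : ℕ → ℂ)
    (R : Matrix (Fin (2 * n + 2)) (Fin (2 * n + 2)) ℝ) : ℂ :=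
  (∏ j ∈ Finset.Icc 1 n,
    detPow ((upperLeft (R + Rᵀ) (2 * j + 2)).map Complex.ofReal)
        ((lam j - lam (j + 1)) / 2) /
      detPow ((upperLeft (1 + R) (2 * j + 2)).map Complex.ofReal)
        ((sig j - sig (j + 1)) / 2)) *
  detPow ((R + Rᴴ).map Complex.ofReal) (-(n : ℂ))

/-- The integrand of the integral over `SO*(4n+2)/U(2n+1)`. -/
def integrandComplex (n : ℕ) (lam sig tau : ℕ → ℂ)
    (R : Matrix (Fin (2 * n + 2)) (Fin (2 * n + 2)) ℂ) : ℂ :=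
  (∏ j ∈ Finset.Icc 1 n,
    detPow (upperLeft (R + Rᴴ) (2 * j + 2)) ((lam j - lam (j + 1)) / 2) /
      detPowConj (upperLeft (1 + R) (2 * j + 2))
        ((sig j - sig (j + 1)) / 2) ((tau j - tau (j + 1)) / 2)) *
  detPow (R + Rᴴ) (-(2 * n : ℂ))

/-! ### `ofCoord` is a bijection onto the affine section -/

theorem J_mul_J (n : ℕ) (𝕜 : Type*) [CommRing 𝕜] : J n 𝕜 * J n 𝕜 = -1 := by
  ext i j
  rw [Matrix.mul_apply, Matrix.neg_apply, Matrix.one_apply]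
  have hi := i.2
  rcases Nat.even_or_odd' (i : ℕ) with ⟨a, ha | ha⟩
  · rw [Finset.sum_eq_single (⟨i + 1, by omega⟩ : Fin (2 * n + 2))]
    · simp only [J, Matrix.of_apply, Fin.ext_iff]
      grind
    · intro b _ hb
      have : (b : ℕ) ≠ i + 1 := fun h => hb (Fin.ext h)
      simp only [J, Matrix.of_apply]
      grind
    · simp
  · rw [Finset.sum_eq_single (⟨i - 1, by omega⟩ : Fin (2 * n + 2))]
    · simp only [J, Matrix.of_apply, Fin.ext_iff]
      grind
    · intro b _ hb
      have : (b : ℕ) ≠ i - 1 := fun h => hb (Fin.ext h)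
      simp only [J, Matrix.of_apply]
      grind
    · simp

theorem J_inv (n : ℕ) (𝕜 : Type*) [CommRing 𝕜] : (J n 𝕜)⁻¹ = -J n 𝕜 :=
  Matrix.inv_eq_right_inv (by rw [mul_neg, J_mul_J, neg_neg])

theorem J_transpose (n : ℕ) (𝕜 : Type*) [CommRing 𝕜] : (J n 𝕜)ᵀ = -J n 𝕜 := by
  ext i j
  simp only [J, Matrix.transpose_apply, Matrix.of_apply, Matrix.neg_apply]
  grind

theorem J_mul_ofCoord {n : ℕ} {𝕜 : Type*} [CommRing 𝕜] (x : Coord n → 𝕜) :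
    J n 𝕜 * ofCoord x = skew x := by
  rw [ofCoord, J_inv, neg_mul, mul_neg, ← mul_assoc, J_mul_J, neg_mul, one_mul, neg_neg]

theorem skew_transpose {n : ℕ} {𝕜 : Type*} [CommRing 𝕜] (x : Coord n → 𝕜) :
    (skew x)ᵀ = -skew x := by
  ext i j
  simp only [skew, Matrix.transpose_apply, Matrix.of_apply, Matrix.neg_apply, Fin.ext_iff,
    Fin.lt_def, Fin.val_zero, Fin.val_one]
  split_ifs <;> first | (exfalso; omega) | simp

theorem skew_zero {n : ℕ} {𝕜 : Type*} [CommRing 𝕜] (x : Coord n → 𝕜) (j : Fin (2 * n + 2)) :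
    skew x 0 j = if j = 1 then -1 else 0 := by
  have h : ¬ (1 ≤ ((0 : Fin (2 * n + 2)) : ℕ) ∧ 0 < j) := by simp
  have h' : ¬ (1 ≤ (j : ℕ) ∧ j < 0) := by simp
  have h'' : ¬ ((0 : Fin (2 * n + 2)) = 1 ∧ j = 0) := fun h => absurd h.1 (by simp)
  simp only [skew, Matrix.of_apply, dif_neg h, dif_neg h', if_neg h'', true_and]

theorem J_mul_apply {n : ℕ} {𝕜 : Type*} [CommRing 𝕜]
    (A : Matrix (Fin (2 * n + 2)) (Fin (2 * n + 2)) 𝕜) (a : ℕ) (ha : a ≤ n)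
    (j : Fin (2 * n + 2)) :
    (J n 𝕜 * A) ⟨2 * a, by omega⟩ j = -A ⟨2 * a + 1, by omega⟩ j ∧
      (J n 𝕜 * A) ⟨2 * a + 1, by omega⟩ j = A ⟨2 * a, by omega⟩ j := by
  constructor
  · rw [Matrix.mul_apply, Finset.sum_eq_single (⟨2 * a + 1, by omega⟩ : Fin (2 * n + 2))]
    · simp [J]
    · intro b _ hb
      have : (b : ℕ) ≠ 2 * a + 1 := fun h => hb (Fin.ext h)
      simp only [J, Matrix.of_apply]
      grind
    · simp
  · rw [Matrix.mul_apply, Finset.sum_eq_single (⟨2 * a, by omega⟩ : Fin (2 * n + 2))]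
    · simp [J]
    · intro b _ hb
      have : (b : ℕ) ≠ 2 * a := fun h => hb (Fin.ext h)
      simp only [J, Matrix.of_apply]
      grind
    · simp

theorem ofCoord_injective {n : ℕ} {𝕜 : Type*} [CommRing 𝕜] :
    Function.Injective (ofCoord : (Coord n → 𝕜) → _) := by
  intro x y h
  have h' : skew x = skew y := by rw [← J_mul_ofCoord, h, J_mul_ofCoord]
  funext p
  have := congrFun (congrFun h' p.1.1) p.1.2
  simpa [skew, p.2.1, p.2.2] using this

theorem ofCoord_mem {n : ℕ} {𝕜 : Type*} [CommRing 𝕜] (x : Coord n → 𝕜) :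
    ofCoord x ∈ affineSection n 𝕜 := by
  have e : ofCoord x = -(J n 𝕜 * skew x) := by rw [ofCoord, J_inv, neg_mul]
  have h0 := fun j => (J_mul_apply (skew x) 0 (Nat.zero_le n) j)
  have z : (⟨2 * 0, by omega⟩ : Fin (2 * n + 2)) = 0 := rfl
  have o : (⟨2 * 0 + 1, by omega⟩ : Fin (2 * n + 2)) = 1 := by simp
  rw [z, o] at h0
  refine ⟨?_, ?_, ?_, ?_⟩
  · rw [e, J_inv, Matrix.transpose_neg, Matrix.transpose_mul, skew_transpose, J_transpose]
    simp only [neg_mul, mul_neg, neg_neg, mul_assoc, J_mul_J, mul_one]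
  · rw [e, Matrix.neg_apply, (h0 1).1]
    simp [skew]
  · intro i
    have hc : ∀ k, skew x k 0 = -skew x 0 k := fun k => by
      rw [← Matrix.neg_apply, ← skew_transpose, Matrix.transpose_apply]
    rw [e, Matrix.neg_apply]
    rcases Nat.even_or_odd' (i : ℕ) with ⟨a, ha | ha⟩
    · have hi : i = ⟨2 * a, by omega⟩ := Fin.ext ha
      rw [hi, (J_mul_apply (skew x) a (by omega) 0).1]
      rw [hc, skew_zero]
      simp only [Fin.ext_iff, Fin.val_one, Fin.val_zero]
      split_ifs <;> first | (exfalso; omega) | simp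
    · have hi : i = ⟨2 * a + 1, by omega⟩ := Fin.ext ha
      rw [hi, (J_mul_apply (skew x) a (by omega) 0).2]
      rw [hc, skew_zero]
      simp only [Fin.ext_iff, Fin.val_one, Fin.val_zero]
      split_ifs <;> first | (exfalso; omega) | simp
  · intro j
    rw [e, Matrix.neg_apply, (h0 j).2, skew_zero]
    split_ifs <;> simp

theorem range_ofCoord (n : ℕ) (𝕜 : Type*) [RCLike 𝕜] :
    Set.range (ofCoord : (Coord n → 𝕜) → _) = affineSection n 𝕜 := by
  refine Set.Subset.antisymm (Set.range_subset_iff.2 ofCoord_mem) ?_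
  rintro R ⟨hR, -, -, h1⟩
  have hX : (J n 𝕜 * R)ᵀ = -(J n 𝕜 * R) := by
    conv_rhs => rw [← hR]
    rw [J_inv, Matrix.transpose_mul, J_transpose]
    simp only [neg_mul, mul_neg, neg_neg, ← mul_assoc, J_mul_J, one_mul]
  have hX' : ∀ i j, (J n 𝕜 * R) j i = -(J n 𝕜 * R) i j := fun i j =>
    congrFun (congrFun hX i) j
  have hd : ∀ i, (J n 𝕜 * R) i i = 0 := fun i => self_eq_neg.1 (hX' i i)
  have hz : ∀ j, (J n 𝕜 * R) 0 j = if j = 1 then -1 else 0 := by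
    intro j
    have h0 := (J_mul_apply R 0 (Nat.zero_le n) j).1
    have z : (⟨2 * 0, by omega⟩ : Fin (2 * n + 2)) = 0 := rfl
    have o : (⟨2 * 0 + 1, by omega⟩ : Fin (2 * n + 2)) = 1 := by simp
    rw [z, o, h1] at h0
    rw [h0]
    split_ifs <;> simp
  refine ⟨fun p => (J n 𝕜 * R) p.1.1 p.1.2, ?_⟩
  have hs : skew (fun p : Coord n => (J n 𝕜 * R) p.1.1 p.1.2) = J n 𝕜 * R := by
    ext i j
    simp only [skew, Matrix.of_apply]
    split_ifs with a b c d
    · rfl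
    · exact (hX' j i).symm
    · rw [c.1, c.2, hz, if_pos rfl]
    · rw [d.1, d.2, hX' 0 1, hz, if_pos rfl, neg_neg]
    · by_cases hi : i = 0
      · rw [hi, hz, if_neg (fun h => c ⟨hi, h⟩)]
      · by_cases hj : j = 0
        · rw [hj, hX' 0 i, hz, if_neg (fun h => d ⟨h, hj⟩), neg_zero]
        · have : i = j := by
            simp only [Fin.ext_iff, Fin.lt_def, Fin.val_zero] at *
            omega
          rw [this, hd]
  rw [ofCoord, hs, J_inv, neg_mul, ← mul_assoc, J_mul_J, neg_mul, one_mul, neg_neg]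

end

end MatrixBeta

namespace MatrixBeta

/-! ### Integrals of powers by means of the Gamma function -/

/-! The proof peels off the last two rows and columns and inducts on `n`, for both fields at once,
with `d` the real dimension of `𝕜`. Let `P` be the upper left block of `R` of size two less, `v` the
vector of the remaining entries of two columns of `J R`, and `y` the one further scalar entry. The
symmetry `J⁻¹ Rᵗ J = R` forces the `2 × 2` Schur complements of `R + R*` and `1 + R` to be scalar
matrices (`symm_fin_two`), say `h` and `u`. Hence `det (R + R*) = det (P + P*) h²` and `det (1 + R)
= det (1 + P) u²`, and `R` is dissipative exactly when `P` is dissipative and `h > 0`. The same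
factorization holds for `logDet`, with its sums of principal logarithms
(`logDet_eq_add_log_schurCompl`): dissipative matrices form a convex set containing `1`, and a
continuous function with values in `2πiℤ` is constant along a segment. The integrand therefore
splits into a function of `P` and a kernel `h ^ α u ^ {-σ‖-τ}`.

For fixed `P` the fiber integral is explicit. One has `2 Re u = 2 + h + Q(v)` with a positive
definite quadratic form `Q` depending on `P`, so a translation and a scaling of `y` turn the
homogeneous kernel into a power of `2 + Q(v)` times a scalar integral that depends neither on `P`
nor on `v`. For `ℝ` the scalar integral is a beta integral; for `ℂ` it is a beta integral times
Cauchy's integral of `(1 + it) ^ (-σ) (1 - it) ^ (-τ)`. Diagonalizing `Q`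
(`exists_quadForm_eq_sum_norm_sq`) reduces the integral over `v` to a radial one, evaluated by
Gaussians and the Gamma function, with Jacobian `(|det (1 + P)| √det (P + P*) / 2 ^ (n + 2)) ^ d`.

Apart from its power of `2`, this Jacobian is a product of powers of the determinants already
present in the integrand, because `|det (1 + P)| ^ d` equals `det (1 + P)` for `ℝ` and `det (1 + P)`
times its conjugate for `ℂ`. It is absorbed by lowering the exponents `λ, σ, τ` by `d, 2, 2 (d -
1)`, after which the fiber contributes a constant (`integral_genIntegrand_succ`). Iteration gives a
product of fiber constants, and in each of them the Gamma factor of the radial integral cancels one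
of the scalar integral. Absolute convergence runs along the same path, since the absolute value of a
homogeneous kernel is again homogeneous. -/

theorem one_div_cpow_of_pos {A : ℝ} (hA : 0 < A) (s : ℂ) : (1 / (A : ℂ)) ^ s = (A : ℂ) ^ (-s) := by
  rw [one_div, Complex.inv_cpow _ _ (by
    rw [Complex.arg_ofReal_of_nonneg hA.le]; exact Real.pi_pos.ne),
    Complex.cpow_neg]

theorem integrableOn_rpow_mul_exp_neg_mul {A s : ℝ} (hA : 0 < A) (hs : 0 < s) :
    IntegrableOn (fun t : ℝ => t ^ (s - 1) * Real.exp (-(A * t))) (Set.Ioi 0) := by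
  have := integrableOn_rpow_mul_exp_neg_mul_rpow (p := 1) (s := s - 1) (b := A) (by linarith)
    one_pos hA
  simpa using this

/-- Integrals of `w (A + g) ^ (-s)` are found by means of the Gamma function from the
integrals of `w e ^ (-t g)`. -/
theorem integral_mul_add_cpow_neg {X : Type*} [MeasurableSpace X] {μ : Measure X} [SFinite μ]
    {g : X → ℝ} {w : X → ℂ} (hg : Measurable g) (hw : Measurable w) (hg0 : ∀ᵐ x ∂μ, 0 ≤ g x)
    {a s c : ℂ} {c' : ℝ} (hs : 0 < s.re) (has : a.re < s.re)
    (hint : ∀ t : ℝ, 0 < t → Integrable (fun x => w x * Complex.exp (-(t * g x : ℝ))) μ)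
    (hval : ∀ t : ℝ, 0 < t → ∫ x, w x * Complex.exp (-(t * g x : ℝ)) ∂μ = c * (t : ℂ) ^ (-a))
    (hnorm : ∀ t : ℝ, 0 < t →
      ∫ x, ‖w x * Complex.exp (-(t * g x : ℝ))‖ ∂μ = c' * t ^ (-a.re))
    {A : ℝ} (hA : 0 < A) :
    Integrable (fun x => w x * ((A + g x : ℝ) : ℂ) ^ (-s)) μ ∧
      ∫ x, w x * ((A + g x : ℝ) : ℂ) ^ (-s) ∂μ =
        c * (A : ℂ) ^ (a - s) * (Complex.Gamma (s - a) / Complex.Gamma s) := by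
  set Φ : ℝ × X → ℂ := fun z => ((z.1 : ℂ) ^ (s - 1) * Complex.exp (-(A * z.1))) *
    (w z.2 * Complex.exp (-(z.1 * g z.2 : ℝ))) with hΦ
  have hΓ : Complex.Gamma s ≠ 0 := Complex.Gamma_ne_zero_of_re_pos hs
  have hmeas : Measurable Φ := by
    simp only [hΦ]
    fun_prop
  have hI : Integrable Φ ((volume.restrict (Set.Ioi 0)).prod μ) := by
    -- Absolute integrability of `t ^ (s - 1) e ^ (-t (A + g)) w` on the product is what permits the
    -- interchange. The inner norm integral is `c' t ^ (-Re a)` by `hnorm`, which leaves a real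
    -- Gamma integrand with exponent `Re s - Re a > 0`.
    rw [integrable_prod_iff hmeas.aestronglyMeasurable]
    constructor
    · filter_upwards [ae_restrict_mem measurableSet_Ioi] with t ht
      exact (hint t ht).const_mul ((t : ℂ) ^ (s - 1) * Complex.exp (-(A * t)))
    · have : IntegrableOn (fun t : ℝ => c' * (t ^ (s.re - a.re - 1) * Real.exp (-(A * t))))
          (Set.Ioi 0) :=
        (integrableOn_rpow_mul_exp_neg_mul hA (by linarith)).const_mul _
      refine this.congr ?_
      filter_upwards [ae_restrict_mem measurableSet_Ioi] with t ht
      have ht' : (0 : ℝ) < t := ht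
      simp only [hΦ, norm_mul (_ * _) (_ * _), integral_const_mul]
      rw [hnorm t ht, norm_mul, Complex.norm_cpow_eq_rpow_re_of_pos ht', Complex.norm_exp]
      simp only [Complex.sub_re, Complex.one_re, Complex.neg_re, Complex.mul_re, Complex.ofReal_re,
        Complex.ofReal_im, mul_zero, sub_zero]
      rw [show s.re - a.re - 1 = (s.re - 1) + (-a.re) by ring, Real.rpow_add ht']
      ring
  have hinner : ∀ᵐ x ∂μ, ∫ t in Set.Ioi (0 : ℝ), Φ (t, x) =
      Complex.Gamma s * (w x * ((A + g x : ℝ) : ℂ) ^ (-s)) := by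
    filter_upwards [hg0] with x hx
    have hpos : 0 < A + g x := by linarith
    have h := Complex.integral_cpow_mul_exp_neg_mul_Ioi (a := s) (r := A + g x) hs hpos
    rw [one_div_cpow_of_pos hpos] at h
    rw [show Complex.Gamma s * (w x * ((A + g x : ℝ) : ℂ) ^ (-s)) =
      w x * (((A + g x : ℝ) : ℂ) ^ (-s) * Complex.Gamma s) by ring, ← h, ← integral_const_mul]
    congr 1
    funext t
    simp only [hΦ]
    rw [show -(((A + g x : ℝ) : ℂ) * (t : ℂ)) = -(A * t) + -((t * g x : ℝ) : ℂ) by push_cast; ring,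
      Complex.exp_add]
    ring
  have houter : ∀ t ∈ Set.Ioi (0 : ℝ), ∫ x, Φ (t, x) ∂μ =
      c * ((t : ℂ) ^ (s - a - 1) * Complex.exp (-(A * t))) := by
    intro t ht
    have ht' : (t : ℂ) ≠ 0 := by exact_mod_cast (ne_of_gt ht)
    simp only [hΦ, integral_const_mul]
    rw [hval t ht, show s - a - 1 = (s - 1) + (-a) by ring, Complex.cpow_add _ _ ht']
    ring
  have hright := (hI.integral_prod_right).congr hinner
  constructor
  · have := hright.const_mul (Complex.Gamma s)⁻¹
    refine this.congr (Filter.Eventually.of_forall fun x => ?_)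
    simp only []
    rw [← mul_assoc, inv_mul_cancel₀ hΓ, one_mul]
  · have h1 := integral_integral_swap (f := fun t x => Φ (t, x)) hI
    rw [integral_congr_ae hinner, integral_const_mul,
      setIntegral_congr_fun measurableSet_Ioi houter, integral_const_mul] at h1
    have h := Complex.integral_cpow_mul_exp_neg_mul_Ioi (a := s - a) (r := A)
      (by simpa using has) hA
    rw [h, one_div_cpow_of_pos hA] at h1
    rw [← mul_right_inj' hΓ, ← h1, neg_sub]
    field_simp

/-- The beta integral over the half-line. -/
theorem integral_cpow_mul_one_add_cpow_neg {a b : ℂ} (ha : 0 < a.re) (hb : 0 < b.re) :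
    IntegrableOn (fun x : ℝ => (x : ℂ) ^ (a - 1) * ((1 + x : ℝ) : ℂ) ^ (-(a + b))) (Set.Ioi 0) ∧
      ∫ x : ℝ in Set.Ioi 0, (x : ℂ) ^ (a - 1) * ((1 + x : ℝ) : ℂ) ^ (-(a + b)) =
        Complex.Gamma a * Complex.Gamma b / Complex.Gamma (a + b) := by
  have key : ∀ t : ℝ, 0 < t → ∀ x : ℝ, (x : ℂ) ^ (a - 1) * Complex.exp (-(t * x : ℝ)) =
      (x : ℂ) ^ (a - 1) * Complex.exp (-((t : ℂ) * x)) := by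
    intro t ht x; push_cast; rfl
  have hn : ∀ t : ℝ, ∀ x ∈ Set.Ioi (0 : ℝ), x ^ (a.re - 1) * Real.exp (-(t * x)) =
      ‖(x : ℂ) ^ (a - 1) * Complex.exp (-(t * x : ℝ))‖ := by
    intro t x hx
    rw [norm_mul, Complex.norm_cpow_eq_rpow_re_of_pos hx, Complex.norm_exp]
    simp
  have hm : Measurable fun x : ℝ => (x : ℂ) ^ (a - 1) := by fun_prop
  -- Here `g x = x` and `w x = x ^ (a - 1)`, whose Laplace transform is `Γ(a) t ^ (-a)`; the
  -- resulting quotient `Γ(s - a) / Γ(s)` with `s = a + b` is the beta function.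
  have := integral_mul_add_cpow_neg (μ := volume.restrict (Set.Ioi (0 : ℝ))) (g := fun x => x)
    (w := fun x => (x : ℂ) ^ (a - 1)) (a := a) (s := a + b) (c := Complex.Gamma a)
    (c' := Real.Gamma a.re) measurable_id hm
    (by filter_upwards [ae_restrict_mem measurableSet_Ioi] with x hx using le_of_lt hx)
    (by simp; linarith) (by simp; linarith) (fun t ht => ?_) (fun t ht => ?_) (fun t ht => ?_)
    one_pos
  · simpa [mul_div_assoc, IntegrableOn] using this
  · have h := integrableOn_rpow_mul_exp_neg_mul ht ha
    refine Integrable.mono' h (by fun_prop) ?_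
    filter_upwards [ae_restrict_mem measurableSet_Ioi] with x hx
    rw [hn t x hx]
  · simp only [key t ht]
    rw [Complex.integral_cpow_mul_exp_neg_mul_Ioi ha ht,
      one_div_cpow_of_pos ht, mul_comm]
  · rw [← setIntegral_congr_fun measurableSet_Ioi (hn t),
      Real.integral_rpow_mul_exp_neg_mul_Ioi ha ht, one_div, Real.inv_rpow ht.le,
      Real.rpow_neg ht.le, mul_comm]

/-! ### Gaussian and radial integrals over both fields -/

/-- The properties of the scalar fields `ℝ` and `ℂ` that are used below: the volume is a Haar
measure, normalized by the Gaussian integral, and the norm over `ℝ` is a power of the absolute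
value. -/
class StandardScalars (𝕜 : Type*) [RCLike 𝕜] [MeasureSpace 𝕜] : Prop where
  borel : BorelSpace 𝕜
  haar : (volume : Measure 𝕜).IsAddHaarMeasure
  gaussian : ∀ t : ℝ, 0 < t →
    ∫ z : 𝕜, Real.exp (-(t * ‖z‖ ^ 2)) = (Real.pi / t) ^ (Module.finrank ℝ 𝕜 / 2 : ℝ)
  abs_norm : ∀ z : 𝕜, |Algebra.norm ℝ z| = ‖z‖ ^ Module.finrank ℝ 𝕜

attribute [instance] StandardScalars.borel StandardScalars.haar

theorem integral_gaussian_of_innerProductSpace (V : Type*) [NormedAddCommGroup V]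
    [InnerProductSpace ℝ V] [FiniteDimensional ℝ V] [MeasurableSpace V] [BorelSpace V]
    (t : ℝ) (ht : 0 < t) :
    ∫ z : V, Real.exp (-(t * ‖z‖ ^ 2)) = (Real.pi / t) ^ (Module.finrank ℝ V / 2 : ℝ) := by
  simpa using GaussianFourier.integral_rexp_neg_mul_sq_norm (V := V) ht

instance : StandardScalars ℝ where
  borel := inferInstance
  haar := inferInstance
  gaussian := integral_gaussian_of_innerProductSpace ℝ
  abs_norm z := by simp [Algebra.norm_self]

instance : StandardScalars ℂ where
  borel := inferInstance
  haar := inferInstance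
  gaussian := integral_gaussian_of_innerProductSpace ℂ
  abs_norm z := by
    rw [Algebra.norm_complex_apply, Complex.finrank_real_complex, Complex.normSq_eq_norm_sq,
      abs_of_nonneg (sq_nonneg _)]

theorem integral_prod_gaussian {𝕜 : Type*} [RCLike 𝕜] [MeasureSpace 𝕜] [StandardScalars 𝕜]
    (m : Type*) [Fintype m] (t : ℝ) (ht : 0 < t) :
    Integrable (fun z : m → 𝕜 => Real.exp (-(t * ∑ i, ‖z i‖ ^ 2))) ∧
      ∫ z : m → 𝕜, Real.exp (-(t * ∑ i, ‖z i‖ ^ 2)) =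
        Real.pi ^ (Module.finrank ℝ 𝕜 * Fintype.card m / 2 : ℝ) *
          t ^ (-(Module.finrank ℝ 𝕜 * Fintype.card m / 2 : ℝ)) := by
  have e : ∀ z : m → 𝕜, Real.exp (-(t * ∑ i, ‖z i‖ ^ 2)) =
      ∏ i, Real.exp (-(t * ‖z i‖ ^ 2)) := fun z => by
    rw [← Real.exp_sum, Finset.sum_neg_distrib, Finset.mul_sum]
  have hp : 0 < Real.pi / t := div_pos Real.pi_pos ht
  have hi : Integrable (fun z : 𝕜 => Real.exp (-(t * ‖z‖ ^ 2))) := by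
    refine Integrable.of_integral_ne_zero ?_
    rw [StandardScalars.gaussian t ht]
    exact (Real.rpow_pos_of_pos hp _).ne'
  simp only [e]
  refine ⟨Integrable.fintype_prod (fun _ => hi), ?_⟩
  rw [integral_fintype_prod_volume_eq_pow (fun z : 𝕜 => Real.exp (-(t * ‖z‖ ^ 2))),
    StandardScalars.gaussian t ht, ← Real.rpow_natCast, ← Real.rpow_mul hp.le,
    Real.div_rpow Real.pi_pos.le ht.le, Real.rpow_neg ht.le, div_mul_eq_mul_div, ← div_eq_mul_inv]

/-- The integral of a power of `A + |z|²` over `𝕜ᵐ`. -/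
theorem integral_add_sum_norm_sq_cpow_neg {𝕜 : Type*} [RCLike 𝕜] [MeasureSpace 𝕜]
    [StandardScalars 𝕜] (m : Type*) [Fintype m] {s : ℂ}
    (hs : 0 < s.re) (hm : (Module.finrank ℝ 𝕜 * Fintype.card m / 2 : ℝ) < s.re)
    {A : ℝ} (hA : 0 < A) :
    Integrable (fun z : m → 𝕜 => ((A + ∑ i, ‖z i‖ ^ 2 : ℝ) : ℂ) ^ (-s)) ∧
      ∫ z : m → 𝕜, ((A + ∑ i, ‖z i‖ ^ 2 : ℝ) : ℂ) ^ (-s) =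
        (Real.pi : ℂ) ^ (Module.finrank ℝ 𝕜 * Fintype.card m / 2 : ℂ) *
          (A : ℂ) ^ (Module.finrank ℝ 𝕜 * Fintype.card m / 2 - s : ℂ) *
          (Complex.Gamma (s - Module.finrank ℝ 𝕜 * Fintype.card m / 2) / Complex.Gamma s) := by
  set a : ℝ := Module.finrank ℝ 𝕜 * Fintype.card m / 2 with ha
  have hac : (Module.finrank ℝ 𝕜 * Fintype.card m / 2 : ℂ) = (a : ℂ) := by rw [ha]; push_cast; rfl
  rw [hac]
  have e : ∀ t : ℝ, ∀ z : m → 𝕜, (1 : ℂ) * Complex.exp (-(t * ∑ i, ‖z i‖ ^ 2 : ℝ)) =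
      ((Real.exp (-(t * ∑ i, ‖z i‖ ^ 2)) : ℝ) : ℂ) := fun t z => by
    rw [one_mul, Complex.ofReal_exp, Complex.ofReal_neg]
  have := integral_mul_add_cpow_neg (μ := (volume : Measure (m → 𝕜)))
    (g := fun z => ∑ i, ‖z i‖ ^ 2) (w := fun _ => 1) (a := a) (s := s)
    (c := (Real.pi : ℂ) ^ (a : ℂ)) (c' := Real.pi ^ a) (by fun_prop) measurable_const
    (Filter.Eventually.of_forall fun z => Finset.sum_nonneg fun i _ => sq_nonneg _)
    hs (by simpa using hm) (fun t ht => ?_) (fun t ht => ?_) (fun t ht => ?_) hA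
  · simpa using this
  · simp only [e]
    exact (integral_prod_gaussian m t ht).1.ofReal
  · simp only [e]
    rw [integral_complex_ofReal, (integral_prod_gaussian m t ht).2, ← ha, Complex.ofReal_mul,
      Complex.ofReal_cpow Real.pi_pos.le, Complex.ofReal_cpow ht.le, Complex.ofReal_neg]
  · simp only [e, Complex.norm_real, Real.norm_eq_abs, Real.abs_exp, Complex.ofReal_re]
    rw [(integral_prod_gaussian m t ht).2, ← ha]

end MatrixBeta

namespace MatrixBeta

/-! ### Cauchy's beta integral -/

open Complex Filter Topology FourierTransform

theorem one_add_mul_I_mem_slitPlane (t : ℝ) : (1 + t * I : ℂ) ∈ slitPlane := Or.inl (by simp)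

theorem one_add_mul_I_ne_zero (t : ℝ) : (1 + t * I : ℂ) ≠ 0 :=
  slitPlane_ne_zero (one_add_mul_I_mem_slitPlane t)

theorem hasDerivAt_one_add_mul_I_cpow (a : ℂ) (s : ℝ) :
    HasDerivAt (fun s : ℝ => (1 + s * I : ℂ) ^ a) (a * (1 + s * I) ^ (a - 1) * I) s := by
  have h : HasDerivAt (fun s : ℂ => (1 + s * I : ℂ)) I s := by
    simpa using ((hasDerivAt_id (s : ℂ)).mul_const I).const_add 1
  exact (h.cpow_const (one_add_mul_I_mem_slitPlane s)).comp_ofReal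

theorem hasDerivAt_one_sub_mul_I_cpow (a : ℂ) (s : ℝ) :
    HasDerivAt (fun s : ℝ => (1 - s * I : ℂ) ^ a) (-(a * (1 - s * I) ^ (a - 1) * I)) s := by
  have h := (hasDerivAt_one_add_mul_I_cpow a (-s)).scomp s (hasDerivAt_neg s)
  simpa [Function.comp_def, ← sub_eq_add_neg] using h

theorem continuous_one_add_mul_I_cpow (a : ℂ) : Continuous fun s : ℝ => (1 + s * I : ℂ) ^ a :=
  continuous_iff_continuousAt.2 fun s => (hasDerivAt_one_add_mul_I_cpow a s).continuousAt

theorem continuous_one_sub_mul_I_cpow (a : ℂ) : Continuous fun s : ℝ => (1 - s * I : ℂ) ^ a :=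
  continuous_iff_continuousAt.2 fun s => (hasDerivAt_one_sub_mul_I_cpow a s).continuousAt

/-- The Gamma integrand twisted by a character of the additive group. -/
theorem norm_cpow_mul_exp_neg_mul {a : ℂ} {t s : ℝ} (ht : 0 < t) :
    ‖(t : ℂ) ^ a * exp (-((1 + s * I) * t))‖ = t ^ a.re * Real.exp (-t) := by
  rw [norm_mul, norm_cpow_eq_rpow_re_of_pos ht, norm_exp]
  simp

theorem integrableOn_cpow_mul_exp_neg_mul {a : ℂ} (ha : 0 < a.re) (s : ℝ) :
    IntegrableOn (fun t : ℝ => (t : ℂ) ^ (a - 1) * exp (-((1 + s * I) * t))) (Set.Ioi 0) := by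
  have h := integrableOn_rpow_mul_exp_neg_mul one_pos ha
  refine Integrable.mono' h (by fun_prop) ?_
  filter_upwards [ae_restrict_mem measurableSet_Ioi] with t ht
  rw [norm_cpow_mul_exp_neg_mul ht]
  simp

/-- The derivative of `t ^ a e ^ (-(1 + is) t)` integrates to zero over the half-line, both boundary
values being zero. -/
theorem integral_cpow_mul_exp_neg_mul_succ {a : ℂ} (ha : 0 < a.re) (s : ℝ) :
    (1 + s * I) * ∫ t : ℝ in Set.Ioi 0, (t : ℂ) ^ a * exp (-((1 + s * I) * t)) =
      a * ∫ t : ℝ in Set.Ioi 0, (t : ℂ) ^ (a - 1) * exp (-((1 + s * I) * t)) := by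
  have ha0 : a ≠ 0 := fun h => by simp [h] at ha
  have h1 := integrableOn_cpow_mul_exp_neg_mul ha s
  have h2 := integrableOn_cpow_mul_exp_neg_mul (a := a + 1) (by simp; linarith) s
  rw [add_sub_cancel_right] at h2
  have hd : ∀ t ∈ Set.Ioi (0 : ℝ), HasDerivAt
      (fun t : ℝ => (t : ℂ) ^ a * exp (-((1 + s * I) * t)))
      (a * ((t : ℂ) ^ (a - 1) * exp (-((1 + s * I) * t))) -
        (1 + s * I) * ((t : ℂ) ^ a * exp (-((1 + s * I) * t)))) t := by
    intro t ht
    have e1 : HasDerivAt (fun t : ℝ => (t : ℂ) ^ a) (a * (t : ℂ) ^ (a - 1)) t := by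
      have := (hasDerivAt_id (t : ℂ)).cpow_const (c := a) (Or.inl (by simpa using ht))
      simpa using this.comp_ofReal
    have e2 : HasDerivAt (fun t : ℝ => exp (-((1 + s * I) * (t : ℂ))))
        (exp (-((1 + s * I) * t)) * (-(1 + s * I))) t := by
      have : HasDerivAt (fun t : ℂ => -((1 + s * I) * t)) (-(1 + s * I)) (t : ℂ) := by
        simpa using ((hasDerivAt_id (t : ℂ)).const_mul (1 + s * I : ℂ)).fun_neg
      exact this.cexp.comp_ofReal
    convert! e1.mul e2 using 1
    ring
  have hc : ContinuousWithinAt (fun t : ℝ => (t : ℂ) ^ a * exp (-((1 + s * I) * t)))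
      (Set.Ici 0) 0 := by
    have : ContinuousAt (fun t : ℝ => (t : ℂ) ^ a) 0 :=
      continuousAt_ofReal_cpow_const _ _ (Or.inl ha)
    exact (this.mul (by fun_prop)).continuousWithinAt
  have hlim : Tendsto (fun t : ℝ => (t : ℂ) ^ a * exp (-((1 + s * I) * t))) atTop (𝓝 0) := by
    have h := tendsto_rpow_mul_exp_neg_mul_atTop_nhds_zero a.re 1 one_pos
    refine squeeze_zero_norm' ?_ h
    filter_upwards [eventually_gt_atTop 0] with t ht
    rw [norm_cpow_mul_exp_neg_mul ht]
    simp
  have := integral_Ioi_of_hasDerivAt_of_tendsto hc hd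
    ((h1.const_mul a).sub (h2.const_mul (1 + s * I))) hlim
  rw [integral_sub (h1.const_mul a) (h2.const_mul (1 + s * I)), integral_const_mul,
    integral_const_mul] at this
  simp only [ofReal_zero, zero_cpow ha0, zero_mul, sub_zero] at this
  exact (sub_eq_zero.1 this).symm

theorem hasDerivAt_integral_cpow_mul_exp_neg_mul {a : ℂ} (ha : 0 < a.re) (s : ℝ) :
    HasDerivAt (fun s : ℝ => ∫ t : ℝ in Set.Ioi 0, (t : ℂ) ^ (a - 1) * exp (-((1 + s * I) * t)))
      (-I * ∫ t : ℝ in Set.Ioi 0, (t : ℂ) ^ a * exp (-((1 + s * I) * t))) s := by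
  have h2 := fun s => integrableOn_cpow_mul_exp_neg_mul (a := a + 1) (by simp; linarith) s
  simp only [add_sub_cancel_right] at h2
  rw [← integral_const_mul]
  -- The norm of the differentiated integrand does not depend on `s`, so its value at `s = 0` is a
  -- dominating function for all `s`.
  refine (hasDerivAt_integral_of_dominated_loc_of_deriv_le (s := Set.univ)
    (bound := fun t : ℝ => ‖(t : ℂ) ^ a * exp (-((1 + (0 : ℝ) * I) * t))‖)
    (F' := fun s t => -I * ((t : ℂ) ^ a * exp (-((1 + s * I) * t))))
    Filter.univ_mem
    (Filter.Eventually.of_forall fun s => (integrableOn_cpow_mul_exp_neg_mul ha s).1)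
    (integrableOn_cpow_mul_exp_neg_mul ha s)
    ((h2 s).const_mul _).1 ?_ (h2 0).norm ?_).2
  · filter_upwards [ae_restrict_mem measurableSet_Ioi] with t ht s _
    rw [norm_mul, norm_neg, norm_I, one_mul, norm_cpow_mul_exp_neg_mul ht,
      norm_cpow_mul_exp_neg_mul ht]
  · filter_upwards [ae_restrict_mem measurableSet_Ioi] with t ht s _
    have ht' : (t : ℂ) ≠ 0 := by exact_mod_cast (ne_of_gt ht)
    have h : HasDerivAt (fun s : ℝ => (-((1 + s * I) * t) : ℂ)) (-(I * t)) s := by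
      simpa using ((((hasDerivAt_id s).ofReal_comp.mul_const I).const_add 1).mul_const
        (t : ℂ)).fun_neg
    convert! h.cexp.const_mul ((t : ℂ) ^ (a - 1)) using 1
    nth_rewrite 1 [show a = (a - 1) + 1 by ring]
    rw [cpow_add _ _ ht', cpow_one]
    ring

/-- The Gamma integral along a ray. -/
theorem integral_cpow_mul_exp_neg_one_add_mul_I {a : ℂ} (ha : 0 < a.re) (s : ℝ) :
    ∫ t : ℝ in Set.Ioi 0, (t : ℂ) ^ (a - 1) * exp (-((1 + s * I) * t)) =
      Gamma a * (1 + s * I) ^ (-a) := by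
  -- Instead of rotating a contour, `(1 + is) ^ a` times the integral is shown to have derivative
  -- zero in `s`; at `s = 0` it is `Γ(a)`.
  set K : ℝ → ℂ := fun s => (1 + s * I : ℂ) ^ a *
    ∫ t : ℝ in Set.Ioi 0, (t : ℂ) ^ (a - 1) * exp (-((1 + s * I) * t)) with hK
  have hd : ∀ s, HasDerivAt K 0 s := by
    intro s
    convert! (hasDerivAt_one_add_mul_I_cpow a s).mul
      (hasDerivAt_integral_cpow_mul_exp_neg_mul ha s) using 1
    have h := integral_cpow_mul_exp_neg_mul_succ ha s
    nth_rewrite 4 [show a = (a - 1) + 1 by ring]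
    rw [cpow_add _ _ (one_add_mul_I_ne_zero s), cpow_one]
    linear_combination I * (1 + s * I : ℂ) ^ (a - 1) * h
  have hc : K s = K 0 := is_const_of_deriv_eq_zero (fun x => (hd x).differentiableAt)
    (fun x => (hd x).deriv) s 0
  have h0 : K 0 = Gamma a := by
    have := Complex.integral_cpow_mul_exp_neg_mul_Ioi (r := 1) ha one_pos
    simp only [hK]
    simpa using this
  rw [cpow_neg, ← h0, ← hc, hK]
  have : (1 + s * I : ℂ) ^ a ≠ 0 := by
    rw [Ne, cpow_eq_zero_iff]; exact fun h => one_add_mul_I_ne_zero s h.1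
  field_simp

end MatrixBeta

namespace MatrixBeta

section Cauchy

open Complex Filter Topology FourierTransform

/-! ### Cauchy's integral: bounds and contiguity in the exponents -/

/-- The integrand of Cauchy's beta integral. -/
noncomputable def cauchyIntegrand (σ τ : ℂ) (t : ℝ) : ℂ := (1 + t * I) ^ (-σ) * (1 - t * I) ^ (-τ)

theorem one_sub_mul_I_eq (t : ℝ) : (1 - t * I : ℂ) = 1 + (-t : ℝ) * I := by
  push_cast; ring

theorem cauchyIntegrand_neg (σ τ : ℂ) (t : ℝ) :
    cauchyIntegrand σ τ (-t) = cauchyIntegrand τ σ t := by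
  simp only [cauchyIntegrand, ofReal_neg, neg_mul, sub_neg_eq_add, ← sub_eq_add_neg]
  rw [mul_comm]

theorem continuous_cauchyIntegrand (σ τ : ℂ) : Continuous (cauchyIntegrand σ τ) :=
  (continuous_one_add_mul_I_cpow _).mul (continuous_one_sub_mul_I_cpow _)

/-- The argument of the base is bounded by `π`, so the imaginary part of the exponent costs only a
constant factor. -/
theorem norm_one_add_mul_I_cpow_le (a : ℂ) (t : ℝ) :
    ‖(1 + t * I : ℂ) ^ a‖ ≤ (1 + ‖t‖ ^ 2) ^ (a.re / 2) * Real.exp (Real.pi * |a.im|) := by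
  have hn : ‖(1 + t * I : ℂ)‖ = (1 + ‖t‖ ^ 2) ^ (1 / 2 : ℝ) := by
    have := Complex.norm_add_mul_I 1 t
    rw [ofReal_one] at this
    rw [this, Real.sqrt_eq_rpow]
    simp
  refine (norm_cpow_le _ _).trans ?_
  rw [hn, ← Real.rpow_mul (by positivity), div_eq_mul_inv, ← Real.exp_neg,
    show 1 / 2 * a.re = a.re / 2 by ring]
  refine mul_le_mul_of_nonneg_left (Real.exp_le_exp.2 ?_) (by positivity)
  calc -(arg (1 + t * I) * a.im) ≤ |arg (1 + t * I) * a.im| := neg_le_abs _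
    _ = |arg (1 + t * I)| * |a.im| := abs_mul _ _
    _ ≤ Real.pi * |a.im| := mul_le_mul_of_nonneg_right (abs_arg_le_pi _) (abs_nonneg _)

theorem norm_cauchyIntegrand_le (σ τ : ℂ) (t : ℝ) :
    ‖cauchyIntegrand σ τ t‖ ≤ Real.exp (Real.pi * |σ.im|) * Real.exp (Real.pi * |τ.im|) *
      (1 + ‖t‖ ^ 2) ^ (-((σ + τ).re) / 2) := by
  have h1 := norm_one_add_mul_I_cpow_le (-σ) t
  have h2 := norm_one_add_mul_I_cpow_le (-τ) (-t)
  rw [← one_sub_mul_I_eq] at h2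
  rw [norm_neg] at h2
  simp only [neg_re, neg_im, abs_neg] at h1 h2
  rw [cauchyIntegrand, norm_mul]
  refine (mul_le_mul h1 h2 (norm_nonneg _) (by positivity)).trans (le_of_eq ?_)
  rw [add_re, show -(σ.re + τ.re) / 2 = -σ.re / 2 + -τ.re / 2 by ring,
    Real.rpow_add (by positivity)]
  ring

theorem integrable_cauchyIntegrand {σ τ : ℂ} (h : 1 < (σ + τ).re) :
    Integrable (cauchyIntegrand σ τ) := by
  have := (integrable_rpow_neg_one_add_norm_sq (E := ℝ) (μ := volume) (r := (σ + τ).re)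
    (by simpa using h)).const_mul (Real.exp (Real.pi * |σ.im|) * Real.exp (Real.pi * |τ.im|))
  exact this.mono' (continuous_cauchyIntegrand σ τ).aestronglyMeasurable
    (Eventually.of_forall fun t => norm_cauchyIntegrand_le σ τ t)

theorem tendsto_one_add_sq_rpow {a : ℝ} (ha : a < 0) {l : Filter ℝ}
    (hl : Tendsto (fun t : ℝ => ‖t‖) l atTop) :
    Tendsto (fun t : ℝ => (1 + ‖t‖ ^ 2) ^ a) l (𝓝 0) := by
  have h1 : Tendsto (fun t : ℝ => 1 + ‖t‖ ^ 2) l atTop :=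
    tendsto_atTop_add_const_left _ _ ((tendsto_pow_atTop (by norm_num)).comp hl)
  have := (tendsto_rpow_neg_atTop (y := -a) (by linarith)).comp h1
  simpa [Function.comp_def] using this

/-- The function `(1 + it) ^ (-σ) (1 - it) ^ (1 - τ)` decays at both ends, so its derivative
integrates to zero; writing `1 - it = 2 - (1 + it)` turns this into a relation between neighbouring
exponents. -/
theorem integral_cauchyIntegrand_succ {σ τ : ℂ} (h : 1 < (σ + τ).re) :
    2 * σ * ∫ t, cauchyIntegrand (σ + 1) τ t = (σ + τ - 1) * ∫ t, cauchyIntegrand σ τ t := by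
  have i1 := integrable_cauchyIntegrand (σ := σ + 1) (τ := τ) (by simp at h ⊢; linarith)
  have i2 := integrable_cauchyIntegrand h
  have hd : ∀ t : ℝ, HasDerivAt (cauchyIntegrand σ (τ - 1))
      (-I * (2 * σ * cauchyIntegrand (σ + 1) τ t - (σ + τ - 1) * cauchyIntegrand σ τ t)) t := by
    intro t
    have hne : (1 - t * I : ℂ) ≠ 0 := by rw [one_sub_mul_I_eq]; exact one_add_mul_I_ne_zero _
    convert! (hasDerivAt_one_add_mul_I_cpow (-σ) t).mul
      (hasDerivAt_one_sub_mul_I_cpow (-(τ - 1)) t) using 1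
    simp only [cauchyIntegrand]
    have e1 := cpow_add (-(σ + 1)) 1 (one_add_mul_I_ne_zero t)
    have e2 := cpow_add (-τ) 1 hne
    rw [cpow_one, show -(σ + 1) + 1 = -σ by ring] at e1
    rw [cpow_one, show -τ + 1 = -(τ - 1) by ring] at e2
    rw [e1, e2, show -(τ - 1) - 1 = -τ by ring, show -σ - 1 = -(σ + 1) by ring]
    ring
  have hlim : ∀ l : Filter ℝ, Tendsto (fun t : ℝ => ‖t‖) l atTop →
      Tendsto (cauchyIntegrand σ (τ - 1)) l (𝓝 0) := by
    intro l hl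
    have := (tendsto_one_add_sq_rpow (a := -((σ + (τ - 1)).re) / 2)
      (by simp at h ⊢; linarith) hl).const_mul
      (Real.exp (Real.pi * |σ.im|) * Real.exp (Real.pi * |(τ - 1).im|))
    rw [mul_zero] at this
    exact squeeze_zero_norm (fun t => norm_cauchyIntegrand_le σ (τ - 1) t) this
  have := integral_of_hasDerivAt_of_tendsto hd
    (((i1.const_mul _).sub (i2.const_mul _)).const_mul _)
    (hlim _ tendsto_abs_atBot_atTop) (hlim _ tendsto_abs_atTop_atTop)
  rw [integral_const_mul, integral_sub (i1.const_mul _) (i2.const_mul _), integral_const_mul,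
    integral_const_mul, sub_zero, mul_eq_zero] at this
  exact sub_eq_zero.1 (this.resolve_left (by simp))

/-! ### Cauchy's integral by Fourier inversion -/

/-- The extension by zero of the Gamma integrand. -/
noncomputable def gammaDensity (a : ℂ) (t : ℝ) : ℂ :=
  (Set.Ioi (0 : ℝ)).indicator (fun t : ℝ => (t : ℂ) ^ (a - 1) * exp (-t)) t

theorem integrable_gammaDensity {a : ℂ} (ha : 0 < a.re) : Integrable (gammaDensity a) := by
  have := integrableOn_cpow_mul_exp_neg_mul ha 0
  simp only [ofReal_zero, zero_mul, add_zero, one_mul] at this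
  exact this.integrable_indicator measurableSet_Ioi

theorem continuous_gammaDensity {a : ℂ} (ha : 1 < a.re) : Continuous (gammaDensity a) := by
  have e : gammaDensity a = fun t : ℝ => ((max t 0 : ℝ) : ℂ) ^ (a - 1) * exp (-t) := by
    funext t
    by_cases ht : 0 < t
    · rw [gammaDensity, Set.indicator_of_mem (Set.mem_Ioi.2 ht), max_eq_left ht.le]
    · rw [gammaDensity, Set.indicator_of_notMem (by simpa using ht), max_eq_right (not_lt.1 ht),
        ofReal_zero, zero_cpow, zero_mul]
      intro h0
      have : a = 1 := sub_eq_zero.1 h0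
      simp [this] at ha
  rw [e]
  have h1 : Continuous fun x : ℝ => (x : ℂ) ^ (a - 1) :=
    continuous_iff_continuousAt.2 fun x =>
      continuousAt_ofReal_cpow_const _ _ (Or.inl (by simpa using ha))
  exact (h1.comp (continuous_id.max continuous_const)).mul (by fun_prop)

theorem fourier_gammaDensity {a : ℂ} (ha : 0 < a.re) (ξ : ℝ) :
    𝓕 (gammaDensity a) ξ = Gamma a * (1 + (2 * Real.pi * ξ : ℝ) * I) ^ (-a) := by
  rw [← integral_cpow_mul_exp_neg_one_add_mul_I ha, Real.fourier_real_eq_integral_exp_smul,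
    ← integral_indicator measurableSet_Ioi]
  congr 1
  funext t
  by_cases ht : t ∈ Set.Ioi (0 : ℝ)
  · rw [gammaDensity, Set.indicator_of_mem ht, Set.indicator_of_mem ht, smul_eq_mul,
      mul_left_comm, ← Complex.exp_add]
    congr 2
    push_cast
    ring
  · rw [gammaDensity, Set.indicator_of_notMem ht, Set.indicator_of_notMem ht, smul_zero]

theorem cauchyIntegrand_eq_fourier {σ τ : ℂ} (hσ : 0 < σ.re) (hτ : 0 < τ.re) (ξ : ℝ) :
    𝓕 (gammaDensity σ) ξ * 𝓕 (fun t => gammaDensity τ (-t)) ξ =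
      Gamma σ * Gamma τ * cauchyIntegrand σ τ (2 * Real.pi * ξ) := by
  have h : 𝓕 (fun t => gammaDensity τ (-t)) ξ = 𝓕 (gammaDensity τ) (-ξ) := by
    rw [← Real.fourierInv_eq_fourier_neg, Real.fourierInv_eq_fourier_comp_neg]
  rw [h, fourier_gammaDensity hσ, fourier_gammaDensity hτ, cauchyIntegrand,
    one_sub_mul_I_eq, mul_neg]
  ring

/-- The two factors are, up to `Γ(σ)` and `Γ(τ)`, Fourier transforms of Gamma densities, one of them
reflected. Moving one transform across the pairing and inverting it leaves the integral of the
product of two densities, a Gamma integral with rate `2`. The bounds `Re σ, Re τ > 1` are stronger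
than needed; `Re σ > 1` makes the density continuous and its transform integrable, as pointwise
inversion requires. -/
theorem integral_cauchyIntegrand_of_one_lt {σ τ : ℂ} (hσ : 1 < σ.re) (hτ : 1 < τ.re) :
    ∫ t, cauchyIntegrand σ τ t = 2 * Real.pi * (2 : ℂ) ^ (1 - σ - τ) *
      (Gamma (σ + τ - 1) * (Gamma σ)⁻¹ * (Gamma τ)⁻¹) := by
  have hσ0 : 0 < σ.re := by linarith
  have hτ0 : 0 < τ.re := by linarith
  have hΓσ := Gamma_ne_zero_of_re_pos hσ0
  have hΓτ := Gamma_ne_zero_of_re_pos hτ0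
  have hpi : (2 * Real.pi : ℝ) ≠ 0 := by positivity
  have hf := integrable_gammaDensity hσ0
  have hg : Integrable fun t => gammaDensity τ (-t) := (integrable_gammaDensity hτ0).comp_neg
  have hFf : Integrable (𝓕 (gammaDensity σ)) := by
    have h1 : Integrable fun t : ℝ => (1 + t * I : ℂ) ^ (-σ) := by
      have := integrable_cauchyIntegrand (σ := σ) (τ := 0) (by simpa using hσ)
      refine this.congr (Eventually.of_forall fun t => ?_)
      simp [cauchyIntegrand]
    have := (h1.comp_mul_left' hpi).const_mul (Gamma σ)
    refine this.congr (Eventually.of_forall fun ξ => ?_)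
    exact (fourier_gammaDensity hσ0 ξ).symm
  have hflip : ∫ ξ, 𝓕 (𝓕 (gammaDensity σ)) ξ • gammaDensity τ (-ξ) =
      ∫ ξ, 𝓕 (gammaDensity σ) ξ • 𝓕 (fun t => gammaDensity τ (-t)) ξ := by
    have := VectorFourier.integral_fourierIntegral_smul_eq_flip (L := innerₗ ℝ)
      (μ := volume) (ν := volume) Real.continuous_fourierChar continuous_inner hFf hg
    rwa [flip_innerₗ] at this
  have hinv : ∀ t, 𝓕 (𝓕 (gammaDensity σ)) t = gammaDensity σ (-t) := by
    intro t
    have := (continuous_gammaDensity hσ).fourierInv_fourier_eq hf hFf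
    have h2 := congrFun this (-t)
    rwa [Real.fourierInv_eq_fourier_neg, neg_neg] at h2
  simp only [hinv, smul_eq_mul, cauchyIntegrand_eq_fourier hσ0 hτ0] at hflip
  rw [integral_const_mul, Measure.integral_comp_mul_left (cauchyIntegrand σ τ),
    integral_neg_eq_self (fun t => gammaDensity σ t * gammaDensity τ t)] at hflip
  have hprod : ∫ t, gammaDensity σ t * gammaDensity τ t =
      (2 : ℂ) ^ (1 - σ - τ) * Gamma (σ + τ - 1) := by
    have h := Complex.integral_cpow_mul_exp_neg_mul_Ioi (a := σ + τ - 1) (r := 2)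
      (by simp; linarith) two_pos
    have e := one_div_cpow_of_pos (A := 2) two_pos (σ + τ - 1)
    push_cast at h e
    rw [e, show -(σ + τ - 1) = 1 - σ - τ by ring] at h
    rw [← h, ← integral_indicator measurableSet_Ioi]
    congr 1
    funext t
    by_cases ht : t ∈ Set.Ioi (0 : ℝ)
    · have ht' : (t : ℂ) ≠ 0 := by exact_mod_cast (ne_of_gt (Set.mem_Ioi.1 ht))
      rw [gammaDensity, gammaDensity, Set.indicator_of_mem ht, Set.indicator_of_mem ht,
        Set.indicator_of_mem ht, show σ + τ - 1 - 1 = (σ - 1) + (τ - 1) by ring,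
        cpow_add _ _ ht', show -(2 * (t : ℂ)) = -t + -t by ring, Complex.exp_add]
      ring
    · rw [gammaDensity, Set.indicator_of_notMem ht, Set.indicator_of_notMem ht, zero_mul]
  rw [hprod, abs_of_pos (by positivity), real_smul] at hflip
  have hpi' : (Real.pi : ℂ) ≠ 0 := by exact_mod_cast Real.pi_ne_zero
  push_cast at hflip
  field_simp at hflip ⊢
  linear_combination -hflip

theorem integral_cauchyIntegrand_symm (σ τ : ℂ) :
    ∫ t, cauchyIntegrand σ τ t = ∫ t, cauchyIntegrand τ σ t := by
  rw [← integral_neg_eq_self]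
  simp only [cauchyIntegrand_neg]

/-- Descent in the first exponent for Cauchy's beta integral. -/
theorem integral_cauchyIntegrand_of_succ {σ τ : ℂ} (h : 1 < (σ + τ).re)
    (hs : ∫ t, cauchyIntegrand (σ + 1) τ t = 2 * Real.pi * (2 : ℂ) ^ (1 - (σ + 1) - τ) *
      (Gamma (σ + 1 + τ - 1) * (Gamma (σ + 1))⁻¹ * (Gamma τ)⁻¹)) :
    ∫ t, cauchyIntegrand σ τ t = 2 * Real.pi * (2 : ℂ) ^ (1 - σ - τ) *
      (Gamma (σ + τ - 1) * (Gamma σ)⁻¹ * (Gamma τ)⁻¹) := by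
  have hne : σ + τ - 1 ≠ 0 := fun h0 => by
    have := congrArg Complex.re h0
    simp at this h
    linarith
  have h1 := integral_cauchyIntegrand_succ h
  -- This form of the functional equation also holds at the poles, where `Gamma` takes the value `0`
  -- and so its inverse is `0`. No case distinction on `σ` is needed.
  have h2 := one_div_Gamma_eq_self_mul_one_div_Gamma_add_one σ
  have h3 := Gamma_add_one (σ + τ - 1) hne
  have h4 : (2 : ℂ) ^ (1 - σ - τ) = (2 : ℂ) ^ (1 - (σ + 1) - τ) * 2 := by
    rw [show 1 - σ - τ = (1 - (σ + 1) - τ) + 1 by ring, cpow_add _ _ two_ne_zero, cpow_one]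
  rw [hs, show σ + 1 + τ - 1 = σ + τ - 1 + 1 by ring, h3] at h1
  rw [← mul_right_inj' hne, ← h1, h2, h4]
  ring

/-- **Cauchy's beta integral**. -/
theorem integral_cauchyIntegrand {σ τ : ℂ} (h : 1 < (σ + τ).re) :
    ∫ t, cauchyIntegrand σ τ t = 2 * Real.pi * (2 : ℂ) ^ (1 - σ - τ) *
      (Gamma (σ + τ - 1) * (Gamma σ)⁻¹ * (Gamma τ)⁻¹) := by
  -- The first exponent is freed of its bound while `Re τ > 1`; `step'` then frees the other one,
  -- using the symmetry under `t ↦ -t`. Only `Re (σ + τ) > 1` remains, and raising an exponent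
  -- preserves it.
  have step : ∀ k : ℕ, ∀ σ τ : ℂ, 1 < (σ + τ).re → 1 < σ.re + k → 1 < τ.re →
      ∫ t, cauchyIntegrand σ τ t = 2 * Real.pi * (2 : ℂ) ^ (1 - σ - τ) *
        (Gamma (σ + τ - 1) * (Gamma σ)⁻¹ * (Gamma τ)⁻¹) := by
    intro k
    induction k with
    | zero => exact fun σ τ _ h1 h2 => integral_cauchyIntegrand_of_one_lt (by simpa using h1) h2
    | succ k ih =>
      intro σ τ h h1 h2
      refine integral_cauchyIntegrand_of_succ h (ih _ _ ?_ ?_ h2)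
      · simp at h ⊢; linarith
      · push_cast at h1; simp; linarith
  have step' : ∀ k : ℕ, ∀ σ τ : ℂ, 1 < (σ + τ).re → 1 < σ.re + k →
      ∫ t, cauchyIntegrand τ σ t = 2 * Real.pi * (2 : ℂ) ^ (1 - τ - σ) *
        (Gamma (τ + σ - 1) * (Gamma τ)⁻¹ * (Gamma σ)⁻¹) := by
    intro k
    induction k with
    | zero =>
      intro σ τ h h1
      obtain ⟨m, hm⟩ := exists_nat_gt (1 - τ.re)
      exact step m τ σ (by rwa [add_comm]) (by linarith) (by simpa using h1)
    | succ k ih =>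
      intro σ τ h h1
      have := ih (σ + 1) τ (by simp at h ⊢; linarith) (by push_cast at h1; simp; linarith)
      rw [integral_cauchyIntegrand_symm] at this ⊢
      have := integral_cauchyIntegrand_of_succ h (this.trans ?_)
      · rw [this, show σ + τ - 1 = τ + σ - 1 by ring, show 1 - σ - τ = 1 - τ - σ by ring]
        ring
      · rw [show τ + (σ + 1) - 1 = σ + 1 + τ - 1 by ring,
          show 1 - τ - (σ + 1) = 1 - (σ + 1) - τ by ring]
        ring
  obtain ⟨m, hm⟩ := exists_nat_gt (1 - τ.re)
  exact step' m τ σ (by rwa [add_comm]) (by linarith)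

end Cauchy

end MatrixBeta

namespace MatrixBeta

/-! ### Dissipative matrices -/

section Dissipative

variable {𝕜 : Type*} [RCLike 𝕜] {m : Type*} [Fintype m] [DecidableEq m]

theorem re_dotProduct_mulVec_pos {m : Type*} [Fintype m] {A : Matrix m m 𝕜}
    (hA : (A + Aᴴ).PosDef) {x : m → 𝕜}
    (hx : x ≠ 0) : 0 < RCLike.re (star x ⬝ᵥ (A *ᵥ x)) := by
  have h := hA.re_dotProduct_pos hx
  have e : star x ⬝ᵥ (Aᴴ *ᵥ x) = star (star x ⬝ᵥ (A *ᵥ x)) := by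
    rw [star_dotProduct, star_mulVec, conjTranspose_conjTranspose, ← dotProduct_mulVec]
  rw [add_mulVec, dotProduct_add, e, map_add, RCLike.star_def, RCLike.conj_re] at h
  linarith

theorem det_ne_zero_of_dissipative {A : Matrix m m 𝕜} (hA : (A + Aᴴ).PosDef) : A.det ≠ 0 := by
  intro h0
  obtain ⟨x, hx, h⟩ := exists_mulVec_eq_zero_iff.2 h0
  have := re_dotProduct_mulVec_pos hA hx
  simp [h] at this

theorem isUnit_det_of_dissipative {A : Matrix m m 𝕜} (hA : (A + Aᴴ).PosDef) : IsUnit A.det :=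
  (det_ne_zero_of_dissipative hA).isUnit

/-- The dissipative matrices form a convex set containing `1`. The segment to `1` is the path along
which branches of logarithms, and signs of determinants, are compared. -/
theorem dissipative_segment {m : Type*} [DecidableEq m] {A : Matrix m m 𝕜}
    (hA : (A + Aᴴ).PosDef) {t : ℝ} (h0 : 0 ≤ t)
    (h1 : t ≤ 1) : ((1 + t • (A - 1)) + (1 + t • (A - 1))ᴴ).PosDef := by
  have e : (1 + t • (A - 1)) + (1 + t • (A - 1))ᴴ = t • (A + Aᴴ) +
      (1 - t) • (2 : Matrix m m 𝕜) := by
    rw [conjTranspose_add, conjTranspose_smul, conjTranspose_sub, conjTranspose_one, star_trivial,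
      ← one_add_one_eq_two]
    module
  have h2 : (2 : Matrix m m 𝕜).PosDef := PosDef.ofNat 2
  rw [e]
  have hcone : ∀ {s : ℝ} {B : Matrix m m 𝕜}, 0 < s → B.PosDef → (s • B).PosDef := by
    intro s B hs hB
    have := hB.smul (show (0 : 𝕜) < (s : 𝕜) by exact_mod_cast hs)
    rwa [RCLike.real_smul_eq_coe_smul (K := 𝕜)]
  rcases h0.eq_or_lt with rfl | h0
  · simpa using h2
  rcases h1.eq_or_lt with rfl | h1
  · simpa using hA
  exact (hcone h0 hA).add (hcone (by linarith) h2)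

/-- If `Re μ ≤ 0`, then `A - μ` is still dissipative, hence invertible, and `μ` is not an
eigenvalue. -/
theorem re_pos_of_mem_roots {A : Matrix m m ℂ} (hA : (A + Aᴴ).PosDef) {μ : ℂ}
    (hμ : μ ∈ A.charpoly.roots) : 0 < μ.re := by
  by_contra hneg
  rw [not_lt] at hneg
  have h0 : (Matrix.scalar m μ - A).det = 0 := by
    rw [← eval_charpoly]
    exact (Polynomial.mem_roots'.1 hμ).2
  have hp : ((A - Matrix.scalar m μ) + (A - Matrix.scalar m μ)ᴴ).PosDef := by
    have e : (A - Matrix.scalar m μ) + (A - Matrix.scalar m μ)ᴴ =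
        (A + Aᴴ) + diagonal fun _ => ((-(2 * μ.re) : ℝ) : ℂ) := by
      rw [conjTranspose_sub, scalar_apply, diagonal_conjTranspose,
        show (diagonal fun _ => ((-(2 * μ.re) : ℝ) : ℂ) : Matrix m m ℂ) =
          -(diagonal fun _ => μ) - diagonal (star fun _ => μ) by
          rw [diagonal_neg, diagonal_sub]
          congr 1
          funext i
          have := Complex.add_conj μ
          simp only [Pi.star_apply, RCLike.star_def]
          push_cast at this ⊢
          linear_combination this]
      abel
    rw [e]
    refine hA.add_posSemidef (PosSemidef.diagonal fun i => ?_)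
    simp only [Pi.zero_apply]
    exact_mod_cast (by linarith : (0 : ℝ) ≤ -(2 * μ.re))
  have := det_ne_zero_of_dissipative hp
  rw [← neg_sub, det_neg, h0, mul_zero] at this
  exact this rfl

theorem exp_logDet {A : Matrix m m ℂ} (hA : A.det ≠ 0) : Complex.exp (logDet A) = A.det := by
  rw [logDet, Complex.exp_multiset_sum, det_eq_prod_roots_charpoly, Multiset.map_map]
  congr 1
  conv_rhs => rw [← Multiset.map_id A.charpoly.roots]
  refine Multiset.map_congr rfl fun μ hμ => ?_
  have : μ ≠ 0 := by
    rintro rfl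
    rw [det_eq_prod_roots_charpoly] at hA
    exact hA (Multiset.prod_eq_zero hμ)
  simp [Complex.exp_log this]

theorem det_one_add_smul_sub_one (A : Matrix m m ℂ) (t : ℝ) :
    (1 + t • (A - 1)).det = (A.charpoly.roots.map fun μ => 1 + (t : ℂ) * (μ - 1)).prod := by
  have hcard : Multiset.card A.charpoly.roots = Fintype.card m := by
    rw [← (IsAlgClosed.splits A.charpoly).natDegree_eq_card_roots, charpoly_natDegree_eq_dim]
  rcases eq_or_ne t 0 with rfl | ht
  · simp
  have ht' : (-t : ℂ) ≠ 0 := by simpa using ht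
  have h := (IsAlgClosed.splits A.charpoly).eval_eq_prod_roots_of_monic (charpoly_monic A)
    ((1 - t) / (-t))
  rw [eval_charpoly] at h
  -- For `t ≠ 0` the determinant is thus a value of the characteristic polynomial, which splits into
  -- its roots with multiplicity.
  have e : 1 + t • (A - 1) = (-t : ℂ) • (Matrix.scalar m ((1 - t : ℂ) / (-t)) - A) := by
    ext i j
    simp only [Matrix.add_apply, Matrix.smul_apply, Matrix.sub_apply, scalar_apply,
      diagonal_apply, Matrix.one_apply, Complex.real_smul, smul_eq_mul]
    split_ifs <;> field_simp <;> ring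
  rw [e, det_smul, h, ← hcard, ← Multiset.prod_replicate, ← Multiset.map_const',
    ← Multiset.prod_map_mul]
  congr 1
  refine Multiset.map_congr rfl fun μ _ => ?_
  field_simp
  ring

/-- The logarithm of the determinant of `1 + t (A - 1)` in terms of the eigenvalues of `A`. -/
noncomputable def logDetPath (A : Matrix m m ℂ) (t : ℝ) : ℂ :=
  (A.charpoly.roots.map fun μ => Complex.log (1 + t * (μ - 1))).sum

theorem logDetPath_zero (A : Matrix m m ℂ) : logDetPath A 0 = 0 := by
  simp [logDetPath]

theorem logDetPath_one (A : Matrix m m ℂ) : logDetPath A 1 = logDet A := by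
  simp [logDetPath, logDet]

theorem segment_mem_slitPlane {μ : ℂ} (hμ : 0 < μ.re) {t : ℝ} (ht : t ∈ Set.Icc (0 : ℝ) 1) :
    1 + t * (μ - 1) ∈ Complex.slitPlane := by
  refine Or.inl ?_
  simp
  rcases ht.1.eq_or_lt with h | h
  · simp [← h]
  · nlinarith [ht.2, mul_pos h hμ]

theorem continuousOn_logDetPath {A : Matrix m m ℂ} (hA : (A + Aᴴ).PosDef) :
    ContinuousOn (logDetPath A) (Set.Icc 0 1) := by
  unfold logDetPath
  refine continuousOn_multiset_sum _ fun μ hμ => ?_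
  exact ContinuousOn.clog (by fun_prop) fun t ht =>
    segment_mem_slitPlane (re_pos_of_mem_roots hA hμ) ht

theorem exp_logDetPath {A : Matrix m m ℂ} (hA : (A + Aᴴ).PosDef) {t : ℝ}
    (ht : t ∈ Set.Icc (0 : ℝ) 1) :
    Complex.exp (logDetPath A t) = (1 + t • (A - 1)).det := by
  rw [logDetPath, Complex.exp_multiset_sum, det_one_add_smul_sub_one, Multiset.map_map]
  congr 1
  refine Multiset.map_congr rfl fun μ hμ => ?_
  exact Complex.exp_log
    (Complex.slitPlane_ne_zero (segment_mem_slitPlane (re_pos_of_mem_roots hA hμ) ht))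

/-- The values lie in the discrete group `2πiℤ`, and a continuous map from an interval to a discrete
set is constant. -/
theorem eq_zero_of_exp_eq_one {g : ℝ → ℂ} (hg : ContinuousOn g (Set.Icc 0 1)) (h0 : g 0 = 0)
    (h : ∀ t ∈ Set.Icc (0 : ℝ) 1, Complex.exp (g t) = 1) : g 1 = 0 := by
  rw [← h0]
  refine isPreconnected_Icc.constant_of_mapsTo
    (T := (AddSubgroup.zmultiples (2 * Real.pi * Complex.I : ℂ) : Set ℂ)) ?_ hg
    (fun t ht => ?_) (Set.right_mem_Icc.2 zero_le_one) (Set.left_mem_Icc.2 zero_le_one)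
  · exact isDiscrete_iff_discreteTopology.2 (NormedSpace.discreteTopology_zmultiples _)
  · obtain ⟨k, hk⟩ := Complex.exp_eq_one_iff.1 (h t ht)
    exact ⟨k, by simp [hk]⟩

end Dissipative

end MatrixBeta

namespace MatrixBeta

/-! ### Schur complements of matrices with a symplectic symmetry -/

section Symplectic

variable {𝕜 : Type*} [RCLike 𝕜] {n : ℕ}

/-- The symplectic form on `𝕜²`. -/
def J₂ (𝕜 : Type*) [CommRing 𝕜] : Matrix (Fin 2) (Fin 2) 𝕜 := !![0, -1; 1, 0]

/-- The block form of `J (n + 1)`. -/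
def JBlock (n : ℕ) (𝕜 : Type*) [CommRing 𝕜] :
    Matrix (Fin (2 * n + 2) ⊕ Fin 2) (Fin (2 * n + 2) ⊕ Fin 2) 𝕜 :=
  fromBlocks (J n 𝕜) 0 0 (J₂ 𝕜)

/-- The matrices `A` with `K⁻¹ Aᵗ K = A`. -/
def IsSymplecticSymm {m : Type*} [Fintype m] (K A : Matrix m m 𝕜) : Prop := Aᵀ * K = K * A

theorem J₂_mul_J₂ : J₂ 𝕜 * J₂ 𝕜 = -1 := by
  ext i j; fin_cases i <;> fin_cases j <;> simp [J₂]

theorem J₂_transpose : (J₂ 𝕜)ᵀ = -J₂ 𝕜 := by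
  ext i j; fin_cases i <;> fin_cases j <;> simp [J₂]

theorem JBlock_mul_JBlock : JBlock n 𝕜 * JBlock n 𝕜 = -1 := by
  rw [JBlock, fromBlocks_multiply]
  simp [J_mul_J, J₂_mul_J₂, ← fromBlocks_one, fromBlocks_neg]

theorem J_conjTranspose : (J n 𝕜)ᴴ = -J n 𝕜 := by
  rw [← J_transpose]
  ext i j
  simp only [J, conjTranspose_apply, transpose_apply, of_apply]
  split_ifs <;> simp

theorem JBlock_conjTranspose : (JBlock n 𝕜)ᴴ = -JBlock n 𝕜 := by
  rw [JBlock, fromBlocks_conjTranspose, J_conjTranspose, fromBlocks_neg]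
  congr 1
  · simp
  · simp
  · ext i j; fin_cases i <;> fin_cases j <;> simp [J₂]

namespace IsSymplecticSymm

variable {m : Type*} [Fintype m] {K A B : Matrix m m 𝕜}

theorem one [DecidableEq m] : IsSymplecticSymm K 1 := by simp [IsSymplecticSymm]

theorem add (hA : IsSymplecticSymm K A) (hB : IsSymplecticSymm K B) :
    IsSymplecticSymm K (A + B) := by
  rw [IsSymplecticSymm] at *
  rw [transpose_add, add_mul, mul_add, hA, hB]

theorem sub (hA : IsSymplecticSymm K A) (hB : IsSymplecticSymm K B) :
    IsSymplecticSymm K (A - B) := by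
  rw [IsSymplecticSymm] at *
  rw [transpose_sub, sub_mul, mul_sub, hA, hB]

theorem smul (hA : IsSymplecticSymm K A) (c : ℝ) : IsSymplecticSymm K (c • A) := by
  rw [IsSymplecticSymm] at *
  rw [transpose_smul, smul_mul_assoc, hA, mul_smul_comm]

theorem mul_eq [DecidableEq m] (hK : K * K = -1) (hA : IsSymplecticSymm K A) :
    A * K = K * Aᵀ := by
  have h : K * (Aᵀ * K) * K = K * (K * A) * K := congrArg (fun X => K * X * K) hA
  rw [mul_assoc, mul_assoc, hK, ← mul_assoc K K, hK] at h
  simpa using h.symm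

theorem conjTranspose [DecidableEq m] (hK : K * K = -1) (hK' : Kᴴ = -K)
    (hA : IsSymplecticSymm K A) : IsSymplecticSymm K Aᴴ := by
  have h := congrArg Matrix.conjTranspose (hA.mul_eq hK)
  rw [conjTranspose_mul, conjTranspose_mul, hK'] at h
  rw [neg_mul, mul_neg, neg_inj] at h
  exact h.symm

end IsSymplecticSymm

/-- Multiplied by `J₂`, such a matrix becomes antisymmetric of size `2`, hence a multiple of `J₂`.
Every Schur complement below therefore reduces to one scalar, and its determinant to a square. -/
theorem symm_fin_two {Z : Matrix (Fin 2) (Fin 2) 𝕜} (h : IsSymplecticSymm (J₂ 𝕜) Z) :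
    Z = Z 0 0 • (1 : Matrix (Fin 2) (Fin 2) 𝕜) := by
  have h00 := congrFun (congrFun h 0) 0
  have h01 := congrFun (congrFun h 0) 1
  have h11 := congrFun (congrFun h 1) 1
  simp [J₂, mul_apply, Fin.sum_univ_two] at h00 h01 h11
  have e1 : Z 1 0 = 0 := by
    have : (2 : 𝕜) * Z 1 0 = 0 := by linear_combination h00
    simpa using this
  have e2 : Z 0 1 = 0 := by
    have : (2 : 𝕜) * Z 0 1 = 0 := by linear_combination -h11
    simpa using this
  ext i j
  fin_cases i <;> fin_cases j <;> simp [e1, e2, h01]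

/-- The Schur complement of the upper left block. -/
noncomputable def schurCompl {m : Type*} [Fintype m] [DecidableEq m]
    (A : Matrix (m ⊕ Fin 2) (m ⊕ Fin 2) 𝕜) : Matrix (Fin 2) (Fin 2) 𝕜 :=
  A.toBlocks₂₂ - A.toBlocks₂₁ * A.toBlocks₁₁⁻¹ * A.toBlocks₁₂

variable {A : Matrix (Fin (2 * n + 2) ⊕ Fin 2) (Fin (2 * n + 2) ⊕ Fin 2) 𝕜}

theorem IsSymplecticSymm.blocks (hA : IsSymplecticSymm (JBlock n 𝕜) A) :
    IsSymplecticSymm (J n 𝕜) A.toBlocks₁₁ ∧ A.toBlocks₂₁ᵀ * J₂ 𝕜 = J n 𝕜 * A.toBlocks₁₂ ∧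
      A.toBlocks₁₂ᵀ * J n 𝕜 = J₂ 𝕜 * A.toBlocks₂₁ ∧ IsSymplecticSymm (J₂ 𝕜) A.toBlocks₂₂ := by
  rw [IsSymplecticSymm] at hA
  rw [← fromBlocks_toBlocks A, JBlock, fromBlocks_transpose, fromBlocks_multiply,
    fromBlocks_multiply, fromBlocks_inj] at hA
  simpa [IsSymplecticSymm] using hA

theorem IsSymplecticSymm.inv {m : Type*} [Fintype m] [DecidableEq m] {K A : Matrix m m 𝕜}
    (hA : IsSymplecticSymm K A) (hu : IsUnit A.det) : IsSymplecticSymm K A⁻¹ := by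
  have hu' : IsUnit Aᵀ.det := by rwa [det_transpose]
  have h : Aᵀ⁻¹ * (Aᵀ * K) * A⁻¹ = Aᵀ⁻¹ * (K * A) * A⁻¹ := congrArg (fun X => Aᵀ⁻¹ * X * A⁻¹) hA
  rw [nonsing_inv_mul_cancel_left _ _ hu', mul_assoc, mul_nonsing_inv_cancel_right _ _ hu] at h
  rw [IsSymplecticSymm, transpose_nonsing_inv, h]

theorem IsSymplecticSymm.schurCompl (hA : IsSymplecticSymm (JBlock n 𝕜) A)
    (hu : IsUnit A.toBlocks₁₁.det) : IsSymplecticSymm (J₂ 𝕜) (schurCompl A) := by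
  obtain ⟨h11, h21, h12, h22⟩ := hA.blocks
  have hi := h11.inv hu
  refine h22.sub ?_
  rw [IsSymplecticSymm] at hi ⊢
  rw [transpose_mul, transpose_mul, Matrix.mul_assoc, Matrix.mul_assoc, h21,
    ← Matrix.mul_assoc _ (J n 𝕜), hi, Matrix.mul_assoc (J n 𝕜), ← Matrix.mul_assoc _ (J n 𝕜), h12]
  simp only [Matrix.mul_assoc]

theorem det_eq_det_mul_schurCompl_sq (hA : IsSymplecticSymm (JBlock n 𝕜) A)
    (hu : IsUnit A.toBlocks₁₁.det) : A.det = A.toBlocks₁₁.det * (schurCompl A 0 0) ^ 2 := by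
  have := invertibleOfIsUnitDet _ hu
  conv_lhs => rw [← fromBlocks_toBlocks A, det_fromBlocks₁₁, invOf_eq_nonsing_inv]
  change _ * (MatrixBeta.schurCompl A).det = _
  conv_lhs => rw [symm_fin_two (hA.schurCompl hu)]
  simp

theorem re_schurCompl_pos {m : Type*} [Fintype m] [DecidableEq m]
    {A : Matrix (m ⊕ Fin 2) (m ⊕ Fin 2) 𝕜}
    (hA : (A + Aᴴ).PosDef) (hu : IsUnit A.toBlocks₁₁.det) :
    0 < RCLike.re (schurCompl A 0 0) := by
  -- This vector is chosen so that `A x` vanishes on the first block; the form of `A` at `x` is then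
  -- the upper left entry of the Schur complement.
  set x : m ⊕ Fin 2 → 𝕜 := Sum.elim (-(A.toBlocks₁₁⁻¹ *ᵥ (A.toBlocks₁₂ *ᵥ Pi.single 0 1)))
    (Pi.single 0 1) with hx
  have hx0 : x ≠ 0 := fun h => by simpa [hx] using congrFun h (Sum.inr 0)
  have hAx : A *ᵥ x = Sum.elim (0 : m → 𝕜) (schurCompl A *ᵥ Pi.single 0 1) := by
    conv_lhs => rw [← fromBlocks_toBlocks A, hx, fromBlocks_mulVec]
    rw [Sum.elim_comp_inl, Sum.elim_comp_inr, mulVec_neg, mulVec_mulVec _ A.toBlocks₁₁,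
      mul_nonsing_inv _ hu, one_mulVec, neg_add_cancel, schurCompl, sub_mulVec, mulVec_neg,
      neg_add_eq_sub, mulVec_mulVec, mulVec_mulVec]
  have h := re_dotProduct_mulVec_pos hA hx0
  rw [hAx] at h
  simpa [hx, dotProduct, Fin.sum_univ_two] using h

theorem posDef_toBlocks₁₁ {m : Type*} {A : Matrix (m ⊕ Fin 2) (m ⊕ Fin 2) 𝕜}
    (hA : A.PosDef) : A.toBlocks₁₁.PosDef :=
  hA.submatrix Sum.inl_injective

theorem dissipative_toBlocks₁₁ {m : Type*} {A : Matrix (m ⊕ Fin 2) (m ⊕ Fin 2) 𝕜}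
    (hA : (A + Aᴴ).PosDef) : (A.toBlocks₁₁ + A.toBlocks₁₁ᴴ).PosDef :=
  hA.submatrix Sum.inl_injective

theorem schurCompl_isHermitian {m : Type*} [Fintype m] [DecidableEq m]
    {A : Matrix (m ⊕ Fin 2) (m ⊕ Fin 2) 𝕜} (hA : A.IsHermitian) :
    (schurCompl A).IsHermitian := by
  have h := hA
  rw [← fromBlocks_toBlocks A, isHermitian_fromBlocks_iff] at h
  obtain ⟨h11, h12, h21, h22⟩ := h
  rw [IsHermitian, schurCompl, conjTranspose_sub, conjTranspose_mul, conjTranspose_mul,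
    conjTranspose_nonsing_inv, h11, h22, h12, h21, Matrix.mul_assoc]

/-- The Schur criterion: the remaining `2 × 2` block is a scalar. -/
theorem posDef_iff_schurCompl (hA : IsSymplecticSymm (JBlock n 𝕜) A) (hh : A.IsHermitian) :
    A.PosDef ↔ A.toBlocks₁₁.PosDef ∧ 0 < RCLike.re (schurCompl A 0 0) := by
  constructor
  · intro h
    have h2 : (A + Aᴴ).PosDef := by rw [hh]; exact h.add h
    have h11 := posDef_toBlocks₁₁ h
    exact ⟨h11, re_schurCompl_pos h2 h11.det_pos.ne'.isUnit⟩
  · rintro ⟨h11, hz⟩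
    have hu : IsUnit A.toBlocks₁₁.det := h11.det_pos.ne'.isUnit
    have hS := symm_fin_two (hA.schurCompl hu)
    have hz0 : schurCompl A 0 0 ≠ 0 := fun h => by simp [h] at hz
    have hre : (RCLike.re (schurCompl A 0 0) : 𝕜) = schurCompl A 0 0 :=
      RCLike.conj_eq_iff_re.1 ((schurCompl_isHermitian hh).apply 0 0)
    have hB : A.toBlocks₂₁ = A.toBlocks₁₂ᴴ := by
      have h := hh
      rw [← fromBlocks_toBlocks A, isHermitian_fromBlocks_iff] at h
      exact h.2.1.symm
    have hp : A.PosSemidef := by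
      have := invertibleOfIsUnitDet _ hu
      rw [← fromBlocks_toBlocks A, hB, PosDef.fromBlocks₁₁ _ _ h11, ← hB]
      change (schurCompl A).PosSemidef
      rw [hS, ← hre, smul_one_eq_diagonal]
      refine PosSemidef.diagonal fun i => ?_
      simp only [Pi.zero_apply]
      exact_mod_cast hz.le
    -- The block criterion yields semidefiniteness only; definiteness follows because the
    -- determinant does not vanish.
    rw [hp.posDef_iff_det_ne_zero, det_eq_det_mul_schurCompl_sq hA hu]
    exact mul_ne_zero hu.ne_zero (pow_ne_zero 2 hz0)

theorem continuousOn_schurCompl_segment {m : Type*} [Fintype m] [DecidableEq m]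
    {A : Matrix (m ⊕ Fin 2) (m ⊕ Fin 2) 𝕜} (hA : (A + Aᴴ).PosDef) (i j : Fin 2) :
    ContinuousOn (fun t : ℝ => schurCompl (1 + t • (A - 1)) i j) (Set.Icc 0 1) := by
  have hc : Continuous fun t : ℝ => (1 + t • (A - 1) : Matrix (m ⊕ Fin 2) (m ⊕ Fin 2) 𝕜) := by
    fun_prop
  have h11 : Continuous fun t : ℝ => (1 + t • (A - 1)).toBlocks₁₁ :=
    hc.matrix_submatrix Sum.inl Sum.inl
  have h12 : Continuous fun t : ℝ => (1 + t • (A - 1)).toBlocks₁₂ :=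
    hc.matrix_submatrix Sum.inl Sum.inr
  have h21 : Continuous fun t : ℝ => (1 + t • (A - 1)).toBlocks₂₁ :=
    hc.matrix_submatrix Sum.inr Sum.inl
  have h22 : Continuous fun t : ℝ => (1 + t • (A - 1)).toBlocks₂₂ :=
    hc.matrix_submatrix Sum.inr Sum.inr
  have hinv : ContinuousOn (fun t : ℝ => (1 + t • (A - 1)).toBlocks₁₁⁻¹) (Set.Icc 0 1) := by
    simp only [inv_def, Ring.inverse_eq_inv']
    refine ContinuousOn.smul (h11.matrix_det.continuousOn.inv₀ fun t ht => ?_)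
      h11.matrix_adjugate.continuousOn
    exact det_ne_zero_of_dissipative
      (dissipative_toBlocks₁₁ (dissipative_segment hA ht.1 ht.2))
  have : ContinuousOn (fun t : ℝ => schurCompl (1 + t • (A - 1))) (Set.Icc 0 1) := by
    unfold schurCompl
    exact h22.continuousOn.sub ((continuous_fst.matrix_mul continuous_snd).comp_continuousOn
      (((continuous_fst.matrix_mul continuous_snd).comp_continuousOn
        (h21.continuousOn.prodMk hinv)).prodMk h12.continuousOn))
  exact (continuous_apply_apply i j).comp_continuousOn this

end Symplectic

/-- Factorization of the logarithm of the determinant. -/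
theorem logDet_eq_add_log_schurCompl {n : ℕ}
    {A : Matrix (Fin (2 * n + 2) ⊕ Fin 2) (Fin (2 * n + 2) ⊕ Fin 2) ℂ}
    (hs : IsSymplecticSymm (JBlock n ℂ) A) (hA : (A + Aᴴ).PosDef) :
    logDet A = logDet A.toBlocks₁₁ + 2 * Complex.log (schurCompl A 0 0) := by
  have hA1 := dissipative_toBlocks₁₁ hA
  have hblock : ∀ t : ℝ, (1 + t • (A - 1)).toBlocks₁₁ = 1 + t • (A.toBlocks₁₁ - 1) := by
    intro t
    ext i j
    simp [toBlocks₁₁, Matrix.one_apply]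
  have hdiss := fun t (ht : t ∈ Set.Icc (0 : ℝ) 1) => dissipative_segment hA ht.1 ht.2
  have hu : ∀ t ∈ Set.Icc (0 : ℝ) 1, IsUnit (1 + t • (A - 1)).toBlocks₁₁.det := fun t ht =>
    isUnit_det_of_dissipative (dissipative_toBlocks₁₁ (hdiss t ht))
  have hre : ∀ t ∈ Set.Icc (0 : ℝ) 1, 0 < (schurCompl (1 + t • (A - 1)) 0 0).re := fun t ht =>
    re_schurCompl_pos (hdiss t ht) (hu t ht)
  -- The determinant identity makes the exponential of this difference equal to `1` along the whole
  -- path, and the difference is zero at `t = 0`. Principal logarithms are continuous here since all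
  -- their arguments have positive real part.
  have key := eq_zero_of_exp_eq_one (g := fun t : ℝ => logDetPath A t -
    (logDetPath A.toBlocks₁₁ t + 2 * Complex.log (schurCompl (1 + t • (A - 1)) 0 0))) ?_ ?_ ?_
  · simp only [logDetPath_one] at key
    simpa using sub_eq_zero.1 key
  · refine (continuousOn_logDetPath hA).sub ((continuousOn_logDetPath hA1).add
      (continuousOn_const.mul ((continuousOn_schurCompl_segment hA 0 0).clog fun t ht =>
        Or.inl (hre t ht))))
  · have : schurCompl (1 : Matrix (Fin (2 * n + 2) ⊕ Fin 2) (Fin (2 * n + 2) ⊕ Fin 2) ℂ) 0 0 =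
    1 := by
      have h12 : (1 : Matrix (Fin (2 * n + 2) ⊕ Fin 2) (Fin (2 * n + 2) ⊕ Fin 2) ℂ).toBlocks₁₂ =
        0 := by
        ext; simp [toBlocks₁₂]
      rw [schurCompl, h12, Matrix.mul_zero, sub_zero]
      simp [toBlocks₂₂]
    simp [logDetPath_zero, this]
  · intro t ht
    have hz : schurCompl (1 + t • (A - 1)) 0 0 ≠ 0 := fun h => by
      have := hre t ht
      simp [h] at this
    have hsymm : IsSymplecticSymm (JBlock n ℂ) (1 + t • (A - 1)) :=
      IsSymplecticSymm.one.add ((hs.sub IsSymplecticSymm.one).smul t)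
    have he : Complex.exp (2 * Complex.log (schurCompl (1 + t • (A - 1)) 0 0)) =
        schurCompl (1 + t • (A - 1)) 0 0 ^ 2 := by
      rw [← Nat.cast_two, Complex.exp_nat_mul, Complex.exp_log hz]
    rw [Complex.exp_sub, Complex.exp_add, exp_logDetPath hA ht, exp_logDetPath hA1 ht,
      ← hblock, det_eq_det_mul_schurCompl_sq hsymm (hu t ht), he]
    exact div_self (mul_ne_zero (hu t ht).ne_zero (pow_ne_zero 2 hz))

end MatrixBeta

namespace MatrixBeta

/-! ### Splitting off the last two rows and columns -/

section Splitting

variable {𝕜 : Type*} [RCLike 𝕜] {n : ℕ}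

/-- The positions of the last two columns and the positions of the upper left block. -/
def coordSum (n : ℕ) :
    Coord n ⊕ (((Fin (2 * n + 1) ⊕ Fin (2 * n + 1)) ⊕ Unit)) → Coord (n + 1)
  | Sum.inl p => ⟨(⟨p.1.1, by have := p.1.1.2; omega⟩, ⟨p.1.2, by have := p.1.2.2; omega⟩),
      p.2.1, p.2.2⟩
  | Sum.inr (Sum.inl (Sum.inl k)) => ⟨(⟨k + 1, by omega⟩, ⟨2 * n + 2, by omega⟩), by simp,
      by simp [Fin.lt_def]; omega⟩
  | Sum.inr (Sum.inl (Sum.inr k)) => ⟨(⟨k + 1, by omega⟩, ⟨2 * n + 3, by omega⟩), by simp,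
      by simp [Fin.lt_def]; omega⟩
  | Sum.inr (Sum.inr _) => ⟨(⟨2 * n + 2, by omega⟩, ⟨2 * n + 3, by omega⟩), by simp,
      by simp [Fin.lt_def]⟩

theorem coordSum_bijective (n : ℕ) : Function.Bijective (coordSum n) := by
  constructor
  · intro a b h
    have h1 : ((coordSum n a).1.1 : ℕ) = (coordSum n b).1.1 := by rw [h]
    have h2 : ((coordSum n a).1.2 : ℕ) = (coordSum n b).1.2 := by rw [h]
    rcases a with p | (k | k) | k <;> rcases b with q | (l | l) | l <;>
      simp only [coordSum] at h1 h2
    · exact congrArg Sum.inl (Subtype.ext (Prod.ext (Fin.ext h1) (Fin.ext h2)))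
    all_goals first
      | (exfalso
         omega)
      | rfl
      | (have : k = l := Fin.ext (by omega)
         rw [this])
  · rintro ⟨⟨⟨i, hi⟩, ⟨j, hj⟩⟩, h1, h2⟩
    replace h1 : 1 ≤ i := h1
    replace h2 : i < j := h2
    by_cases hj2 : j < 2 * n + 2
    · exact ⟨Sum.inl ⟨(⟨i, by omega⟩, ⟨j, hj2⟩), h1, h2⟩, rfl⟩
    by_cases hi2 : i < 2 * n + 2
    · rcases (by omega : j = 2 * n + 2 ∨ j = 2 * n + 3) with rfl | rfl
      · exact ⟨Sum.inr (Sum.inl (Sum.inl ⟨i - 1, by omega⟩)),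
          Subtype.ext (Prod.ext (Fin.ext (Nat.sub_add_cancel h1)) rfl)⟩
      · exact ⟨Sum.inr (Sum.inl (Sum.inr ⟨i - 1, by omega⟩)),
          Subtype.ext (Prod.ext (Fin.ext (Nat.sub_add_cancel h1)) rfl)⟩
    · refine ⟨Sum.inr (Sum.inr ()), ?_⟩
      simp only [coordSum, Subtype.mk.injEq, Prod.mk.injEq, Fin.mk.injEq]
      omega

/-- The equivalence given by `coordSum`. -/
noncomputable def coordEquiv (n : ℕ) :
    Coord n ⊕ (((Fin (2 * n + 1) ⊕ Fin (2 * n + 1)) ⊕ Unit)) ≃ Coord (n + 1) :=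
  Equiv.ofBijective _ (coordSum_bijective n)

/-- The equivalence of the row indices. -/
def blockEquiv (n : ℕ) : Fin (2 * n + 2) ⊕ Fin 2 ≃ Fin (2 * (n + 1) + 2) := finSumFinEquiv

theorem blockEquiv_inl (i : Fin (2 * n + 2)) : (blockEquiv n (Sum.inl i) : ℕ) = i := rfl

theorem blockEquiv_inr (c : Fin 2) : (blockEquiv n (Sum.inr c) : ℕ) = 2 * n + 2 + c := rfl

/-- The two columns with vanishing zeroth entry. -/
def twoColumns (v : Fin (2 * n + 1) ⊕ Fin (2 * n + 1) → 𝕜) : Matrix (Fin (2 * n + 2)) (Fin 2) 𝕜 :=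
  of fun i => ![Fin.cons (α := fun _ => 𝕜) 0 (fun k => v (Sum.inl k)) i,
    Fin.cons (α := fun _ => 𝕜) 0 (fun k => v (Sum.inr k)) i]

/-- The matrix `R` with the upper left block `P`. -/
def extend (P : Matrix (Fin (2 * n + 2)) (Fin (2 * n + 2)) 𝕜)
    (v : Fin (2 * n + 1) ⊕ Fin (2 * n + 1) → 𝕜) (y : 𝕜) :
    Matrix (Fin (2 * n + 2) ⊕ Fin 2) (Fin (2 * n + 2) ⊕ Fin 2) 𝕜 :=
  fromBlocks P (-(J n 𝕜 * twoColumns v)) (J₂ 𝕜 * (twoColumns v)ᵀ) ((-y) • 1)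

theorem J_submatrix_blockEquiv :
    (J (n + 1) 𝕜).submatrix (blockEquiv n) (blockEquiv n) = JBlock n 𝕜 := by
  ext i j
  rcases i with i | i <;> rcases j with j | j <;>
    simp only [submatrix_apply, JBlock, fromBlocks_apply₁₁, fromBlocks_apply₁₂,
      fromBlocks_apply₂₁, fromBlocks_apply₂₂, J, of_apply, blockEquiv_inl, blockEquiv_inr]
  · rfl
  · have := i.2
    have := j.2
    simp only [Matrix.zero_apply]
    grind
  · have := i.2
    have := j.2
    simp only [Matrix.zero_apply]
    grind
  · have he : Even (2 * n + 2) := ⟨n + 1, by ring⟩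
    have ho : ¬ Even (2 * n + 2 + 1) := by rw [Nat.even_add_one]; simpa using he
    fin_cases i <;> fin_cases j <;> simp [J₂, he, ho]

theorem skew_submatrix_blockEquiv (x : Coord (n + 1) → 𝕜) :
    (skew x).submatrix (blockEquiv n) (blockEquiv n) =
      fromBlocks (skew fun p => x (coordEquiv n (Sum.inl p)))
        (twoColumns fun k => x (coordEquiv n (Sum.inr (Sum.inl k))))
        (-(twoColumns fun k => x (coordEquiv n (Sum.inr (Sum.inl k))))ᵀ)
        (x (coordEquiv n (Sum.inr (Sum.inr ()))) • !![0, 1; -1, 0]) := by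
  have h12 : ∀ (i : Fin (2 * n + 2)) (c : Fin 2),
      skew x (blockEquiv n (Sum.inl i)) (blockEquiv n (Sum.inr c)) =
        twoColumns (fun k => x (coordEquiv n (Sum.inr (Sum.inl k)))) i c := by
    intro i c
    refine Fin.cases ?_ (fun k => ?_) i
    · have : (blockEquiv n (Sum.inl 0)) = 0 := rfl
      rw [this, skew_zero, if_neg]
      · fin_cases c <;> simp [twoColumns]
      · intro h
        have := congrArg Fin.val h
        rw [blockEquiv_inr, Fin.val_one] at this
        omega
    · have hlt : 1 ≤ ((blockEquiv n (Sum.inl k.succ) : Fin (2 * (n + 1) + 2)) : ℕ) ∧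
          blockEquiv n (Sum.inl k.succ) < blockEquiv n (Sum.inr c) := by
        rw [Fin.lt_def, blockEquiv_inl, blockEquiv_inr, Fin.val_succ]
        have := k.2
        omega
      simp only [skew, of_apply, dif_pos hlt]
      fin_cases c <;> rfl
  ext i j
  rcases i with i | i <;> rcases j with j | j <;>
    simp only [submatrix_apply, fromBlocks_apply₁₁, fromBlocks_apply₁₂,
      fromBlocks_apply₂₁, fromBlocks_apply₂₂]
  · simp only [skew, of_apply, blockEquiv_inl, Fin.lt_def, Fin.ext_iff]
    rfl
  · exact h12 i j
  · rw [Matrix.neg_apply, transpose_apply, ← h12]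
    have := congrFun (congrFun (skew_transpose x) (blockEquiv n (Sum.inl j)))
      (blockEquiv n (Sum.inr i))
    exact this
  · have hs := congrFun (congrFun (skew_transpose x) (blockEquiv n (Sum.inr i)))
      (blockEquiv n (Sum.inr j))
    rw [transpose_apply, Matrix.neg_apply] at hs
    have h01 : skew x (blockEquiv n (Sum.inr 0)) (blockEquiv n (Sum.inr 1)) =
        x (coordEquiv n (Sum.inr (Sum.inr ()))) := by
      have hlt : 1 ≤ ((blockEquiv n (Sum.inr 0) : Fin (2 * (n + 1) + 2)) : ℕ) ∧
          blockEquiv n (Sum.inr 0) < blockEquiv n (Sum.inr 1) := by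
        rw [Fin.lt_def, blockEquiv_inr, blockEquiv_inr]
        simp
      simp only [skew, of_apply, dif_pos hlt]
      rfl
    fin_cases i <;> fin_cases j
    · simpa using self_eq_neg.1 hs
    · simpa using h01
    · simp only [Fin.mk_one, Fin.zero_eta] at hs ⊢
      rw [← neg_eq_iff_eq_neg.2 hs, h01]
      simp
    · simpa using self_eq_neg.1 hs

theorem ofCoord_submatrix_blockEquiv (x : Coord (n + 1) → 𝕜) :
    (ofCoord x).submatrix (blockEquiv n) (blockEquiv n) =
      extend (ofCoord fun p => x (coordEquiv n (Sum.inl p)))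
        (fun k => x (coordEquiv n (Sum.inr (Sum.inl k))))
        (x (coordEquiv n (Sum.inr (Sum.inr ())))) := by
  have h2 : J₂ 𝕜 * !![0, 1; -1, 0] = 1 := by
    ext i j; fin_cases i <;> fin_cases j <;> simp [J₂]
  rw [ofCoord, J_inv, ← submatrix_mul_equiv _ _ _ (blockEquiv n), submatrix_neg,
    Pi.neg_apply, Pi.neg_apply, J_submatrix_blockEquiv, skew_submatrix_blockEquiv, JBlock,
      extend, ofCoord, J_inv,
    fromBlocks_neg, fromBlocks_multiply]
  congr 1
  · simp
  · simp
  · simp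
  · rw [neg_zero, Matrix.zero_mul, zero_add, Matrix.neg_mul, Matrix.mul_smul, h2, neg_smul]

theorem isSymplecticSymm_ofCoord (x : Coord n → 𝕜) : IsSymplecticSymm (J n 𝕜) (ofCoord x) := by
  have h := skew_transpose x
  rw [← J_mul_ofCoord, transpose_mul, J_transpose, Matrix.mul_neg, neg_inj] at h
  exact h

theorem isSymplecticSymm_extend {P : Matrix (Fin (2 * n + 2)) (Fin (2 * n + 2)) 𝕜}
    (hP : IsSymplecticSymm (J n 𝕜) P) (v : Fin (2 * n + 1) ⊕ Fin (2 * n + 1) → 𝕜) (y : 𝕜) :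
    IsSymplecticSymm (JBlock n 𝕜) (extend P v y) := by
  rw [IsSymplecticSymm] at hP
  rw [IsSymplecticSymm, extend, JBlock, fromBlocks_transpose, fromBlocks_multiply,
    fromBlocks_multiply]
  congr 1
  · simpa using hP
  · rw [transpose_mul, transpose_transpose, J₂_transpose, Matrix.mul_assoc, Matrix.neg_mul,
      J₂_mul_J₂, Matrix.mul_neg (J n 𝕜), ← Matrix.mul_assoc, J_mul_J]
    simp
  · rw [transpose_neg, transpose_mul, J_transpose, ← Matrix.mul_assoc, J₂_mul_J₂, Matrix.neg_mul,
      Matrix.mul_assoc, Matrix.neg_mul, J_mul_J]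
    simp
  · simp

/-- The first column of the upper right block of `extend P v y`. -/
def colVec (v : Fin (2 * n + 1) ⊕ Fin (2 * n + 1) → 𝕜) : Fin (2 * n + 2) → 𝕜 :=
  fun i => (-(J n 𝕜 * twoColumns v)) i 0

/-- The adjoint of the first row of the lower left block of `extend P v y`. -/
def rowVec (v : Fin (2 * n + 1) ⊕ Fin (2 * n + 1) → 𝕜) : Fin (2 * n + 2) → 𝕜 :=
  fun i => star ((J₂ 𝕜 * (twoColumns v)ᵀ) 0 i)

/-- The square root of the quotient of the determinants of the hermitian parts of
`extend P v y` and `P`. -/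
noncomputable def hermRatio (P : Matrix (Fin (2 * n + 2)) (Fin (2 * n + 2)) 𝕜)
    (v : Fin (2 * n + 1) ⊕ Fin (2 * n + 1) → 𝕜) (y : 𝕜) : ℝ :=
  -(2 * RCLike.re y) - RCLike.re (star (colVec v + rowVec v) ⬝ᵥ
    ((P + Pᴴ)⁻¹ *ᵥ (colVec v + rowVec v)))

/-- The square root of the quotient of the determinants of `1 + extend P v y` and `1 + P`. -/
noncomputable def shiftRatio (P : Matrix (Fin (2 * n + 2)) (Fin (2 * n + 2)) 𝕜)
    (v : Fin (2 * n + 1) ⊕ Fin (2 * n + 1) → 𝕜) (y : 𝕜) : 𝕜 :=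
  1 - y - star (rowVec v) ⬝ᵥ ((1 + P)⁻¹ *ᵥ colVec v)

theorem toBlocks₁₁_one_add_extend (P : Matrix (Fin (2 * n + 2)) (Fin (2 * n + 2)) 𝕜)
    (v : Fin (2 * n + 1) ⊕ Fin (2 * n + 1) → 𝕜) (y : 𝕜) :
    (1 + extend P v y).toBlocks₁₁ = 1 + P := by
  rw [extend, ← fromBlocks_one, fromBlocks_add, toBlocks_fromBlocks₁₁]

theorem toBlocks₁₁_extend_add (P : Matrix (Fin (2 * n + 2)) (Fin (2 * n + 2)) 𝕜)
    (v : Fin (2 * n + 1) ⊕ Fin (2 * n + 1) → 𝕜) (y : 𝕜) :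
    (extend P v y + (extend P v y)ᴴ).toBlocks₁₁ = P + Pᴴ := by
  rw [extend, fromBlocks_conjTranspose, fromBlocks_add, toBlocks_fromBlocks₁₁]

theorem mul_mul_apply_eq_dotProduct {k l : Type*} [Fintype k]
    (A : Matrix l k 𝕜) (B : Matrix k k 𝕜) (C : Matrix k l 𝕜) (i j : l) :
    (A * B * C) i j = (fun a => A i a) ⬝ᵥ (B *ᵥ fun a => C a j) := by
  rw [Matrix.mul_assoc, mul_apply]
  simp only [dotProduct, mulVec, mul_apply]

theorem schurCompl_one_add_extend (P : Matrix (Fin (2 * n + 2)) (Fin (2 * n + 2)) 𝕜)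
    (v : Fin (2 * n + 1) ⊕ Fin (2 * n + 1) → 𝕜) (y : 𝕜) :
    schurCompl (1 + extend P v y) 0 0 = shiftRatio P v y := by
  rw [extend, ← fromBlocks_one, fromBlocks_add, schurCompl, toBlocks_fromBlocks₁₁,
    toBlocks_fromBlocks₁₂, toBlocks_fromBlocks₂₁, toBlocks_fromBlocks₂₂, zero_add, zero_add,
    Matrix.sub_apply, mul_mul_apply_eq_dotProduct, shiftRatio]
  congr 1
  · simp [sub_eq_add_neg]
  · congr 1
    funext i
    simp [rowVec]

theorem schurCompl_extend_add (P : Matrix (Fin (2 * n + 2)) (Fin (2 * n + 2)) 𝕜)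
    (v : Fin (2 * n + 1) ⊕ Fin (2 * n + 1) → 𝕜) (y : 𝕜) :
    schurCompl (extend P v y + (extend P v y)ᴴ) 0 0 = (hermRatio P v y : 𝕜) := by
  have hre : (RCLike.re (schurCompl (extend P v y + (extend P v y)ᴴ) 0 0) : 𝕜) =
      schurCompl (extend P v y + (extend P v y)ᴴ) 0 0 :=
    RCLike.conj_eq_iff_re.1
      ((schurCompl_isHermitian (isHermitian_add_transpose_self (extend P v y))).apply 0 0)
  rw [← hre, RCLike.ofReal_inj]
  rw [extend, fromBlocks_conjTranspose, fromBlocks_add, schurCompl, toBlocks_fromBlocks₁₁,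
    toBlocks_fromBlocks₁₂, toBlocks_fromBlocks₂₁, toBlocks_fromBlocks₂₂,
    Matrix.sub_apply, mul_mul_apply_eq_dotProduct, hermRatio, map_sub]
  congr 1
  · simp
    ring
  · congr 2
    funext i
    rw [Matrix.add_apply, Pi.star_apply, Pi.add_apply, star_add, conjTranspose_apply, rowVec,
      colVec, star_star, add_comm]

/-- Positivity of `R + R*` is tested on the block `P + P*` and on the scalar Schur complement, so
the domain fibers over the smaller one with the single inequality `hermRatio > 0`. -/
theorem mem_wedgeSection_succ_iff (x : Coord (n + 1) → 𝕜) :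
    ofCoord x ∈ wedgeSection (n + 1) 𝕜 ↔
      (ofCoord fun p => x (coordEquiv n (Sum.inl p))) ∈ wedgeSection n 𝕜 ∧
        0 < hermRatio (ofCoord fun p => x (coordEquiv n (Sum.inl p)))
          (fun k => x (coordEquiv n (Sum.inr (Sum.inl k))))
          (x (coordEquiv n (Sum.inr (Sum.inr ())))) := by
  set P := ofCoord fun p => x (coordEquiv n (Sum.inl p)) with hP
  have hs := isSymplecticSymm_extend (isSymplecticSymm_ofCoord
    fun p => x (coordEquiv n (Sum.inl p))) (fun k => x (coordEquiv n (Sum.inr (Sum.inl k))))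
    (x (coordEquiv n (Sum.inr (Sum.inr ()))))
  rw [← hP] at hs
  have hPm : P ∈ affineSection n 𝕜 := ofCoord_mem _
  have e : (ofCoord x + (ofCoord x)ᴴ).submatrix (blockEquiv n) (blockEquiv n) =
      extend P (fun k => x (coordEquiv n (Sum.inr (Sum.inl k))))
        (x (coordEquiv n (Sum.inr (Sum.inr ())))) +
      (extend P (fun k => x (coordEquiv n (Sum.inr (Sum.inl k))))
        (x (coordEquiv n (Sum.inr (Sum.inr ())))))ᴴ := by
    rw [submatrix_add, Pi.add_apply, Pi.add_apply, ← conjTranspose_submatrix,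
      ofCoord_submatrix_blockEquiv]
  simp only [wedgeSection, Set.mem_ofPred_eq, ofCoord_mem, true_and]
  have hsub : (ofCoord x + (ofCoord x)ᴴ).PosDef ↔
      ((ofCoord x + (ofCoord x)ᴴ).submatrix (blockEquiv n) (blockEquiv n)).PosDef := by
    refine ⟨fun h => h.submatrix (blockEquiv n).injective, fun h => ?_⟩
    have := h.submatrix (blockEquiv n).symm.injective
    simpa using this
  rw [hsub, e, posDef_iff_schurCompl
    (hs.add (hs.conjTranspose JBlock_mul_JBlock JBlock_conjTranspose))
    (isHermitian_add_transpose_self _), toBlocks₁₁_extend_add, schurCompl_extend_add,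
    RCLike.ofReal_re]
  simp only [hPm, true_and]

end Splitting

end MatrixBeta

namespace MatrixBeta

/-! ### Linear substitutions over `𝕜` -/

section Substitution

variable {𝕜 : Type*} [RCLike 𝕜] [MeasureSpace 𝕜] [StandardScalars 𝕜]

/-- Regarded over `ℝ`, a `𝕜`-linear map has as determinant the field norm of its `𝕜`-determinant,
and the absolute value of that is `‖det‖ ^ d`. -/
theorem map_mulVec_volume {m : Type*} [Fintype m] [DecidableEq m] {A : Matrix m m 𝕜}
    (hA : A.det ≠ 0) :
    Measure.map (fun z : m → 𝕜 => A *ᵥ z) volume =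
      ENNReal.ofReal ((‖A.det‖ ^ Module.finrank ℝ 𝕜)⁻¹) • (volume : Measure (m → 𝕜)) := by
  have hdet : LinearMap.det ((toLin' A).restrictScalars ℝ) = Algebra.norm ℝ A.det := by
    rw [LinearMap.det_restrictScalars, LinearMap.det_toLin']
  have habs : |Algebra.norm ℝ A.det| = ‖A.det‖ ^ Module.finrank ℝ 𝕜 :=
    StandardScalars.abs_norm _
  have hne : LinearMap.det ((toLin' A).restrictScalars ℝ) ≠ 0 := by
    rw [hdet, ← abs_ne_zero, habs]
    exact pow_ne_zero _ (norm_ne_zero_iff.2 hA)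
  have := Measure.map_linearMap_addHaar_eq_smul_addHaar (volume : Measure (m → 𝕜)) hne
  rw [hdet, abs_inv, habs] at this
  exact this

theorem integrable_and_integral_of_comp_mulVec {m : Type*} [Fintype m] [DecidableEq m]
    {A : Matrix m m 𝕜} (hA : A.det ≠ 0) {f : (m → 𝕜) → ℂ}
    (hf : Integrable fun z => f (A *ᵥ z)) :
    Integrable f ∧ ∫ z, f z = ((‖A.det‖ ^ Module.finrank ℝ 𝕜 : ℝ) : ℂ) * ∫ z, f (A *ᵥ z) := by
  have hpos : 0 < ‖A.det‖ ^ Module.finrank ℝ 𝕜 := pow_pos (norm_pos_iff.2 hA) _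
  have hc : Continuous fun z : m → 𝕜 => A *ᵥ z := by fun_prop
  have hemb : MeasurableEmbedding fun z : m → 𝕜 => A *ᵥ z :=
    hc.measurableEmbedding (mulVec_injective_of_isUnit ((isUnit_iff_isUnit_det A).2 hA.isUnit))
  have hmap := map_mulVec_volume hA
  have h1 := hemb.integrable_map_iff (g := f) (μ := volume)
  have h2 := hemb.integral_map (μ := volume) f
  rw [hmap] at h1 h2
  have hne : ENNReal.ofReal ((‖A.det‖ ^ Module.finrank ℝ 𝕜)⁻¹) ≠ 0 := by
    simpa using hpos
  refine ⟨(integrable_smul_measure hne ENNReal.ofReal_ne_top).1 (h1.2 hf), ?_⟩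
  rw [integral_smul_measure, ENNReal.toReal_ofReal (inv_nonneg.2 hpos.le),
    Complex.real_smul] at h2
  rw [← h2, ← mul_assoc, ← Complex.ofReal_mul, mul_inv_cancel₀ hpos.ne', Complex.ofReal_one,
    one_mul]

/-- Conjugation and change of sign in half of the coordinates. -/
def starRight {𝕜 : Type*} [RCLike 𝕜] {m : Type*} (v : m ⊕ m → 𝕜) : m ⊕ m → 𝕜 :=
  Sum.elim (fun k => v (Sum.inl k)) fun k => -star (v (Sum.inr k))

theorem starRight_starRight {𝕜 : Type*} [RCLike 𝕜] {m : Type*} (v : m ⊕ m → 𝕜) :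
    starRight (starRight v) = v := by
  funext k
  rcases k with k | k <;> simp [starRight]

end Substitution

/-! ### Diagonalization of the quadratic form -/

section QuadraticForm

variable {𝕜 : Type*} [RCLike 𝕜] {n : ℕ}

/-- The quadratic form that appears in the real part of `shiftRatio`. -/
noncomputable def quadForm (P : Matrix (Fin (2 * n + 2)) (Fin (2 * n + 2)) 𝕜)
    (v : Fin (2 * n + 1) ⊕ Fin (2 * n + 1) → 𝕜) : ℝ :=
  RCLike.re (star (colVec v + rowVec v) ⬝ᵥ ((P + Pᴴ)⁻¹ *ᵥ (colVec v + rowVec v))) -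
    2 * RCLike.re (star (rowVec v) ⬝ᵥ ((1 + P)⁻¹ *ᵥ colVec v))

/-- The contribution of `y` to `2 Re u - h` cancels, leaving a function of `v` alone. For fixed `v`,
a translation of `y` thus brings `h` and `u` to the normal form `2 Re y` and `(2 + Q(v)) / 2 + y`.
-/
theorem two_mul_re_shiftRatio (P : Matrix (Fin (2 * n + 2)) (Fin (2 * n + 2)) 𝕜)
    (v : Fin (2 * n + 1) ⊕ Fin (2 * n + 1) → 𝕜) (y : 𝕜) :
    2 * RCLike.re (shiftRatio P v y) = 2 + hermRatio P v y + quadForm P v := by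
  rw [shiftRatio, hermRatio, quadForm, map_sub, map_sub, RCLike.one_re]
  ring

theorem star_mulVec_dotProduct {m : Type*} [Fintype m] (A : Matrix m m 𝕜) (x y : m → 𝕜) :
    star (A *ᵥ x) ⬝ᵥ y = star x ⬝ᵥ (Aᴴ *ᵥ y) := by
  rw [star_mulVec, dotProduct_mulVec]

theorem re_star_dotProduct_comm {m : Type*} [Fintype m] (x y : m → 𝕜) :
    RCLike.re (star x ⬝ᵥ y) = RCLike.re (star y ⬝ᵥ x) := by
  rw [star_dotProduct, RCLike.star_def, RCLike.conj_re]

/-- The substitution gives `q + p = b + (P + P*) r` and `(1 + P)⁻¹ᴴ p = r`, which cancels both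
inverses in the terms with `r`. The mixed terms in `b` and `r` and the terms with `r* P r` then drop
out. -/
theorem re_form_substitution {m : Type*} [Fintype m] [DecidableEq m] {P : Matrix m m 𝕜}
    (hM : IsUnit (P + Pᴴ).det) (hD : IsUnit (1 + P).det) {b r q p : m → 𝕜}
    (hq : q = b + (P - 1) *ᵥ r) (hp : p = (1 + P)ᴴ *ᵥ r) :
    RCLike.re (star (q + p) ⬝ᵥ ((P + Pᴴ)⁻¹ *ᵥ (q + p))) -
        2 * RCLike.re (star p ⬝ᵥ ((1 + P)⁻¹ *ᵥ q)) =
      RCLike.re (star b ⬝ᵥ ((P + Pᴴ)⁻¹ *ᵥ b)) + 2 * RCLike.re (star r ⬝ᵥ r) := by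
  have hw : q + p = b + (P + Pᴴ) *ᵥ r := by
    rw [hq, hp, conjTranspose_add, conjTranspose_one, add_assoc, ← add_mulVec]
    congr 2
    abel
  have hMh : (P + Pᴴ)ᴴ = P + Pᴴ := isHermitian_add_transpose_self P
  have e1 : star p ⬝ᵥ ((1 + P)⁻¹ *ᵥ q) = star r ⬝ᵥ q := by
    rw [hp, star_mulVec_dotProduct, conjTranspose_conjTranspose, mulVec_mulVec,
      mul_nonsing_inv _ hD, one_mulVec]
  have e2 : (P + Pᴴ)⁻¹ *ᵥ (b + (P + Pᴴ) *ᵥ r) = (P + Pᴴ)⁻¹ *ᵥ b + r := by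
    rw [mulVec_add, mulVec_mulVec, nonsing_inv_mul _ hM, one_mulVec]
  have e3 : star ((P + Pᴴ) *ᵥ r) ⬝ᵥ ((P + Pᴴ)⁻¹ *ᵥ b) = star r ⬝ᵥ b := by
    rw [star_mulVec_dotProduct, hMh, mulVec_mulVec, mul_nonsing_inv _ hM, one_mulVec]
  have e4 : RCLike.re (star ((P + Pᴴ) *ᵥ r) ⬝ᵥ r) = 2 * RCLike.re (star r ⬝ᵥ (P *ᵥ r)) := by
    rw [star_mulVec_dotProduct, hMh, add_mulVec, dotProduct_add, map_add,
      ← star_mulVec_dotProduct P, re_star_dotProduct_comm (P *ᵥ r)]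
    ring
  rw [e1, hw, e2, star_add, add_dotProduct, dotProduct_add, dotProduct_add, e3, hq,
    dotProduct_add, sub_mulVec, dotProduct_sub, one_mulVec]
  simp only [map_add, map_sub]
  rw [e4, re_star_dotProduct_comm b r]
  ring

theorem submatrix_succ_mulVec {k : ℕ} (A : Matrix (Fin (k + 1)) (Fin (k + 1)) 𝕜) (r : Fin k → 𝕜)
    (i : Fin k) :
    (A.submatrix Fin.succ Fin.succ *ᵥ r) i =
      (A *ᵥ (Fin.cons (α := fun _ => 𝕜) 0 r : Fin (k + 1) → 𝕜)) i.succ := by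
  simp [mulVec, dotProduct, Fin.sum_univ_succ]

theorem star_cons_dotProduct_mulVec_cons {k : ℕ} (A : Matrix (Fin (k + 1)) (Fin (k + 1)) 𝕜)
    (r : Fin k → 𝕜) :
    star (Fin.cons (α := fun _ => 𝕜) 0 r : Fin (k + 1) → 𝕜) ⬝ᵥ
        (A *ᵥ (Fin.cons (α := fun _ => 𝕜) 0 r : Fin (k + 1) → 𝕜)) =
      star r ⬝ᵥ (A.submatrix Fin.succ Fin.succ *ᵥ r) := by
  simp only [dotProduct, Fin.sum_univ_succ, submatrix_succ_mulVec, Pi.star_apply, Fin.cons_zero,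
    Fin.cons_succ, star_zero, zero_mul, zero_add]

theorem re_star_dotProduct_self {m : Type*} [Fintype m] (x : m → 𝕜) :
    RCLike.re (star x ⬝ᵥ x) = ∑ i, ‖x i‖ ^ 2 := by
  rw [dotProduct, map_sum]
  refine Finset.sum_congr rfl fun i _ => ?_
  rw [Pi.star_apply, RCLike.star_def, RCLike.conj_mul]
  norm_cast

variable {P : Matrix (Fin (2 * n + 2)) (Fin (2 * n + 2)) 𝕜}

theorem isSymplecticSymm_of_mem (hP : P ∈ affineSection n 𝕜) : IsSymplecticSymm (J n 𝕜) P := by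
  rw [← range_ofCoord] at hP
  obtain ⟨x, rfl⟩ := hP
  exact isSymplecticSymm_ofCoord x

theorem dissipative_one_add {m : Type*} [Fintype m] [DecidableEq m] {P : Matrix m m 𝕜}
    (hP : (P + Pᴴ).PosDef) : ((1 + P) + (1 + P)ᴴ).PosDef := by
  have e : (1 + P) + (1 + P)ᴴ = (P + Pᴴ) + 2 := by
    rw [conjTranspose_add, conjTranspose_one, ← one_add_one_eq_two]
    abel
  rw [e]
  exact hP.add (PosDef.ofNat 2)

/-- The matrix of the substitution that simplifies `quadForm`. -/
noncomputable def substMatrix (P : Matrix (Fin (2 * n + 2)) (Fin (2 * n + 2)) 𝕜) :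
    Matrix (Fin (2 * n + 1) ⊕ Fin (2 * n + 1)) (Fin (2 * n + 1) ⊕ Fin (2 * n + 1)) 𝕜 :=
  fromBlocks 1 ((J n 𝕜 * (P - 1)).submatrix Fin.succ Fin.succ) 0
    ((1 + P)ᴴ.submatrix Fin.succ Fin.succ)

theorem colVec_eq (v : Fin (2 * n + 1) ⊕ Fin (2 * n + 1) → 𝕜) :
    colVec v = -(J n 𝕜 *ᵥ (Fin.cons (α := fun _ => 𝕜) 0 (fun k => v (Sum.inl k)) :
      Fin (2 * n + 2) → 𝕜)) := by
  funext i
  simp [colVec, mulVec, dotProduct, mul_apply, twoColumns]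

theorem rowVec_eq (v : Fin (2 * n + 1) ⊕ Fin (2 * n + 1) → 𝕜) :
    rowVec v = (Fin.cons (α := fun _ => 𝕜) 0 (fun k => -star (v (Sum.inr k))) :
      Fin (2 * n + 2) → 𝕜) := by
  funext i
  refine Fin.cases ?_ (fun k => ?_) i <;> simp [rowVec, mul_apply, J₂, twoColumns]

/-- The entries of index `0` are fixed and must be dropped consistently: row `1` of `P - 1` is zero
and column `0` of `1 + P` is twice a unit vector, so the substitution preserves vectors with
vanishing entry `0`. `starRight` removes the conjugation and sign in `rowVec`, which makes the
substitution linear over `𝕜`. -/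
theorem quadForm_substMatrix (hP : P ∈ wedgeSection n 𝕜)
    (z : Fin (2 * n + 1) ⊕ Fin (2 * n + 1) → 𝕜) :
    quadForm P (starRight (substMatrix P *ᵥ z)) =
      RCLike.re (star (fun k => z (Sum.inl k)) ⬝ᵥ
        ((P + Pᴴ)⁻¹ᵀ.submatrix Fin.succ Fin.succ *ᵥ fun k => z (Sum.inl k))) +
      2 * ∑ k, ‖z (Sum.inr k)‖ ^ 2 := by
  obtain ⟨hA, hM⟩ := hP
  have hs := isSymplecticSymm_of_mem hA
  obtain ⟨-, -, hcol, hrow⟩ := hA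
  have hMu : IsUnit (P + Pᴴ).det := hM.det_pos.ne'.isUnit
  have hDu : IsUnit (1 + P).det := isUnit_det_of_dissipative (dissipative_one_add hM)
  set β : Fin (2 * n + 1) → 𝕜 := fun k => z (Sum.inl k) with hβ
  set r : Fin (2 * n + 1) → 𝕜 := fun k => z (Sum.inr k) with hr
  set β' : Fin (2 * n + 2) → 𝕜 := Fin.cons (α := fun _ => 𝕜) 0 β with hβ'
  set r' : Fin (2 * n + 2) → 𝕜 := Fin.cons (α := fun _ => 𝕜) 0 r with hr'
  have hz : z = Sum.elim β r := by
    funext k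
    rcases k with k | k <;> rfl
  have hS : substMatrix P *ᵥ z = Sum.elim (β + (J n 𝕜 * (P - 1)).submatrix Fin.succ Fin.succ *ᵥ r)
      ((1 + P)ᴴ.submatrix Fin.succ Fin.succ *ᵥ r) := by
    rw [hz, substMatrix, fromBlocks_mulVec, Sum.elim_comp_inl, Sum.elim_comp_inr, one_mulVec,
      zero_mulVec, zero_add]
  have h0 : ((J n 𝕜 * (P - 1)) *ᵥ r') 0 = 0 := by
    have h1 : ∀ j, (J n 𝕜 * (P - 1)) 0 j = 0 := fun j => by
      have := (J_mul_apply (P - 1) 0 (Nat.zero_le n) j).1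
      have o : (⟨2 * 0 + 1, by omega⟩ : Fin (2 * n + 2)) = 1 := by simp
      rw [o] at this
      refine this.trans ?_
      rw [Matrix.sub_apply, hrow, Matrix.one_apply]
      simp [eq_comm]
    simp [mulVec, dotProduct, h1]
  have h0' : ((1 + P)ᴴ *ᵥ r') 0 = 0 := by
    rw [mulVec, dotProduct]
    refine Finset.sum_eq_zero fun j _ => ?_
    rw [conjTranspose_apply, Matrix.add_apply, hcol, Matrix.one_apply]
    refine Fin.cases ?_ (fun k => ?_) j <;> simp [hr']
  have hq : colVec (starRight (substMatrix P *ᵥ z)) = -(J n 𝕜 *ᵥ β') + (P - 1) *ᵥ r' := by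
    have : (Fin.cons (α := fun _ => 𝕜) 0 (fun k => starRight (substMatrix P *ᵥ z) (Sum.inl k)) :
        Fin (2 * n + 2) → 𝕜) = β' + (J n 𝕜 * (P - 1)) *ᵥ r' := by
      funext i
      refine Fin.cases ?_ (fun k => ?_) i
      · rw [Pi.add_apply, h0]
        simp [hβ']
      · rw [Pi.add_apply, Fin.cons_succ, starRight, Sum.elim_inl, hS, Sum.elim_inl, Pi.add_apply,
          submatrix_succ_mulVec, hβ', Fin.cons_succ]
    rw [colVec_eq, this, mulVec_add, mulVec_mulVec, ← Matrix.mul_assoc, J_mul_J, neg_add,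
      Matrix.neg_mul, Matrix.one_mul, neg_mulVec, neg_neg]
  have hp : rowVec (starRight (substMatrix P *ᵥ z)) = (1 + P)ᴴ *ᵥ r' := by
    rw [rowVec_eq]
    funext i
    refine Fin.cases ?_ (fun k => ?_) i
    · rw [h0', Fin.cons_zero]
    · rw [Fin.cons_succ, starRight, Sum.elim_inr, hS, Sum.elim_inr, submatrix_succ_mulVec]
      simp [hr']
  -- Conjugation by `J` turns the inverse of `P + P*` into its transpose, by the symplectic
  -- symmetry; this removes `J` from the form.
  have hb : star (-(J n 𝕜 *ᵥ β')) ⬝ᵥ ((P + Pᴴ)⁻¹ *ᵥ (-(J n 𝕜 *ᵥ β'))) =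
      star β' ⬝ᵥ ((P + Pᴴ)⁻¹ᵀ *ᵥ β') := by
    have hsM : IsSymplecticSymm (J n 𝕜) (P + Pᴴ)⁻¹ :=
      (hs.add (hs.conjTranspose (J_mul_J n 𝕜) J_conjTranspose)).inv hMu
    rw [IsSymplecticSymm] at hsM
    rw [mulVec_neg, star_neg, neg_dotProduct_neg, star_mulVec_dotProduct, J_conjTranspose,
      mulVec_mulVec, mulVec_mulVec, Matrix.neg_mul, ← hsM, Matrix.neg_mul, Matrix.mul_assoc,
      J_mul_J]
    simp
  rw [quadForm, re_form_substitution hMu hDu hq hp, hb, hβ', star_cons_dotProduct_mulVec_cons,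
    re_star_dotProduct_self, Fin.sum_univ_succ]
  simp [hr', hr]

/-! ### The Jacobian of the diagonalization -/

open scoped MatrixOrder Matrix.Norms.L2Operator in
theorem exists_eq_conjTranspose_mul_self {m : Type*} [Fintype m] [DecidableEq m]
    {N : Matrix m m 𝕜} (hN : N.PosSemidef) : ∃ L : Matrix m m 𝕜, N = Lᴴ * L := by
  obtain ⟨L, hL⟩ := CStarAlgebra.nonneg_iff_eq_star_mul_self.mp hN.nonneg
  exact ⟨L, hL⟩

theorem det_submatrix_succ_of_col {k : ℕ} {A : Matrix (Fin (k + 1)) (Fin (k + 1)) 𝕜}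
    (hA : ∀ j, j ≠ 0 → A 0 j = 0) :
    A.det = A 0 0 * (A.submatrix Fin.succ Fin.succ).det := by
  rw [det_succ_row_zero, Fin.sum_univ_succ, Finset.sum_eq_zero fun j _ => by
    rw [hA _ (Fin.succ_ne_zero j)]; simp]
  simp

/-- This is Cramer's rule for `A⁻¹`: its adjugate is `A / det A`. -/
theorem det_inv_submatrix_succ {k : ℕ} {A : Matrix (Fin (k + 1)) (Fin (k + 1)) 𝕜}
    (hA : A.det ≠ 0) : (A⁻¹.submatrix Fin.succ Fin.succ).det = A 0 0 / A.det := by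
  have h := adjugate_fin_succ_eq_det_submatrix A⁻¹ 0 0
  have hi : A⁻¹.det ≠ 0 := by rw [det_nonsing_inv, Ring.inverse_eq_inv']; exact inv_ne_zero hA
  have h2 : adjugate A⁻¹ = A⁻¹.det • A := by
    have h3 : A⁻¹ * adjugate A⁻¹ = A⁻¹.det • 1 := mul_adjugate _
    have := congrArg (fun X => A * X) h3
    simpa [mul_nonsing_inv_cancel_left _ _ hA.isUnit] using this
  rw [h2] at h
  simp only [Matrix.smul_apply, smul_eq_mul, det_nonsing_inv, Ring.inverse_eq_inv'] at h
  rw [div_eq_inv_mul, h]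
  simp

theorem norm_det_substMatrix (hP : P ∈ wedgeSection n 𝕜) :
    ‖(substMatrix P).det‖ = ‖(1 + P).det‖ / 2 := by
  obtain ⟨⟨-, -, hcol, -⟩, -⟩ := hP
  have h0 : (1 + P)ᴴ 0 0 = 2 := by
    rw [conjTranspose_apply, Matrix.add_apply, hcol]
    norm_num
  have h := det_submatrix_succ_of_col (A := (1 + P)ᴴ) fun j hj => by
    rw [conjTranspose_apply, Matrix.add_apply, hcol, Matrix.one_apply]
    simp [hj]
  rw [h0, det_conjTranspose] at h
  have h' := congrArg norm h
  rw [norm_star, norm_mul, RCLike.norm_ofNat] at h'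
  rw [substMatrix, det_fromBlocks_zero₂₁, det_one, one_mul, h']
  ring

/-- The quadratic form `quadForm P` is equivalent to the sum of the squares. -/
theorem exists_quadForm_eq_sum_norm_sq (hP : P ∈ wedgeSection n 𝕜) :
    ∃ T : Matrix (Fin (2 * n + 1) ⊕ Fin (2 * n + 1)) (Fin (2 * n + 1) ⊕ Fin (2 * n + 1)) 𝕜,
      ‖T.det‖ = ‖(1 + P).det‖ * √‖(P + Pᴴ).det‖ / 2 ^ (n + 2) ∧ T.det ≠ 0 ∧
        ∀ z, quadForm P (starRight (T *ᵥ z)) = ∑ i, ‖z i‖ ^ 2 := by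
  obtain ⟨hA, hM⟩ := hP
  have hMdet : (P + Pᴴ).det ≠ 0 := hM.det_pos.ne'
  have hDdet : (1 + P).det ≠ 0 := det_ne_zero_of_dissipative (dissipative_one_add hM)
  obtain ⟨L, hL⟩ := exists_eq_conjTranspose_mul_self
    (hM.inv.transpose.submatrix (Fin.succ_injective _)).posSemidef
  have hLdet : ‖L.det‖ ^ 2 * ‖(P + Pᴴ).det‖ = 2 := by
    have h1 := congrArg Matrix.det hL
    have h00 : (P + Pᴴ)ᵀ 0 0 = 2 := by
      rw [transpose_apply, Matrix.add_apply, conjTranspose_apply, hA.2.2.1]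
      norm_num
    rw [transpose_nonsing_inv, det_inv_submatrix_succ (by rwa [det_transpose]), h00, det_transpose,
      det_mul, det_conjTranspose] at h1
    have h2 := congrArg norm h1
    rw [norm_mul, norm_star, norm_div, RCLike.norm_ofNat] at h2
    rw [sq, ← h2]
    field_simp [norm_ne_zero_iff.2 hMdet]
  set T : Matrix (Fin (2 * n + 1) ⊕ Fin (2 * n + 1)) (Fin (2 * n + 1) ⊕ Fin (2 * n + 1)) 𝕜 :=
    fromBlocks L 0 0 ((√2 : 𝕜) • 1) with hT
  -- The `2n + 1` diagonal entries `√2` and the factor `√2` from `L` together give `2 ^ (n + 1)`.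
  -- The remaining factor `2` in `2 ^ (n + 2)` comes from `norm_det_substMatrix`.
  have hTdet : ‖T.det‖ = 2 ^ (n + 1) / √‖(P + Pᴴ).det‖ := by
    have hpos := norm_pos_iff.2 hMdet
    have h2 : ‖(√2 : 𝕜)‖ ^ 2 = 2 := by
      rw [RCLike.norm_ofReal, sq_abs, Real.sq_sqrt (by norm_num)]
    have hsq : ‖T.det‖ ^ 2 = (2 ^ (n + 1) / √‖(P + Pᴴ).det‖) ^ 2 := by
      rw [hT, det_fromBlocks_zero₂₁, det_smul, det_one, mul_one, Fintype.card_fin, norm_mul,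
        norm_pow, mul_pow, ← pow_mul, mul_comm (2 * n + 1) 2, pow_mul, h2, div_pow,
        Real.sq_sqrt hpos.le, eq_div_iff hpos.ne', mul_right_comm, hLdet]
      ring
    exact (sq_eq_sq₀ (norm_nonneg _) (by positivity)).1 hsq
  have hTu : IsUnit T.det := by
    rw [isUnit_iff_ne_zero, ← norm_ne_zero_iff, hTdet]
    have := norm_pos_iff.2 hMdet
    positivity
  have hF : ∀ z, quadForm P (starRight (substMatrix P *ᵥ z)) = ∑ i, ‖(T *ᵥ z) i‖ ^ 2 := by
    intro z
    have hz : z = Sum.elim (fun k => z (Sum.inl k)) (fun k => z (Sum.inr k)) := by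
      funext k
      rcases k with k | k <;> rfl
    have hTz : T *ᵥ z = Sum.elim (L *ᵥ fun k => z (Sum.inl k))
        ((√2 : 𝕜) • fun k => z (Sum.inr k)) := by
      conv_lhs => rw [hz]
      rw [hT, fromBlocks_mulVec, Sum.elim_comp_inl, Sum.elim_comp_inr, zero_mulVec, add_zero,
        zero_mulVec, zero_add, smul_mulVec, one_mulVec]
    have h2 : ‖(√2 : 𝕜)‖ ^ 2 = 2 := by
      rw [RCLike.norm_ofReal, sq_abs, Real.sq_sqrt (by norm_num)]
    rw [quadForm_substMatrix ⟨hA, hM⟩, hL, ← mulVec_mulVec, ← star_mulVec_dotProduct,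
      re_star_dotProduct_self, hTz, Fintype.sum_sum_type, Finset.mul_sum]
    congr 1
    refine Finset.sum_congr rfl fun k _ => ?_
    rw [Sum.elim_inr, Pi.smul_apply, smul_eq_mul, norm_mul, mul_pow, h2]
  have hF' : ∀ z, quadForm P (starRight ((substMatrix P * T⁻¹) *ᵥ z)) = ∑ i, ‖z i‖ ^ 2 := by
    intro z
    rw [← mulVec_mulVec, hF, mulVec_mulVec, mul_nonsing_inv _ hTu, one_mulVec]
  have hdet : ‖(substMatrix P * T⁻¹).det‖ =
      ‖(1 + P).det‖ * √‖(P + Pᴴ).det‖ / 2 ^ (n + 2) := by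
    rw [det_mul, det_nonsing_inv, Ring.inverse_eq_inv', norm_mul, norm_inv,
      norm_det_substMatrix ⟨hA, hM⟩, hTdet]
    have := norm_pos_iff.2 hMdet
    field_simp
    ring
  refine ⟨substMatrix P * T⁻¹, hdet, ?_, hF'⟩
  rw [← norm_ne_zero_iff, hdet]
  have := norm_pos_iff.2 hMdet
  have := norm_pos_iff.2 hDdet
  positivity

theorem quadForm_nonneg (hP : P ∈ wedgeSection n 𝕜)
    (v : Fin (2 * n + 1) ⊕ Fin (2 * n + 1) → 𝕜) : 0 ≤ quadForm P v := by
  obtain ⟨T, -, hT, h⟩ := exists_quadForm_eq_sum_norm_sq hP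
  have hv : starRight (T *ᵥ (T⁻¹ *ᵥ starRight v)) = v := by
    rw [mulVec_mulVec, mul_nonsing_inv _ hT.isUnit, one_mulVec, starRight_starRight]
  rw [← hv, h]
  positivity

variable [MeasureSpace 𝕜] [StandardScalars 𝕜]

theorem measurePreserving_starRight {m : Type*} [Fintype m] :
    MeasurePreserving (starRight : (m ⊕ m → 𝕜) → (m ⊕ m → 𝕜)) := by
  have hstar : MeasurePreserving (fun z : 𝕜 => -star z) volume volume := by
    set l : 𝕜 →ₗ[ℝ] 𝕜 := -(RCLike.conjLIE (K := 𝕜)).toLinearEquiv.toLinearMap with hl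
    have hl' : (l : 𝕜 → 𝕜) = fun z => -star z := rfl
    have hll : l ∘ₗ l = LinearMap.id := by
      ext z
      simp [hl]
    -- The map is an involution, so its real determinant is `±1` over either field.
    have hd : LinearMap.det l * LinearMap.det l = 1 := by
      rw [← LinearMap.det_comp, hll, LinearMap.det_id]
    have habs : |LinearMap.det l| = 1 := by
      rcases mul_self_eq_one_iff.1 hd with h | h <;> simp [h]
    refine ⟨by fun_prop, ?_⟩
    have := Measure.map_linearMap_addHaar_eq_smul_addHaar (volume : Measure 𝕜)
      (f := l) (by intro h; simp [h] at hd)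
    rwa [abs_inv, habs, inv_one, ENNReal.ofReal_one, one_smul, hl'] at this
  have := volume_preserving_pi (α' := fun _ : m ⊕ m => 𝕜) (β' := fun _ : m ⊕ m => 𝕜)
    (f := fun i => Sum.elim (fun _ => id) (fun _ => fun z : 𝕜 => -star z) i) (fun i => by
      rcases i with i | i
      · exact MeasurePreserving.id _
      · exact hstar)
  convert! this using 1
  funext v i
  rcases i with i | i <;> rfl

/-- Integrals of functions of `quadForm` are integrals of radial functions. -/
theorem integral_comp_quadForm (hP : P ∈ wedgeSection n 𝕜) {g : ℝ → ℂ}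
    (hg : Integrable fun z : Fin (2 * n + 1) ⊕ Fin (2 * n + 1) → 𝕜 => g (∑ i, ‖z i‖ ^ 2)) :
    Integrable (fun v => g (quadForm P v)) ∧
      ∫ v, g (quadForm P v) =
        (((‖(1 + P).det‖ * √‖(P + Pᴴ).det‖ / 2 ^ (n + 2)) ^ Module.finrank ℝ 𝕜 : ℝ) : ℂ) *
          ∫ z : Fin (2 * n + 1) ⊕ Fin (2 * n + 1) → 𝕜, g (∑ i, ‖z i‖ ^ 2) := by
  obtain ⟨T, hdet, hne, hF'⟩ := exists_quadForm_eq_sum_norm_sq hP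
  have key := integrable_and_integral_of_comp_mulVec hne
    (f := fun v => g (quadForm P (starRight v))) (by simpa only [hF'] using hg)
  simp only [hF', hdet] at key
  have hmp := measurePreserving_starRight (𝕜 := 𝕜) (m := Fin (2 * n + 1))
  have hemb : MeasurableEmbedding
      (starRight : (Fin (2 * n + 1) ⊕ Fin (2 * n + 1) → 𝕜) → _) :=
    (⟨⟨starRight, starRight, starRight_starRight, starRight_starRight⟩,
      hmp.measurable, hmp.measurable⟩ :
        (Fin (2 * n + 1) ⊕ Fin (2 * n + 1) → 𝕜) ≃ᵐ _).measurableEmbedding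
  exact ⟨(hmp.integrable_comp_emb hemb).1 key.1,
    (hmp.integral_comp hemb (fun v => g (quadForm P v))).symm.trans key.2⟩

end QuadraticForm

end MatrixBeta

namespace MatrixBeta

/-! ### Integration over the last two rows and columns -/

section Fiber

variable {𝕜 : Type*} [RCLike 𝕜] {n : ℕ}

@[fun_prop]
theorem continuous_colVec : Continuous (colVec : (Fin (2 * n + 1) ⊕ Fin (2 * n + 1) → 𝕜) → _) := by
  have h : Continuous fun v : Fin (2 * n + 1) ⊕ Fin (2 * n + 1) → 𝕜 =>
      (Fin.cons (α := fun _ => 𝕜) 0 (fun k => v (Sum.inl k)) : Fin (2 * n + 2) → 𝕜) := by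
    fun_prop
  exact (((continuous_const (y := J n 𝕜)).matrix_mulVec h).neg).congr fun v => (colVec_eq v).symm

@[fun_prop]
theorem continuous_rowVec : Continuous (rowVec : (Fin (2 * n + 1) ⊕ Fin (2 * n + 1) → 𝕜) → _) := by
  have h : Continuous fun v : Fin (2 * n + 1) ⊕ Fin (2 * n + 1) → 𝕜 =>
      (Fin.cons (α := fun _ => 𝕜) 0 (fun k => -star (v (Sum.inr k))) : Fin (2 * n + 2) → 𝕜) := by
    fun_prop
  exact h.congr fun v => (rowVec_eq v).symm

theorem continuous_hermRatio (P : Matrix (Fin (2 * n + 2)) (Fin (2 * n + 2)) 𝕜) :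
    Continuous fun p : (Fin (2 * n + 1) ⊕ Fin (2 * n + 1) → 𝕜) × 𝕜 => hermRatio P p.1 p.2 := by
  unfold hermRatio
  fun_prop

theorem continuous_shiftRatio (P : Matrix (Fin (2 * n + 2)) (Fin (2 * n + 2)) 𝕜) :
    Continuous fun p : (Fin (2 * n + 1) ⊕ Fin (2 * n + 1) → 𝕜) × 𝕜 => shiftRatio P p.1 p.2 := by
  unfold shiftRatio
  fun_prop

/-- A function on `ℝ × 𝕜` that is supported in `h > 0` and homogeneous of degree `-e`. -/
structure IsHomogeneousKernel (k : ℝ → 𝕜 → ℂ) (e : ℂ) : Prop where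
  eq_zero : ∀ h u, h ≤ 0 → k h u = 0
  smul : ∀ (t h : ℝ) (u : 𝕜), 0 < t → 0 < h → 0 < RCLike.re u →
    k (t * h) (t • u) = (t : ℂ) ^ (-e) * k h u

/-- Used to apply the same fiber computations to absolute values, which supplies the integrability
needed for Fubini. -/
theorem IsHomogeneousKernel.norm {k : ℝ → 𝕜 → ℂ} {e : ℂ} (hk : IsHomogeneousKernel k e) :
    IsHomogeneousKernel (fun h u => (‖k h u‖ : ℂ)) (e.re : ℂ) where
  eq_zero h u hh := by simp [hk.eq_zero h u hh]
  smul t h u ht hh hu := by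
    rw [hk.smul t h u ht hh hu, norm_mul, Complex.norm_cpow_eq_rpow_re_of_pos ht,
      Complex.ofReal_mul, Complex.ofReal_cpow ht.le]
    simp

variable [MeasureSpace 𝕜] [StandardScalars 𝕜] {k : ℝ → 𝕜 → ℂ} {e : ℂ}

/-- Substituting `A y` for `y` produces `A ^ d` from the measure and `A ^ (-e)` from homogeneity.
Where `Re y ≤ 0` the kernel vanishes, so homogeneity is only needed for `Re u > 0`. -/
theorem IsHomogeneousKernel.integral_shift (hk : IsHomogeneousKernel k e)
    (hi : Integrable fun y : 𝕜 => k (2 * RCLike.re y) (1 / 2 + y)) {A : ℝ} (hA : 0 < A) :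
    Integrable (fun y : 𝕜 => k (2 * RCLike.re y) ((A / 2 : ℝ) + y)) ∧
      ∫ y : 𝕜, k (2 * RCLike.re y) ((A / 2 : ℝ) + y) =
        (A : ℂ) ^ ((Module.finrank ℝ 𝕜 : ℂ) - e) *
          ∫ y : 𝕜, k (2 * RCLike.re y) (1 / 2 + y) := by
  set f : 𝕜 → ℂ := fun y => k (2 * RCLike.re y) ((A / 2 : ℝ) + y) with hf
  have hs : ∀ y : 𝕜, f (A • y) = (A : ℂ) ^ (-e) * k (2 * RCLike.re y) (1 / 2 + y) := by
    intro y
    have h1 : 2 * RCLike.re (A • y) = A * (2 * RCLike.re y) := by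
      rw [RCLike.smul_re]; ring
    have h2 : ((A / 2 : ℝ) : 𝕜) + A • y = A • (1 / 2 + y) := by
      rw [smul_add, RCLike.real_smul_eq_coe_mul, RCLike.real_smul_eq_coe_mul]
      push_cast
      ring
    simp only [hf, h1, h2]
    rcases lt_or_ge 0 (RCLike.re y) with hy | hy
    · refine hk.smul _ _ _ hA (by positivity) ?_
      have : (1 / 2 : 𝕜) = ((1 / 2 : ℝ) : 𝕜) := by push_cast; rfl
      rw [map_add, this, RCLike.ofReal_re]
      positivity
    · rw [hk.eq_zero _ _ (by nlinarith), hk.eq_zero _ _ (by linarith), mul_zero]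
  have h1 := (integrable_comp_smul_iff volume f hA.ne').1
    ((hi.const_mul ((A : ℂ) ^ (-e))).congr (Filter.Eventually.of_forall fun y => (hs y).symm))
  refine ⟨h1, ?_⟩
  have h2 := Measure.integral_comp_smul volume f A
  simp only [hs] at h2
  rw [integral_const_mul, abs_of_pos (by positivity), Complex.real_smul] at h2
  have hA' : (A : ℂ) ≠ 0 := Complex.ofReal_ne_zero.2 hA.ne'
  rw [sub_eq_add_neg, Complex.cpow_add _ _ hA', mul_assoc, h2, Complex.cpow_natCast]
  push_cast
  rw [← mul_assoc, mul_inv_cancel₀ (pow_ne_zero _ hA'), one_mul]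

variable {P : Matrix (Fin (2 * n + 2)) (Fin (2 * n + 2)) 𝕜}

theorem IsHomogeneousKernel.integral_ratio (hk : IsHomogeneousKernel k e)
    (hi : Integrable fun y : 𝕜 => k (2 * RCLike.re y) (1 / 2 + y)) (hP : P ∈ wedgeSection n 𝕜)
    (v : Fin (2 * n + 1) ⊕ Fin (2 * n + 1) → 𝕜) :
    Integrable (fun y : 𝕜 => k (hermRatio P v y) (shiftRatio P v y)) ∧
      ∫ y : 𝕜, k (hermRatio P v y) (shiftRatio P v y) =
        ((2 + quadForm P v : ℝ) : ℂ) ^ (-(e - (Module.finrank ℝ 𝕜 : ℂ))) *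
          ∫ y : 𝕜, k (2 * RCLike.re y) (1 / 2 + y) := by
  have hA : 0 < 2 + quadForm P v := by linarith [quadForm_nonneg hP v]
  obtain ⟨h1, h2⟩ := hk.integral_shift hi hA
  set c : 𝕜 := shiftRatio P v 0 - ((2 + quadForm P v) / 2 : ℝ) with hc
  have hu : ∀ y, shiftRatio P v y = ((2 + quadForm P v) / 2 : ℝ) + (c - y) := by
    intro y
    rw [hc, shiftRatio, shiftRatio]
    ring
  have hh : ∀ y, hermRatio P v y = 2 * RCLike.re (c - y) := by
    intro y
    have h := two_mul_re_shiftRatio P v y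
    rw [hu, map_add, RCLike.ofReal_re] at h
    linarith
  simp only [hu, hh]
  rw [neg_sub]
  exact ⟨h1.comp_sub_left c, (integral_sub_left_eq_self _ volume c).trans h2⟩

/-- The integral of a homogeneous kernel over the last two rows and columns. -/
theorem IsHomogeneousKernel.integral_fiber (hk : IsHomogeneousKernel k e)
    (hm : Measurable fun p : ℝ × 𝕜 => k p.1 p.2)
    (hi : Integrable fun y : 𝕜 => k (2 * RCLike.re y) (1 / 2 + y)) (hP : P ∈ wedgeSection n 𝕜)
    (hs : (Module.finrank ℝ 𝕜 * (2 * n + 1) : ℝ) < (e - Module.finrank ℝ 𝕜).re) :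
    Integrable (fun p : (Fin (2 * n + 1) ⊕ Fin (2 * n + 1) → 𝕜) × 𝕜 =>
        k (hermRatio P p.1 p.2) (shiftRatio P p.1 p.2)) ∧
      ∫ p : (Fin (2 * n + 1) ⊕ Fin (2 * n + 1) → 𝕜) × 𝕜,
          k (hermRatio P p.1 p.2) (shiftRatio P p.1 p.2) =
        (((‖(1 + P).det‖ * √‖(P + Pᴴ).det‖ / 2 ^ (n + 2)) ^ Module.finrank ℝ 𝕜 : ℝ) : ℂ) *
          ((Real.pi : ℂ) ^ (Module.finrank ℝ 𝕜 * (2 * n + 1)) *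
            (2 : ℂ) ^ ((Module.finrank ℝ 𝕜 * (2 * n + 1) : ℂ) - (e - Module.finrank ℝ 𝕜)) *
            (Complex.Gamma (e - Module.finrank ℝ 𝕜 - Module.finrank ℝ 𝕜 * (2 * n + 1)) /
              Complex.Gamma (e - Module.finrank ℝ 𝕜)) *
            ∫ y : 𝕜, k (2 * RCLike.re y) (1 / 2 + y)) := by
  have hcard : (Fintype.card (Fin (2 * n + 1) ⊕ Fin (2 * n + 1)) : ℝ) = 2 * (2 * n + 1) := by
    rw [Fintype.card_sum, Fintype.card_fin]
    push_cast
    ring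
  -- The statement is proved for general `s` because it is used twice: with `e - d` for the value
  -- and with its real part for absolute convergence.
  have houter : ∀ s : ℂ, (Module.finrank ℝ 𝕜 * (2 * n + 1) : ℝ) < s.re →
      Integrable (fun v => ((2 + quadForm P v : ℝ) : ℂ) ^ (-s)) ∧
        ∫ v, ((2 + quadForm P v : ℝ) : ℂ) ^ (-s) =
          (((‖(1 + P).det‖ * √‖(P + Pᴴ).det‖ / 2 ^ (n + 2)) ^ Module.finrank ℝ 𝕜 : ℝ) : ℂ) *
          ((Real.pi : ℂ) ^ (Module.finrank ℝ 𝕜 * (2 * n + 1)) *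
            (2 : ℂ) ^ ((Module.finrank ℝ 𝕜 * (2 * n + 1) : ℂ) - s) *
            (Complex.Gamma (s - Module.finrank ℝ 𝕜 * (2 * n + 1)) / Complex.Gamma s)) := by
    intro s hs
    have e1 : (Module.finrank ℝ 𝕜 * Fintype.card (Fin (2 * n + 1) ⊕ Fin (2 * n + 1)) / 2 : ℝ) =
        Module.finrank ℝ 𝕜 * (2 * n + 1) := by
      rw [hcard]; ring
    have e2 : (Module.finrank ℝ 𝕜 * Fintype.card (Fin (2 * n + 1) ⊕ Fin (2 * n + 1)) / 2 : ℂ) =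
        Module.finrank ℝ 𝕜 * (2 * n + 1) := by
      simpa only [Complex.ofReal_div, Complex.ofReal_mul, Complex.ofReal_add, Complex.ofReal_one,
        Complex.ofReal_natCast, Complex.ofReal_ofNat] using congrArg Complex.ofReal e1
    have hs0 : 0 < s.re := lt_of_le_of_lt (by positivity) hs
    obtain ⟨a, b⟩ := integral_add_sum_norm_sq_cpow_neg (𝕜 := 𝕜)
      (Fin (2 * n + 1) ⊕ Fin (2 * n + 1)) hs0 (by rwa [e1]) (A := 2) two_pos
    obtain ⟨c, d⟩ := integral_comp_quadForm hP (g := fun x => ((2 + x : ℝ) : ℂ) ^ (-s)) a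
    refine ⟨c, d.trans ?_⟩
    rw [b, e2]
    norm_cast
  obtain ⟨o1, o2⟩ := houter _ hs
  have o1' := (houter ((e.re : ℂ) - Module.finrank ℝ 𝕜) (by simpa using hs)).1
  have hin := fun v => hk.integral_ratio hi hP v
  have hin' := fun v => hk.norm.integral_ratio hi.norm.ofReal hP v
  have hmeas : AEStronglyMeasurable (fun p : (Fin (2 * n + 1) ⊕ Fin (2 * n + 1) → 𝕜) × 𝕜 =>
      k (hermRatio P p.1 p.2) (shiftRatio P p.1 p.2)) volume :=
    (hm.comp ((continuous_hermRatio P).measurable.prodMk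
      (continuous_shiftRatio P).measurable)).aestronglyMeasurable
  have hint : Integrable (fun p : (Fin (2 * n + 1) ⊕ Fin (2 * n + 1) → 𝕜) × 𝕜 =>
      k (hermRatio P p.1 p.2) (shiftRatio P p.1 p.2)) := by
    refine (integrable_prod_iff hmeas).2 ⟨Filter.Eventually.of_forall fun v => (hin v).1, ?_⟩
    have h := o1'.mul_const (∫ y : 𝕜, (‖k (2 * RCLike.re y) (1 / 2 + y)‖ : ℂ))
    refine h.re.congr (Filter.Eventually.of_forall fun v => ?_)
    simp only
    rw [← (hin' v).2, integral_complex_ofReal]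
    simp
  refine ⟨hint, ?_⟩
  rw [Measure.volume_eq_prod, integral_prod _ hint]
  simp only [fun v => (hin v).2]
  rw [integral_mul_const, o2]
  ring

end Fiber

end MatrixBeta

namespace MatrixBeta

/-! ### The kernels of the fiber integrals -/

section Kernel

variable {𝕜 : Type*} [RCLike 𝕜]

/-- The embedding of the scalars in the complex numbers. -/
noncomputable def toComplex (𝕜 : Type*) [RCLike 𝕜] : 𝕜 →⋆ₐ[ℝ] ℂ where
  toFun z := ⟨RCLike.re z, RCLike.im z⟩
  map_one' := by apply Complex.ext <;> simp
  map_mul' z w := by apply Complex.ext <;> simp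
  map_zero' := by apply Complex.ext <;> simp
  map_add' z w := by apply Complex.ext <;> simp
  commutes' r := by apply Complex.ext <;> simp
  map_star' z := by apply Complex.ext <;> simp

@[simp] theorem toComplex_re (z : 𝕜) : (toComplex 𝕜 z).re = RCLike.re z := rfl

@[simp] theorem toComplex_im (z : 𝕜) : (toComplex 𝕜 z).im = RCLike.im z := rfl

theorem toComplex_real (x : ℝ) : toComplex ℝ x = (x : ℂ) := by
  apply Complex.ext <;> simp

theorem toComplex_complex (z : ℂ) : toComplex ℂ z = z := by
  apply Complex.ext <;> simp

theorem toComplex_ofReal (x : ℝ) : toComplex 𝕜 (x : 𝕜) = (x : ℂ) := by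
  apply Complex.ext <;> simp

@[fun_prop]
theorem continuous_toComplex : Continuous (toComplex 𝕜) := by
  have h : (toComplex 𝕜 : 𝕜 → ℂ) = fun z => (RCLike.re z : ℂ) + RCLike.im z * Complex.I := by
    funext z
    apply Complex.ext <;> simp
  rw [h]
  fun_prop

theorem norm_toComplex (z : 𝕜) : ‖toComplex 𝕜 z‖ = ‖z‖ := by
  rw [← sq_eq_sq₀ (norm_nonneg _) (norm_nonneg _), ← Complex.normSq_eq_norm_sq,
    Complex.normSq_apply, RCLike.norm_sq_eq_def, toComplex_re, toComplex_im]

/-- The function `h ^ α * u ^ {-σ‖-τ}` on `h > 0`. -/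
noncomputable def powKernel (α σ τ : ℂ) (h : ℝ) (u : 𝕜) : ℂ :=
  if 0 < h then (h : ℂ) ^ α * (Complex.exp (-σ * Complex.log (toComplex 𝕜 u)) *
    Complex.exp (-τ * (starRingEnd ℂ) (Complex.log (toComplex 𝕜 u)))) else 0

theorem powKernel_of_pos {α σ τ : ℂ} {h : ℝ} (hh : 0 < h) (u : 𝕜) :
    powKernel α σ τ h u = (h : ℂ) ^ α * (Complex.exp (-σ * Complex.log (toComplex 𝕜 u)) *
      Complex.exp (-τ * (starRingEnd ℂ) (Complex.log (toComplex 𝕜 u)))) := if_pos hh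

theorem isHomogeneousKernel_powKernel (α σ τ : ℂ) :
    IsHomogeneousKernel (powKernel α σ τ : ℝ → 𝕜 → ℂ) (σ + τ - α) where
  eq_zero h u hh := if_neg hh.not_gt
  smul t h u ht hh hu := by
    have hu' : toComplex 𝕜 u ≠ 0 := fun h0 => by
      have := congrArg Complex.re h0
      rw [toComplex_re] at this
      exact hu.ne' this
    have hl : Complex.log (toComplex 𝕜 (t • u)) = Real.log t + Complex.log (toComplex 𝕜 u) := by
      rw [RCLike.real_smul_eq_coe_mul, map_mul, toComplex_ofReal, Complex.log_ofReal_mul ht hu']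
    have ht' : (t : ℂ) ≠ 0 := Complex.ofReal_ne_zero.2 ht.ne'
    rw [powKernel_of_pos hh, powKernel_of_pos (mul_pos ht hh), hl, Complex.ofReal_mul,
      Complex.mul_cpow_ofReal_nonneg ht.le hh.le, map_add, Complex.conj_ofReal, mul_add, mul_add,
      Complex.exp_add, Complex.exp_add, Complex.cpow_def_of_ne_zero ht',
      Complex.cpow_def_of_ne_zero ht', ← Complex.ofReal_log ht.le]
    have : Complex.exp (Real.log t * -(σ + τ - α)) = Complex.exp (Real.log t * α) *
        Complex.exp (-σ * Real.log t) * Complex.exp (-τ * Real.log t) := by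
      rw [← Complex.exp_add, ← Complex.exp_add]
      ring_nf
    rw [this]
    ring

theorem measurable_powKernel [MeasurableSpace 𝕜] [BorelSpace 𝕜] (α σ τ : ℂ) :
    Measurable fun p : ℝ × 𝕜 => powKernel α σ τ p.1 p.2 := by
  have h1 : Measurable fun p : ℝ × 𝕜 => Complex.log (toComplex 𝕜 p.2) :=
    Complex.measurable_log.comp (continuous_toComplex.measurable.comp measurable_snd)
  have h2 : Measurable fun p : ℝ × 𝕜 => (starRingEnd ℂ) (Complex.log (toComplex 𝕜 p.2)) :=
    Complex.continuous_conj.measurable.comp h1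
  unfold powKernel
  refine Measurable.ite (measurableSet_lt measurable_const measurable_fst) ?_ measurable_const
  fun_prop

/-! ### The scalar integrals of the kernels -/

/-- The beta integral in the form in which it appears in the fibers. -/
theorem integral_two_mul_cpow_mul_half_add_cpow {α ρ : ℂ} (hα : -1 < α.re)
    (hρ : 0 < (ρ - α - 1).re) :
    IntegrableOn (fun x : ℝ => ((2 * x : ℝ) : ℂ) ^ α * ((1 / 2 + x : ℝ) : ℂ) ^ (-ρ)) (Set.Ioi 0) ∧
      ∫ x : ℝ in Set.Ioi 0, ((2 * x : ℝ) : ℂ) ^ α * ((1 / 2 + x : ℝ) : ℂ) ^ (-ρ) =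
        2 ^ (ρ - 1) * (Complex.Gamma (α + 1) * Complex.Gamma (ρ - α - 1) / Complex.Gamma ρ) := by
  obtain ⟨h1, h2⟩ := integral_cpow_mul_one_add_cpow_neg (a := α + 1) (b := ρ - α - 1)
    (by simpa using by linarith) hρ
  have e1 : α + 1 + (ρ - α - 1) = ρ := by ring
  rw [add_sub_cancel_right, e1] at h1 h2
  have hs : ∀ x ∈ Set.Ioi (0 : ℝ), (2 : ℂ) ^ ρ * ((((2 * x : ℝ)) : ℂ) ^ α *
      ((1 + 2 * x : ℝ) : ℂ) ^ (-ρ)) = ((2 * x : ℝ) : ℂ) ^ α * ((1 / 2 + x : ℝ) : ℂ) ^ (-ρ) := by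
    intro x hx
    have hx : 0 < x := hx
    have e2 : (1 / 2 + x : ℝ) = (1 / 2 : ℝ) * (1 + 2 * x) := by ring
    rw [e2, Complex.ofReal_mul (1 / 2), Complex.mul_cpow_ofReal_nonneg (by norm_num)
      (by positivity)]
    have e3 : ((1 / 2 : ℝ) : ℂ) ^ (-ρ) = 2 ^ ρ := by
      have := one_div_cpow_of_pos (A := 2) two_pos (-ρ)
      rw [neg_neg] at this
      simpa using this
    rw [e3]
    ring
  have i1 : IntegrableOn (fun x : ℝ => (((2 * x : ℝ)) : ℂ) ^ α *
      ((1 + 2 * x : ℝ) : ℂ) ^ (-ρ)) (Set.Ioi 0) := by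
    have := (integrableOn_Ioi_comp_mul_left_iff (fun x : ℝ => (x : ℂ) ^ α *
      ((1 + x : ℝ) : ℂ) ^ (-ρ)) 0 two_pos).2 (by simpa using h1)
    exact this
  have i2 := integral_comp_mul_left_Ioi (fun x : ℝ => (x : ℂ) ^ α *
      ((1 + x : ℝ) : ℂ) ^ (-ρ)) 0 two_pos
  rw [mul_zero, h2] at i2
  refine ⟨IntegrableOn.congr_fun (i1.const_mul ((2 : ℂ) ^ ρ)) hs measurableSet_Ioi, ?_⟩
  rw [← setIntegral_congr_fun measurableSet_Ioi hs, integral_const_mul, i2,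
    Complex.cpow_sub _ _ two_ne_zero, Complex.cpow_one, Complex.real_smul]
  push_cast
  ring

theorem powKernel_half_add_real {α σ : ℂ} (y : ℝ) :
    powKernel α σ 0 (2 * y) (1 / 2 + y) = (Set.Ioi 0).indicator
      (fun x : ℝ => ((2 * x : ℝ) : ℂ) ^ α * ((1 / 2 + x : ℝ) : ℂ) ^ (-σ)) y := by
  by_cases hy : 0 < y
  · have h0 : ((1 / 2 + y : ℝ) : ℂ) ≠ 0 := Complex.ofReal_ne_zero.2 (by positivity)
    rw [Set.indicator_of_mem (Set.mem_Ioi.2 hy), powKernel_of_pos (by positivity), toComplex_real,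
      Complex.cpow_def_of_ne_zero h0, neg_zero, zero_mul, Complex.exp_zero, mul_one, mul_comm (-σ)]
  · rw [Set.indicator_of_notMem (by simpa using hy), powKernel, if_neg (by linarith)]

theorem integral_powKernel_real {α σ : ℂ} (hα : -1 < α.re) (hσ : 0 < (σ - α - 1).re) :
    Integrable (fun y : ℝ => powKernel α σ 0 (2 * RCLike.re y) (1 / 2 + y)) ∧
      ∫ y : ℝ, powKernel α σ 0 (2 * RCLike.re y) (1 / 2 + y) =
        2 ^ (σ - 1) * (Complex.Gamma (α + 1) * Complex.Gamma (σ - α - 1) / Complex.Gamma σ) := by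
  obtain ⟨h1, h2⟩ := integral_two_mul_cpow_mul_half_add_cpow hα hσ
  simp only [RCLike.re_to_real, powKernel_half_add_real]
  rw [integral_indicator measurableSet_Ioi]
  exact ⟨h1.integrable_indicator measurableSet_Ioi, h2⟩

/-- On the vertical line `Re y = a` the imaginary part is measured in units of `1 / 2 + a`, so that
`1 / 2 + y = (1 / 2 + a) (1 + it)` and the variables separate. -/
theorem powKernel_half_add_complex {α σ τ : ℂ} {a : ℝ} (ha : 0 < a) (t : ℝ) :
    powKernel α σ τ (2 * a) ((1 / 2 : ℂ) + ⟨a, (1 / 2 + a) * t⟩) =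
      ((2 * a : ℝ) : ℂ) ^ α * ((1 / 2 + a : ℝ) : ℂ) ^ (-(σ + τ)) * cauchyIntegrand σ τ t := by
  have hc : 0 < 1 / 2 + a := by positivity
  have h0 : ((1 / 2 + a : ℝ) : ℂ) ≠ 0 := Complex.ofReal_ne_zero.2 hc.ne'
  have hp : (1 + t * Complex.I : ℂ) ≠ 0 := fun h => by simpa using congrArg Complex.re h
  have hm : (1 - t * Complex.I : ℂ) ≠ 0 := fun h => by simpa using congrArg Complex.re h
  have e1 : (1 / 2 : ℂ) + ⟨a, (1 / 2 + a) * t⟩ = ((1 / 2 + a : ℝ) : ℂ) * (1 + t * Complex.I) := by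
    apply Complex.ext <;> simp
  have e2 : (starRingEnd ℂ) (Complex.log (1 + t * Complex.I)) =
      Complex.log (1 - t * Complex.I) := by
    rw [← Complex.log_conj]
    · simp [sub_eq_add_neg]
    · intro h
      have := Complex.arg_eq_pi_iff.1 h
      simp at this
      linarith [this.1]
  rw [powKernel_of_pos (by positivity), toComplex_complex, e1, Complex.log_ofReal_mul hc hp,
    map_add, e2, Complex.conj_ofReal, cauchyIntegrand, Complex.cpow_def_of_ne_zero hp,
    Complex.cpow_def_of_ne_zero hm, Complex.cpow_def_of_ne_zero h0, ← Complex.ofReal_log hc.le,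
    mul_assoc]
  congr 1
  simp only [← Complex.exp_add]
  ring_nf

theorem integral_powKernel_complex_line {α σ τ : ℂ} (hστ : 1 < (σ + τ).re) {a : ℝ}
    (ha : 0 < a) :
    Integrable (fun b : ℝ => powKernel α σ τ (2 * a) ((1 / 2 : ℂ) + ⟨a, b⟩)) ∧
      ∫ b : ℝ, powKernel α σ τ (2 * a) ((1 / 2 : ℂ) + ⟨a, b⟩) =
        (((2 * a : ℝ) : ℂ) ^ α * ((1 / 2 + a : ℝ) : ℂ) ^ (-(σ + τ - 1))) *
          ∫ t, cauchyIntegrand σ τ t ∧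
      ∫ b : ℝ, ‖powKernel α σ τ (2 * a) ((1 / 2 : ℂ) + ⟨a, b⟩)‖ =
        ‖((2 * a : ℝ) : ℂ) ^ α * ((1 / 2 + a : ℝ) : ℂ) ^ (-(σ + τ - 1))‖ *
          ∫ t, ‖cauchyIntegrand σ τ t‖ := by
  have hc : 0 < 1 / 2 + a := by positivity
  have hc0 : ((1 / 2 + a : ℝ) : ℂ) ≠ 0 := Complex.ofReal_ne_zero.2 hc.ne'
  set f : ℝ → ℂ := fun b => powKernel α σ τ (2 * a) ((1 / 2 : ℂ) + ⟨a, b⟩) with hf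
  have hs : ∀ t, f ((1 / 2 + a) * t) =
      ((2 * a : ℝ) : ℂ) ^ α * ((1 / 2 + a : ℝ) : ℂ) ^ (-(σ + τ)) * cauchyIntegrand σ τ t :=
    fun t => powKernel_half_add_complex ha t
  have hpow : ((1 / 2 + a : ℝ) : ℂ) ^ (-(σ + τ - 1)) =
      ((1 / 2 + a : ℝ) : ℂ) * ((1 / 2 + a : ℝ) : ℂ) ^ (-(σ + τ)) := by
    rw [neg_sub, sub_eq_add_neg, Complex.cpow_add _ _ hc0, Complex.cpow_one]
  have h1 : Integrable f := (integrable_comp_mul_left_iff f hc.ne').1 (by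
    simp only [hs]
    exact (integrable_cauchyIntegrand hστ).const_mul _)
  have h2 := Measure.integral_comp_mul_left f (1 / 2 + a)
  have h3 := Measure.integral_comp_mul_left (fun b => ‖f b‖) (1 / 2 + a)
  simp only [hs, norm_mul] at h2 h3
  rw [integral_const_mul, abs_of_pos (inv_pos.2 hc)] at h2 h3
  refine ⟨h1, ?_, ?_⟩
  · rw [hpow, mul_left_comm, mul_assoc, h2, Complex.real_smul, ← mul_assoc, ← Complex.ofReal_mul,
      mul_inv_cancel₀ hc.ne', Complex.ofReal_one, one_mul]
  · rw [hpow, norm_mul, norm_mul, Complex.norm_real, Real.norm_of_nonneg hc.le, mul_left_comm,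
      mul_assoc, h3, smul_eq_mul, ← mul_assoc, mul_inv_cancel₀ hc.ne', one_mul]

theorem integral_powKernel_complex {α σ τ : ℂ} (hα : -1 < α.re)
    (hσ : 0 < (σ + τ - α - 2).re) :
    Integrable (fun y : ℂ => powKernel α σ τ (2 * RCLike.re y) (1 / 2 + y)) ∧
      ∫ y : ℂ, powKernel α σ τ (2 * RCLike.re y) (1 / 2 + y) =
        Real.pi * (Complex.Gamma (α + 1) * Complex.Gamma (σ + τ - α - 2) *
          (Complex.Gamma σ)⁻¹ * (Complex.Gamma τ)⁻¹) := by
  have hστ : 1 < (σ + τ).re := by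
    simp only [Complex.sub_re, Complex.re_ofNat] at hσ
    linarith
  have e0 : σ + τ - 1 - α - 1 = σ + τ - α - 2 := by ring
  obtain ⟨b1, b2⟩ := integral_two_mul_cpow_mul_half_add_cpow (ρ := σ + τ - 1) hα (by rwa [e0])
  rw [e0] at b2
  have hmp := Complex.volume_preserving_equiv_real_prod.symm
  have hemb := Complex.measurableEquivRealProd.symm.measurableEmbedding
  have hm : Measurable fun p : ℝ × ℝ => powKernel α σ τ (2 * p.1) ((1 / 2 : ℂ) + ⟨p.1, p.2⟩) := by
    refine (measurable_powKernel (𝕜 := ℂ) α σ τ).comp (Measurable.prodMk (by fun_prop) ?_)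
    exact measurable_const.add Complex.measurableEquivRealProd.symm.measurable
  have hneg : ∀ a b : ℝ, ¬ 0 < a → powKernel α σ τ (2 * a) ((1 / 2 : ℂ) + ⟨a, b⟩) = 0 :=
    fun a b ha => if_neg (by linarith)
  have hline : ∀ a : ℝ, ∫ b : ℝ, powKernel α σ τ (2 * a) ((1 / 2 : ℂ) + ⟨a, b⟩) =
      (Set.Ioi 0).indicator (fun x : ℝ => ((2 * x : ℝ) : ℂ) ^ α *
        ((1 / 2 + x : ℝ) : ℂ) ^ (-(σ + τ - 1))) a * ∫ t, cauchyIntegrand σ τ t := by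
    intro a
    by_cases ha : 0 < a
    · rw [Set.indicator_of_mem (Set.mem_Ioi.2 ha), (integral_powKernel_complex_line hστ ha).2.1]
    · rw [Set.indicator_of_notMem (by simpa using ha)]
      simp only [hneg a _ ha, integral_zero, zero_mul]
  have hlinen : ∀ a : ℝ, ∫ b : ℝ, ‖powKernel α σ τ (2 * a) ((1 / 2 : ℂ) + ⟨a, b⟩)‖ =
      ‖(Set.Ioi 0).indicator (fun x : ℝ => ((2 * x : ℝ) : ℂ) ^ α *
        ((1 / 2 + x : ℝ) : ℂ) ^ (-(σ + τ - 1))) a‖ * ∫ t, ‖cauchyIntegrand σ τ t‖ := by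
    intro a
    by_cases ha : 0 < a
    · rw [Set.indicator_of_mem (Set.mem_Ioi.2 ha), (integral_powKernel_complex_line hστ ha).2.2]
    · rw [Set.indicator_of_notMem (by simpa using ha)]
      simp only [hneg a _ ha, norm_zero, integral_zero, zero_mul]
  have hint : Integrable fun p : ℝ × ℝ =>
      powKernel α σ τ (2 * p.1) ((1 / 2 : ℂ) + ⟨p.1, p.2⟩) := by
    refine (integrable_prod_iff hm.aestronglyMeasurable).2 ⟨Filter.Eventually.of_forall fun a => ?_,
      ?_⟩
    · by_cases ha : 0 < a
      · exact (integral_powKernel_complex_line hστ ha).1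
      · simp only [hneg a _ ha]
        exact integrable_zero _ _ _
    · simp only [hlinen]
      exact (b1.integrable_indicator measurableSet_Ioi).norm.mul_const _
  refine ⟨(hmp.integrable_comp_emb hemb).1 hint, ?_⟩
  refine (hmp.integral_comp hemb (fun y : ℂ =>
    powKernel α σ τ (2 * RCLike.re y) (1 / 2 + y))).symm.trans ?_
  refine (integral_prod _ hint).trans ?_
  simp only [hline]
  rw [integral_mul_const, integral_indicator measurableSet_Ioi, b2, integral_cauchyIntegrand hστ]
  have hG : Complex.Gamma (σ + τ - 1) ≠ 0 := Complex.Gamma_ne_zero_of_re_pos (by simpa using hστ)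
  -- All powers of `2` from the beta integral and Cauchy's integral cancel, as does `Γ(σ + τ - 1)`,
  -- which is the denominator of the one and a numerator of the other.
  have h2 : (2 : ℂ) ^ (σ + τ - 1 - 1) * 2 ^ (1 - σ - τ) * 2 = 1 := by
    nth_rewrite 3 [← Complex.cpow_one 2]
    rw [← Complex.cpow_add _ _ two_ne_zero, ← Complex.cpow_add _ _ two_ne_zero]
    ring_nf
    simp
  field_simp
  linear_combination (Complex.Gamma (α + 1) * Complex.Gamma (σ + τ - α - 2) *
    (Complex.Gamma σ)⁻¹ * (Complex.Gamma τ)⁻¹) * h2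

end Kernel

end MatrixBeta

namespace MatrixBeta

/-! ### The recursion for the integrands -/

section Recursion

theorem logDet_submatrix_equiv {m l : Type*} [Fintype m] [DecidableEq m] [Fintype l]
    [DecidableEq l] (A : Matrix m m ℂ) (e : l ≃ m) : logDet (A.submatrix e e) = logDet A := by
  have := charpoly_reindex e.symm A
  rw [reindex_apply, Equiv.symm_symm] at this
  rw [logDet, this, logDet]

/-- The positions of an upper left block. -/
def upperLeftEquiv {N p : ℕ} (h : p ≤ N) : Fin p ≃ {i : Fin N // (i : ℕ) < p} where
  toFun i := ⟨Fin.castLE h i, i.2⟩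
  invFun i := ⟨i.1, i.2⟩
  left_inv _ := rfl
  right_inv _ := rfl

theorem logDet_upperLeft {N p : ℕ} {α : Type*} (h : p ≤ N) (A : Matrix (Fin N) (Fin N) α)
    (f : α → ℂ) : logDet ((upperLeft A p).map f) =
      logDet ((A.submatrix (Fin.castLE h) (Fin.castLE h)).map f) :=
  (logDet_submatrix_equiv _ (upperLeftEquiv h)).symm

theorem logDet_upperLeft_self {N : ℕ} {α : Type*} (A : Matrix (Fin N) (Fin N) α)
    (f : α → ℂ) : logDet ((upperLeft A N).map f) = logDet (A.map f) :=
  logDet_upperLeft le_rfl A f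

theorem logDet_upperLeft_submatrix {N N' p : ℕ} {α : Type*} (h : p ≤ N) (h' : N ≤ N')
    (A : Matrix (Fin N') (Fin N') α) (f : α → ℂ) :
    logDet ((upperLeft A p).map f) =
      logDet ((upperLeft (A.submatrix (Fin.castLE h') (Fin.castLE h')) p).map f) := by
  rw [logDet_upperLeft (h.trans h'), logDet_upperLeft h]
  rfl

/-- The eigenvalues are positive, so the principal logarithms are real and add up to the real
logarithm of the determinant. -/
theorem logDet_of_posDef {m : Type*} [Fintype m] [DecidableEq m] {A : Matrix m m ℂ}
    (hA : A.PosDef) : logDet A = (Real.log ‖A.det‖ : ℝ) := by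
  have hr : ∃ r : ℝ, logDet A = r := by
    refine ⟨∑ i, Real.log (hA.isHermitian.eigenvalues i), ?_⟩
    rw [logDet, hA.isHermitian.roots_charpoly_eq_eigenvalues, Multiset.map_map,
      Complex.ofReal_sum]
    refine Finset.sum_congr rfl fun i _ => ?_
    exact (Complex.ofReal_log (hA.eigenvalues_pos i).le).symm
  obtain ⟨r, hr⟩ := hr
  have h := exp_logDet hA.det_pos.ne'
  rw [hr] at h ⊢
  rw [← h, ← Complex.ofReal_exp, Complex.norm_real, Real.norm_of_nonneg (Real.exp_pos r).le,
    Real.log_exp]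

variable {𝕜 : Type*} [RCLike 𝕜] {n : ℕ}

theorem map_toComplex_conjTranspose {m l : Type*} (A : Matrix m l 𝕜) :
    Aᴴ.map (toComplex 𝕜) = (A.map (toComplex 𝕜))ᴴ := by
  ext i j
  exact map_star (toComplex 𝕜) (A j i)

theorem map_toComplex_mul {m l k : Type*} [Fintype l] (A : Matrix m l 𝕜) (B : Matrix l k 𝕜) :
    (A * B).map (toComplex 𝕜) = A.map (toComplex 𝕜) * B.map (toComplex 𝕜) :=
  Matrix.map_mul

theorem map_toComplex_add {m l : Type*} (A B : Matrix m l 𝕜) :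
    (A + B).map (toComplex 𝕜) = A.map (toComplex 𝕜) + B.map (toComplex 𝕜) :=
  Matrix.map_add _ (map_add _) A B

theorem det_map_toComplex {m : Type*} [Fintype m] [DecidableEq m] (A : Matrix m m 𝕜) :
    (A.map (toComplex 𝕜)).det = toComplex 𝕜 A.det :=
  ((toComplex 𝕜 : 𝕜 →⋆ₐ[ℝ] ℂ).toAlgHom.toRingHom.map_det A).symm

theorem map_toComplex_inv {m : Type*} [Fintype m] [DecidableEq m] {A : Matrix m m 𝕜}
    (hA : IsUnit A.det) : A⁻¹.map (toComplex 𝕜) = (A.map (toComplex 𝕜))⁻¹ := by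
  refine (inv_eq_right_inv ?_).symm
  rw [← map_toComplex_mul, mul_nonsing_inv _ hA]
  exact Matrix.map_one _ (map_zero _) (map_one _)

theorem posDef_map_toComplex {m : Type*} [Fintype m] [DecidableEq m] {A : Matrix m m 𝕜}
    (hA : A.PosDef) : (A.map (toComplex 𝕜)).PosDef := by
  obtain ⟨L, hL⟩ := exists_eq_conjTranspose_mul_self hA.posSemidef
  have hp : (A.map (toComplex 𝕜)).PosSemidef := by
    rw [hL, map_toComplex_mul, map_toComplex_conjTranspose]
    exact posSemidef_conjTranspose_mul_self _
  rw [hp.posDef_iff_det_ne_zero, det_map_toComplex, ← norm_ne_zero_iff, norm_toComplex,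
    norm_ne_zero_iff]
  exact hA.det_pos.ne'

theorem isSymplecticSymm_map_toComplex {A : Matrix (Fin (2 * n + 2) ⊕ Fin 2)
    (Fin (2 * n + 2) ⊕ Fin 2) 𝕜} (hA : IsSymplecticSymm (JBlock n 𝕜) A) :
    IsSymplecticSymm (JBlock n ℂ) (A.map (toComplex 𝕜)) := by
  have hJ : (JBlock n 𝕜).map (toComplex 𝕜) = JBlock n ℂ := by
    ext i j
    rcases i with i | i <;> rcases j with j | j
    · simp only [JBlock, J, map_apply, fromBlocks_apply₁₁, of_apply, apply_ite (toComplex 𝕜),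
        map_neg, map_one, map_zero]
    · simp [JBlock]
    · simp [JBlock]
    · fin_cases i <;> fin_cases j <;> simp [JBlock, J₂]
  have h := congrArg (fun X => X.map (toComplex 𝕜)) hA
  simp only [map_toComplex_mul, hJ] at h
  exact h

/-- Factorization of the logarithm of the determinant over `𝕜`. -/
theorem logDet_map_toComplex_eq_add {A : Matrix (Fin (2 * n + 2) ⊕ Fin 2)
    (Fin (2 * n + 2) ⊕ Fin 2) 𝕜} (hs : IsSymplecticSymm (JBlock n 𝕜) A) (hA : (A + Aᴴ).PosDef) :
    logDet (A.map (toComplex 𝕜)) = logDet (A.toBlocks₁₁.map (toComplex 𝕜)) +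
      2 * Complex.log (toComplex 𝕜 (schurCompl A 0 0)) := by
  rw [logDet_eq_add_log_schurCompl (isSymplecticSymm_map_toComplex hs)
    (by
      rw [← map_toComplex_conjTranspose, ← map_toComplex_add]
      exact posDef_map_toComplex hA)]
  have h : schurCompl (A.map (toComplex 𝕜)) = (schurCompl A).map (toComplex 𝕜) := by
    have hu := isUnit_det_of_dissipative (dissipative_toBlocks₁₁ hA)
    have h1 : (schurCompl A).map (toComplex 𝕜) = A.toBlocks₂₂.map (toComplex 𝕜) -
        (A.toBlocks₂₁ * A.toBlocks₁₁⁻¹ * A.toBlocks₁₂).map (toComplex 𝕜) :=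
      Matrix.map_sub _ (map_sub _) _ _
    rw [h1, map_toComplex_mul, map_toComplex_mul, map_toComplex_inv hu]
    rfl
  rw [h]
  rfl

/-! ### Factorization of the integrand -/

/-- The integrand over `𝕜`, with an additional exponent of index `0`. -/
noncomputable def genIntegrand (n : ℕ) (lam sig tau : ℕ → ℂ)
    (R : Matrix (Fin (2 * n + 2)) (Fin (2 * n + 2)) 𝕜) : ℂ :=
  (∏ j ∈ Finset.range (n + 1),
    detPow ((upperLeft (R + Rᴴ) (2 * j + 2)).map (toComplex 𝕜)) ((lam j - lam (j + 1)) / 2) /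
      detPowConj ((upperLeft (1 + R) (2 * j + 2)).map (toComplex 𝕜))
        ((sig j - sig (j + 1)) / 2) ((tau j - tau (j + 1)) / 2)) *
  detPow ((R + Rᴴ).map (toComplex 𝕜)) (-(Module.finrank ℝ 𝕜 * n : ℂ))

/-- Subtract `c` from the terms up to index `n` and delete the others. -/
def shiftTo (n : ℕ) (c : ℂ) (lam : ℕ → ℂ) (k : ℕ) : ℂ := if k ≤ n then lam k - c else 0

theorem detPow_div_detPowConj {m : Type*} [Fintype m] [DecidableEq m] (A B : Matrix m m ℂ)
    (a b c : ℂ) : detPow A a / detPowConj B b c =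
      Complex.exp (a * logDet A - b * logDet B - c * (starRingEnd ℂ) (logDet B)) := by
  rw [detPow, detPowConj, ← Complex.exp_add, ← Complex.exp_sub]
  ring_nf

/-- The scalar fields for which `det A * conj (det A) ^ (d - 1)` is positive on dissipative
matrices, where `d` is the real dimension of the field. -/
class DissipativeDetPos (𝕜 : Type*) [RCLike 𝕜] : Prop where
  det_mul_conj_pow : ∀ (k : ℕ) (A : Matrix (Fin k) (Fin k) 𝕜), (A + Aᴴ).PosDef →
    toComplex 𝕜 A.det * (starRingEnd ℂ) (toComplex 𝕜 A.det) ^ (Module.finrank ℝ 𝕜 - 1) =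
      (‖A.det‖ ^ Module.finrank ℝ 𝕜 : ℝ)

/-- On the segment to `1` the determinant never vanishes and it ends at `1`; the intermediate value
theorem excludes a negative sign. -/
theorem det_pos_of_dissipative {k : ℕ} {A : Matrix (Fin k) (Fin k) ℝ} (hA : (A + Aᴴ).PosDef) :
    0 < A.det := by
  by_contra! h
  have hc : ContinuousOn (fun t : ℝ => (1 + t • (A - 1)).det) (Set.Icc 0 1) := by
    fun_prop
  obtain ⟨t, ht, h0⟩ := intermediate_value_Icc' zero_le_one hc
    (show (0 : ℝ) ∈ Set.Icc _ _ from ⟨by simpa using h, by simp⟩)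
  exact det_ne_zero_of_dissipative (dissipative_segment hA ht.1 ht.2) h0

instance : DissipativeDetPos ℝ where
  det_mul_conj_pow k A hA := by
    rw [Module.finrank_self, toComplex_real, Real.norm_of_nonneg (det_pos_of_dissipative hA).le]
    simp

instance : DissipativeDetPos ℂ where
  det_mul_conj_pow k A hA := by
    rw [Complex.finrank_real_complex, toComplex_complex]
    simp [Complex.mul_conj, Complex.normSq_eq_norm_sq]

/-- The exponent by which the second exponents `tau` are shifted. -/
noncomputable def conjShift (𝕜 : Type*) [RCLike 𝕜] : ℂ := 2 * ((Module.finrank ℝ 𝕜 - 1 : ℕ) : ℂ)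

/-- The reciprocal of the Jacobian without its power of `2`, written in the form of the integrand.
It explains the shifts of `lam`, `sig` and `tau` by `d`, `2` and `2 (d - 1)`. -/
theorem exp_logDet_shift [DissipativeDetPos 𝕜] {P : Matrix (Fin (2 * n + 2)) (Fin (2 * n + 2)) 𝕜}
    (hP : P ∈ wedgeSection n 𝕜) :
    Complex.exp (-(Module.finrank ℝ 𝕜 / 2 : ℂ) * logDet ((P + Pᴴ).map (toComplex 𝕜)) -
      logDet ((1 + P).map (toComplex 𝕜)) -
      conjShift 𝕜 / 2 * (starRingEnd ℂ) (logDet ((1 + P).map (toComplex 𝕜)))) =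
      ((((‖(1 + P).det‖ * √‖(P + Pᴴ).det‖) ^ Module.finrank ℝ 𝕜)⁻¹ : ℝ) : ℂ) := by
  have hM := hP.2
  have hD := dissipative_one_add hM
  have hDdet := det_ne_zero_of_dissipative hD
  have hMdet : 0 < ‖(P + Pᴴ).det‖ := norm_pos_iff.2 hM.det_pos.ne'
  have hD' : ((1 + P).map (toComplex 𝕜)).det ≠ 0 := by
    rwa [det_map_toComplex, ← norm_ne_zero_iff, norm_toComplex, norm_ne_zero_iff]
  have h1 : Complex.exp (-(Module.finrank ℝ 𝕜 / 2 : ℂ) * logDet ((P + Pᴴ).map (toComplex 𝕜))) =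
      (((√‖(P + Pᴴ).det‖ ^ Module.finrank ℝ 𝕜)⁻¹ : ℝ) : ℂ) := by
    rw [logDet_of_posDef (posDef_map_toComplex hM), det_map_toComplex, norm_toComplex,
      ← Real.exp_log (pow_pos (Real.sqrt_pos.2 hMdet) (Module.finrank ℝ 𝕜)), ← Real.exp_neg,
      Real.log_pow, Real.log_sqrt hMdet.le, Complex.ofReal_exp]
    push_cast
    ring_nf
  have h2 : Complex.exp (logDet ((1 + P).map (toComplex 𝕜)) +
      conjShift 𝕜 / 2 * (starRingEnd ℂ) (logDet ((1 + P).map (toComplex 𝕜)))) =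
      ((‖(1 + P).det‖ ^ Module.finrank ℝ 𝕜 : ℝ) : ℂ) := by
    rw [conjShift, mul_div_cancel_left₀ _ two_ne_zero, Complex.exp_add, Complex.exp_nat_mul,
      Complex.exp_conj, exp_logDet hD', det_map_toComplex,
      DissipativeDetPos.det_mul_conj_pow _ _ hD]
  rw [sub_sub, Complex.exp_sub, h1, h2]
  push_cast
  rw [mul_pow, mul_inv, div_eq_mul_inv, mul_comm]

theorem submatrix_castLE_ofCoord (x : Coord (n + 1) → 𝕜) :
    (ofCoord x).submatrix (Fin.castLE (by omega : 2 * n + 2 ≤ 2 * (n + 1) + 2))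
      (Fin.castLE (by omega)) = ofCoord fun p => x (coordEquiv n (Sum.inl p)) := by
  have h := congrArg toBlocks₁₁ (ofCoord_submatrix_blockEquiv x)
  rw [extend, toBlocks_fromBlocks₁₁] at h
  exact h

/-- The blocks of size at most `2n + 2` are blocks of `P`, and the full matrices contribute `h` and
`u` through their Schur complements. Differences of consecutive exponents below index `n` are
unaffected by the shifts; at index `n` the shift exactly compensates the inserted reciprocal
Jacobian and the change of the exponent `-d n` to `-d (n + 1)`. -/
theorem genIntegrand_succ [DissipativeDetPos 𝕜] {lam sig tau : ℕ → ℂ} (hlam : lam (n + 2) = 0)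
    (hsig : sig (n + 2) = 0) (htau : tau (n + 2) = 0) {x : Coord (n + 1) → 𝕜}
    {P : Matrix (Fin (2 * n + 2)) (Fin (2 * n + 2)) 𝕜}
    {v : Fin (2 * n + 1) ⊕ Fin (2 * n + 1) → 𝕜} {y : 𝕜}
    (hPx : P = ofCoord fun p => x (coordEquiv n (Sum.inl p)))
    (hv : v = fun k => x (coordEquiv n (Sum.inr (Sum.inl k))))
    (hy : y = x (coordEquiv n (Sum.inr (Sum.inr ()))))
    (hP : P ∈ wedgeSection n 𝕜) (hh : 0 < hermRatio P v y) :
    genIntegrand (n + 1) lam sig tau (ofCoord x) =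
      genIntegrand n (shiftTo n (Module.finrank ℝ 𝕜) lam) (shiftTo n 2 sig)
        (shiftTo n (conjShift 𝕜) tau) P *
      ((((‖(1 + P).det‖ * √‖(P + Pᴴ).det‖) ^ Module.finrank ℝ 𝕜)⁻¹ : ℝ) : ℂ) *
      powKernel (lam (n + 1) - 2 * Module.finrank ℝ 𝕜 * (n + 1)) (sig (n + 1)) (tau (n + 1))
        (hermRatio P v y) (shiftRatio P v y) := by
  set R := ofCoord x with hR
  have hxR : R ∈ wedgeSection (n + 1) 𝕜 := by
    rw [hR, mem_wedgeSection_succ_iff, ← hPx, ← hv, ← hy]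
    exact ⟨hP, hh⟩
  set E := extend P v y with hE
  have hRE : R.submatrix (blockEquiv n) (blockEquiv n) = E := by
    rw [hR, ofCoord_submatrix_blockEquiv, hE, hPx, hv, hy]
  have hle : 2 * n + 2 ≤ 2 * (n + 1) + 2 := by omega
  have hRP : R.submatrix (Fin.castLE hle) (Fin.castLE hle) = P := by
    rw [hR, hPx, ← submatrix_castLE_ofCoord]
  have hME : (R + Rᴴ).submatrix (blockEquiv n) (blockEquiv n) = E + Eᴴ := by
    rw [← hRE, conjTranspose_submatrix]
    rfl
  have hDE : (1 + R).submatrix (blockEquiv n) (blockEquiv n) = 1 + E := by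
    rw [← hRE, submatrix_add, Pi.add_apply, Pi.add_apply, submatrix_one_equiv]
  have hMP : (R + Rᴴ).submatrix (Fin.castLE hle) (Fin.castLE hle) = P + Pᴴ := by
    rw [← hRP, conjTranspose_submatrix]
    rfl
  have hDP : (1 + R).submatrix (Fin.castLE hle) (Fin.castLE hle) = 1 + P := by
    rw [← hRP, submatrix_add, Pi.add_apply, Pi.add_apply,
      submatrix_one _ (Fin.castLE_injective hle)]
  have hEs : IsSymplecticSymm (JBlock n 𝕜) E := isSymplecticSymm_extend
    (isSymplecticSymm_of_mem hP.1) v y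
  have hEpos : (E + Eᴴ).PosDef := by
    rw [← hME]
    exact hxR.2.submatrix (blockEquiv n).injective
  have hMlog : logDet ((R + Rᴴ).map (toComplex 𝕜)) = logDet ((P + Pᴴ).map (toComplex 𝕜)) +
      2 * Complex.log (hermRatio P v y) := by
    have h := logDet_map_toComplex_eq_add
      (hEs.add (hEs.conjTranspose JBlock_mul_JBlock JBlock_conjTranspose)) (by
        rw [(isHermitian_add_transpose_self E).eq]
        exact hEpos.add hEpos)
    rw [toBlocks₁₁_extend_add, schurCompl_extend_add, toComplex_ofReal, ← hME] at h
    rw [← h, ← submatrix_map, logDet_submatrix_equiv]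
  have hDlog : logDet ((1 + R).map (toComplex 𝕜)) = logDet ((1 + P).map (toComplex 𝕜)) +
      2 * Complex.log (toComplex 𝕜 (shiftRatio P v y)) := by
    have h := logDet_map_toComplex_eq_add (IsSymplecticSymm.one.add hEs)
      (dissipative_one_add hEpos)
    rw [toBlocks₁₁_one_add_extend, schurCompl_one_add_extend, ← hDE] at h
    rw [← h, ← submatrix_map, logDet_submatrix_equiv]
  have hh' : (hermRatio P v y : ℂ) ≠ 0 := Complex.ofReal_ne_zero.2 hh.ne'
  rw [← exp_logDet_shift hP, powKernel_of_pos hh, Complex.cpow_def_of_ne_zero hh']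
  simp only [genIntegrand, detPow_div_detPowConj]
  simp only [detPow, ← Complex.exp_sum, ← Complex.exp_add]
  congr 1
  have htop : 2 * (n + 1) + 2 = 2 * n + 2 + 2 := by ring
  rw [Finset.sum_range_succ, Finset.sum_range_succ, Finset.sum_range_succ (n := n)]
  rw [logDet_upperLeft_self (R + Rᴴ), logDet_upperLeft_self (1 + R),
    logDet_upperLeft_submatrix le_rfl hle (R + Rᴴ), logDet_upperLeft_submatrix le_rfl hle (1 + R),
    hMP, hDP, logDet_upperLeft_self (P + Pᴴ), logDet_upperLeft_self (1 + P), hMlog, hDlog]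
  have hsum : ∑ j ∈ Finset.range n,
      ((lam j - lam (j + 1)) / 2 * logDet ((upperLeft (R + Rᴴ) (2 * j + 2)).map (toComplex 𝕜)) -
        (sig j - sig (j + 1)) / 2 * logDet ((upperLeft (1 + R) (2 * j + 2)).map (toComplex 𝕜)) -
        (tau j - tau (j + 1)) / 2 * (starRingEnd ℂ)
          (logDet ((upperLeft (1 + R) (2 * j + 2)).map (toComplex 𝕜)))) =
      ∑ j ∈ Finset.range n,
      ((shiftTo n (Module.finrank ℝ 𝕜) lam j - shiftTo n (Module.finrank ℝ 𝕜) lam (j + 1)) / 2 *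
          logDet ((upperLeft (P + Pᴴ) (2 * j + 2)).map (toComplex 𝕜)) -
        (shiftTo n 2 sig j - shiftTo n 2 sig (j + 1)) / 2 *
          logDet ((upperLeft (1 + P) (2 * j + 2)).map (toComplex 𝕜)) -
        (shiftTo n (conjShift 𝕜) tau j - shiftTo n (conjShift 𝕜) tau (j + 1)) / 2 *
          (starRingEnd ℂ) (logDet ((upperLeft (1 + P) (2 * j + 2)).map (toComplex 𝕜)))) := by
    refine Finset.sum_congr rfl fun j hj => ?_
    have hj' : j < n := Finset.mem_range.1 hj
    rw [logDet_upperLeft_submatrix (by omega) hle (R + Rᴴ),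
      logDet_upperLeft_submatrix (by omega) hle (1 + R), hMP, hDP]
    simp only [shiftTo, if_pos hj'.le, if_pos (Nat.succ_le_of_lt hj'), sub_sub_sub_cancel_right]
  rw [hsum]
  simp only [shiftTo, le_refl, if_true, if_neg (Nat.not_succ_le_self n), hlam, hsig, htau]
  simp only [map_add, map_mul, Complex.conj_ofNat]
  push_cast
  ring

end Recursion

end MatrixBeta

namespace MatrixBeta

/-! ### The integral over the section of the wedge -/

section Induction

set_option linter.unusedSectionVars false

variable {𝕜 : Type*} [RCLike 𝕜] {n : ℕ}

@[fun_prop]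
theorem continuous_ofCoord : Continuous (ofCoord : (Coord n → 𝕜) → _) := by
  have h : Continuous (skew : (Coord n → 𝕜) → Matrix (Fin (2 * n + 2)) (Fin (2 * n + 2)) 𝕜) := by
    refine continuous_matrix fun i j => ?_
    simp only [skew, of_apply]
    split_ifs <;> fun_prop
  exact continuous_const.matrix_mul h

theorem measurable_inv_apply {X : Type*} [TopologicalSpace X] [MeasurableSpace X]
    [OpensMeasurableSpace X] [MeasurableSpace 𝕜] [BorelSpace 𝕜] {m : Type*} [Fintype m]
    [DecidableEq m] {A : X → Matrix m m 𝕜} (hA : Continuous A) (i j : m) :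
    Measurable fun x => (A x)⁻¹ i j := by
  simp only [inv_def, Ring.inverse_eq_inv', Matrix.smul_apply, smul_eq_mul]
  exact hA.matrix_det.measurable.inv.mul (hA.matrix_adjugate.matrix_elem i j).measurable

theorem measurable_dotProduct_inv_mulVec {X : Type*} [TopologicalSpace X] [MeasurableSpace X]
    [OpensMeasurableSpace X] [MeasurableSpace 𝕜] [BorelSpace 𝕜] {m : Type*} [Fintype m]
    [DecidableEq m] {A : X → Matrix m m 𝕜} (hA : Continuous A) {a b : X → m → 𝕜}
    (ha : Continuous a) (hb : Continuous b) :
    Measurable fun x => a x ⬝ᵥ ((A x)⁻¹ *ᵥ b x) := by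
  simp only [dotProduct, mulVec]
  refine Finset.measurable_sum _ fun i _ => ?_
  refine ((continuous_apply i).comp ha).measurable.mul (Finset.measurable_sum _ fun j _ => ?_)
  exact (measurable_inv_apply hA i j).mul ((continuous_apply j).comp hb).measurable

variable [MeasureSpace 𝕜] [StandardScalars 𝕜]

theorem measurable_hermRatio : Measurable fun q : (Coord n → 𝕜) ×
    ((Fin (2 * n + 1) ⊕ Fin (2 * n + 1) → 𝕜) × 𝕜) => hermRatio (ofCoord q.1) q.2.1 q.2.2 := by
  unfold hermRatio
  refine Measurable.sub (by fun_prop) (RCLike.continuous_re.measurable.comp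
    (measurable_dotProduct_inv_mulVec ?_ ?_ ?_)) <;> fun_prop

theorem measurable_shiftRatio : Measurable fun q : (Coord n → 𝕜) ×
    ((Fin (2 * n + 1) ⊕ Fin (2 * n + 1) → 𝕜) × 𝕜) => shiftRatio (ofCoord q.1) q.2.1 q.2.2 := by
  unfold shiftRatio
  refine Measurable.sub (by fun_prop) (measurable_dotProduct_inv_mulVec ?_ ?_ ?_) <;> fun_prop

/-! ### Fubini over the fibers and induction -/

/-- Splitting of the coordinates. -/
noncomputable def splitCoord (n : ℕ) (𝕜 : Type*) [MeasurableSpace 𝕜] :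
    (Coord (n + 1) → 𝕜) ≃ᵐ
      (Coord n → 𝕜) × ((Fin (2 * n + 1) ⊕ Fin (2 * n + 1) → 𝕜) × 𝕜) :=
  ((MeasurableEquiv.piCongrLeft (fun _ => 𝕜) (coordEquiv n)).symm.trans
    (MeasurableEquiv.sumPiEquivProdPi fun _ => 𝕜)).trans
    (MeasurableEquiv.prodCongr (MeasurableEquiv.refl _)
      ((MeasurableEquiv.sumPiEquivProdPi fun _ => 𝕜).trans
        (MeasurableEquiv.prodCongr (MeasurableEquiv.refl _) (MeasurableEquiv.funUnique Unit 𝕜))))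

theorem splitCoord_apply {𝕜 : Type*} [MeasurableSpace 𝕜] (x : Coord (n + 1) → 𝕜) :
    splitCoord n 𝕜 x =
    (fun p => x (coordEquiv n (Sum.inl p)), fun k => x (coordEquiv n (Sum.inr (Sum.inl k))),
      x (coordEquiv n (Sum.inr (Sum.inr ())))) := rfl

theorem measurePreserving_splitCoord : MeasurePreserving (splitCoord n 𝕜) := by
  have h1 := (volume_measurePreserving_piCongrLeft (fun _ => 𝕜) (coordEquiv n)).symm
  have h2 := volume_measurePreserving_sumPiEquivProdPi
    (fun _ : Coord n ⊕ ((Fin (2 * n + 1) ⊕ Fin (2 * n + 1)) ⊕ Unit) => 𝕜)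
  have h3 := volume_measurePreserving_sumPiEquivProdPi
    (fun _ : (Fin (2 * n + 1) ⊕ Fin (2 * n + 1)) ⊕ Unit => 𝕜)
  have h4 := volume_preserving_funUnique Unit 𝕜
  exact ((MeasurePreserving.id volume).prod (((MeasurePreserving.id volume).prod h4).comp h3)).comp
    (h2.comp h1)

variable (𝕜 n) in
theorem measurableSet_wedgeSection :
    MeasurableSet {x : Coord n → 𝕜 | ofCoord x ∈ wedgeSection n 𝕜} := by
  induction n with
  | zero =>
    have : IsEmpty (Coord 0) := ⟨fun p => by
      have h1 := p.2.1
      have h2 : (p.1.1 : ℕ) < p.1.2 := p.2.2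
      have h3 := p.1.2.2
      omega⟩
    exact Subsingleton.measurableSet
  | succ n ih =>
    have h : {x : Coord (n + 1) → 𝕜 | ofCoord x ∈ wedgeSection (n + 1) 𝕜} =
        splitCoord n 𝕜 ⁻¹' ((Prod.fst ⁻¹' {x : Coord n → 𝕜 | ofCoord x ∈ wedgeSection n 𝕜}) ∩
          {q | 0 < hermRatio (ofCoord q.1) q.2.1 q.2.2}) := by
      ext x
      exact mem_wedgeSection_succ_iff x
    rw [h]
    exact (splitCoord n 𝕜).measurable ((measurable_fst ih).inter
      (measurableSet_lt measurable_const measurable_hermRatio))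

/-- The factor that comes from the integration over the last two rows and columns. -/
noncomputable def fiberConst (𝕜 : Type*) [RCLike 𝕜] [MeasureSpace 𝕜] (n : ℕ) (α σ τ : ℂ) : ℂ :=
  (1 / 2 ^ (n + 2)) ^ Module.finrank ℝ 𝕜 *
    ((Real.pi : ℂ) ^ (Module.finrank ℝ 𝕜 * (2 * n + 1)) *
      (2 : ℂ) ^ ((Module.finrank ℝ 𝕜 * (2 * n + 1) : ℂ) - (σ + τ - α - Module.finrank ℝ 𝕜)) *
      (Complex.Gamma (σ + τ - α - Module.finrank ℝ 𝕜 - Module.finrank ℝ 𝕜 * (2 * n + 1)) /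
        Complex.Gamma (σ + τ - α - Module.finrank ℝ 𝕜)) *
      ∫ y : 𝕜, powKernel α σ τ (2 * RCLike.re y) (1 / 2 + y))

/-- The condition for the convergence of the integral over the last two rows and columns. -/
def FiberIntegrable (𝕜 : Type*) [RCLike 𝕜] [MeasureSpace 𝕜] (n : ℕ) (α σ τ : ℂ) : Prop :=
  Integrable (fun y : 𝕜 => powKernel α σ τ (2 * RCLike.re y) (1 / 2 + y)) ∧
    (Module.finrank ℝ 𝕜 * (2 * n + 1) : ℝ) < (σ + τ - α - Module.finrank ℝ 𝕜).re

/-- The normalized kernel of the integration over the last two rows and columns. -/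
noncomputable def normKernel (α σ τ : ℂ) (P : Matrix (Fin (2 * n + 2)) (Fin (2 * n + 2)) 𝕜)
    (p : (Fin (2 * n + 1) ⊕ Fin (2 * n + 1) → 𝕜) × 𝕜) : ℂ :=
  ((((‖(1 + P).det‖ * √‖(P + Pᴴ).det‖) ^ Module.finrank ℝ 𝕜)⁻¹ : ℝ) : ℂ) *
    powKernel α σ τ (hermRatio P p.1 p.2) (shiftRatio P p.1 p.2)

theorem inv_norm_det_pow_mul {P : Matrix (Fin (2 * n + 2)) (Fin (2 * n + 2)) 𝕜}
    (hP : P ∈ wedgeSection n 𝕜) :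
    ((‖(1 + P).det‖ * √‖(P + Pᴴ).det‖) ^ Module.finrank ℝ 𝕜)⁻¹ *
      (‖(1 + P).det‖ * √‖(P + Pᴴ).det‖ / 2 ^ (n + 2)) ^ Module.finrank ℝ 𝕜 =
      (1 / 2 ^ (n + 2)) ^ Module.finrank ℝ 𝕜 := by
  have hM : 0 < ‖(P + Pᴴ).det‖ := norm_pos_iff.2 hP.2.det_pos.ne'
  have hD : 0 < ‖(1 + P).det‖ :=
    norm_pos_iff.2 (det_ne_zero_of_dissipative (dissipative_one_add hP.2))
  rw [← inv_pow, ← mul_pow]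
  congr 1
  have := Real.sqrt_pos.2 hM
  field_simp

theorem integral_normKernel {α σ τ : ℂ} (h : FiberIntegrable 𝕜 n α σ τ)
    {P : Matrix (Fin (2 * n + 2)) (Fin (2 * n + 2)) 𝕜} (hP : P ∈ wedgeSection n 𝕜) :
    Integrable (normKernel α σ τ P) ∧ ∫ p, normKernel α σ τ P p = fiberConst 𝕜 n α σ τ := by
  obtain ⟨h1, h2⟩ := (isHomogeneousKernel_powKernel α σ τ).integral_fiber
    (measurable_powKernel (𝕜 := 𝕜) α σ τ) h.1 hP h.2
  refine ⟨h1.const_mul _, ?_⟩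
  have hc := inv_norm_det_pow_mul hP
  simp only [normKernel]
  rw [integral_const_mul, h2, fiberConst, ← mul_assoc, ← Complex.ofReal_mul, hc]
  push_cast
  rfl

variable (𝕜) in
-- Only the independence of the constant from `P` matters: it bounds the fiberwise absolute
-- integrals uniformly.
theorem exists_integral_norm_normKernel {α σ τ : ℂ} (h : FiberIntegrable 𝕜 n α σ τ) :
    ∃ C : ℝ, ∀ P ∈ wedgeSection n 𝕜, ∫ p, ‖normKernel α σ τ P p‖ = C := by
  have hk := (isHomogeneousKernel_powKernel (𝕜 := 𝕜) α σ τ).norm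
  obtain ⟨X, hX⟩ : ∃ X : ℂ, ∀ P ∈ wedgeSection n 𝕜,
      ∫ p : (Fin (2 * n + 1) ⊕ Fin (2 * n + 1) → 𝕜) × 𝕜,
        (‖powKernel α σ τ (hermRatio P p.1 p.2) (shiftRatio P p.1 p.2)‖ : ℂ) =
      (((‖(1 + P).det‖ * √‖(P + Pᴴ).det‖ / 2 ^ (n + 2)) ^ Module.finrank ℝ 𝕜 : ℝ) : ℂ) * X :=
    ⟨_, fun P hP => (hk.integral_fiber
      (Complex.measurable_ofReal.comp (measurable_powKernel (𝕜 := 𝕜) α σ τ).norm)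
      h.1.norm.ofReal hP (by simpa using h.2)).2⟩
  refine ⟨(1 / 2 ^ (n + 2)) ^ Module.finrank ℝ 𝕜 * X.re, fun P hP => ?_⟩
  have h2 := hX P hP
  have hc := inv_norm_det_pow_mul hP
  have hpos : 0 ≤ ((‖(1 + P).det‖ * √‖(P + Pᴴ).det‖) ^ Module.finrank ℝ 𝕜)⁻¹ := by positivity
  rw [integral_complex_ofReal] at h2
  have h3 := congrArg Complex.re h2
  rw [Complex.ofReal_re, Complex.re_ofReal_mul] at h3
  simp only [normKernel, norm_mul, Complex.norm_real, Real.norm_of_nonneg hpos]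
  rw [integral_const_mul, h3, ← mul_assoc, hc]

theorem measurable_normKernel (α σ τ : ℂ) : Measurable fun q : (Coord n → 𝕜) ×
    ((Fin (2 * n + 1) ⊕ Fin (2 * n + 1) → 𝕜) × 𝕜) => normKernel α σ τ (ofCoord q.1) q.2 := by
  refine Measurable.mul ?_ ((measurable_powKernel (𝕜 := 𝕜) α σ τ).comp
    (measurable_hermRatio.prodMk measurable_shiftRatio))
  refine Complex.measurable_ofReal.comp (Measurable.inv ?_)
  exact Continuous.measurable (by fun_prop)

variable [DissipativeDetPos 𝕜]

/-- The kernel vanishes for `h ≤ 0`, so the condition on the fiber is carried by the kernel and only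
the indicator of the base remains. -/
theorem indicator_genIntegrand_succ {lam sig tau : ℕ → ℂ} (hlam : lam (n + 2) = 0)
    (hsig : sig (n + 2) = 0) (htau : tau (n + 2) = 0) (x : Coord (n + 1) → 𝕜) :
    {x : Coord (n + 1) → 𝕜 | ofCoord x ∈ wedgeSection (n + 1) 𝕜}.indicator
      (fun x => genIntegrand (n + 1) lam sig tau (ofCoord x)) x =
    {x : Coord n → 𝕜 | ofCoord x ∈ wedgeSection n 𝕜}.indicator
      (fun x => genIntegrand n (shiftTo n (Module.finrank ℝ 𝕜) lam) (shiftTo n 2 sig)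
        (shiftTo n (conjShift 𝕜) tau) (ofCoord x)) (splitCoord n 𝕜 x).1 *
      normKernel (lam (n + 1) - 2 * Module.finrank ℝ 𝕜 * (n + 1)) (sig (n + 1)) (tau (n + 1))
        (ofCoord (splitCoord n 𝕜 x).1) (splitCoord n 𝕜 x).2 := by
  rw [splitCoord_apply]
  simp only
  by_cases hP : (ofCoord fun p => x (coordEquiv n (Sum.inl p))) ∈ wedgeSection n 𝕜
  · rw [Set.indicator_of_mem (a := fun p => x (coordEquiv n (Sum.inl p))) (by exact hP)]
    by_cases hh : 0 < hermRatio (ofCoord fun p => x (coordEquiv n (Sum.inl p)))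
        (fun k => x (coordEquiv n (Sum.inr (Sum.inl k)))) (x (coordEquiv n (Sum.inr (Sum.inr ()))))
    · rw [Set.indicator_of_mem (by exact (mem_wedgeSection_succ_iff x).2 ⟨hP, hh⟩),
        genIntegrand_succ hlam hsig htau rfl rfl rfl hP hh, normKernel, mul_assoc]
    · rw [Set.indicator_of_notMem (by exact fun h => hh ((mem_wedgeSection_succ_iff x).1 h).2),
      normKernel,
        powKernel, if_neg hh, mul_zero, mul_zero]
  · rw [Set.indicator_of_notMem (by exact fun h => hP ((mem_wedgeSection_succ_iff x).1 h).1),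
      Set.indicator_of_notMem (by exact hP), zero_mul]

theorem integral_genIntegrand_succ {lam sig tau : ℕ → ℂ} (hlam : lam (n + 2) = 0)
    (hsig : sig (n + 2) = 0) (htau : tau (n + 2) = 0)
    (hG : IntegrableOn (fun x : Coord n → 𝕜 => genIntegrand n
      (shiftTo n (Module.finrank ℝ 𝕜) lam) (shiftTo n 2 sig) (shiftTo n (conjShift 𝕜) tau)
        (ofCoord x)) {x | ofCoord x ∈ wedgeSection n 𝕜})
    (hk : FiberIntegrable 𝕜 n (lam (n + 1) - 2 * Module.finrank ℝ 𝕜 * (n + 1)) (sig (n + 1))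
      (tau (n + 1))) :
    IntegrableOn (fun x : Coord (n + 1) → 𝕜 => genIntegrand (n + 1) lam sig tau (ofCoord x))
        {x | ofCoord x ∈ wedgeSection (n + 1) 𝕜} ∧
      ∫ x : Coord (n + 1) → 𝕜 in {x | ofCoord x ∈ wedgeSection (n + 1) 𝕜},
          genIntegrand (n + 1) lam sig tau (ofCoord x) =
        (∫ x : Coord n → 𝕜 in {x | ofCoord x ∈ wedgeSection n 𝕜}, genIntegrand n
          (shiftTo n (Module.finrank ℝ 𝕜) lam) (shiftTo n 2 sig) (shiftTo n (conjShift 𝕜) tau)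
            (ofCoord x)) *
          fiberConst 𝕜 n (lam (n + 1) - 2 * Module.finrank ℝ 𝕜 * (n + 1)) (sig (n + 1))
            (tau (n + 1)) := by
  set α := lam (n + 1) - 2 * Module.finrank ℝ 𝕜 * (n + 1) with hα
  set S := {x : Coord n → 𝕜 | ofCoord x ∈ wedgeSection n 𝕜} with hS
  set G := fun x : Coord n → 𝕜 => genIntegrand n
    (shiftTo n (Module.finrank ℝ 𝕜) lam) (shiftTo n 2 sig) (shiftTo n (conjShift 𝕜) tau)
      (ofCoord x) with hGdef
  have hSm : MeasurableSet S := measurableSet_wedgeSection 𝕜 n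
  have hGi : Integrable (S.indicator G) := hG.integrable_indicator hSm
  set Φ : (Coord n → 𝕜) × ((Fin (2 * n + 1) ⊕ Fin (2 * n + 1) → 𝕜) × 𝕜) → ℂ := fun q =>
    S.indicator G q.1 * normKernel α (sig (n + 1)) (tau (n + 1)) (ofCoord q.1) q.2 with hΦ
  have hsf : SFinite (volume : Measure ((Fin (2 * n + 1) ⊕ Fin (2 * n + 1) → 𝕜) × 𝕜)) :=
    Measure.prod.instSFinite (μ := (volume : Measure (Fin (2 * n + 1) ⊕ Fin (2 * n + 1) → 𝕜)))
      (ν := (volume : Measure 𝕜))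
  have hΦm : AEStronglyMeasurable Φ (volume.prod volume) :=
    hGi.aestronglyMeasurable.comp_fst.mul (measurable_normKernel _ _ _).aestronglyMeasurable
  obtain ⟨C, hC⟩ := exists_integral_norm_normKernel 𝕜 hk
  have hi : ∀ x, ∫ p, Φ (x, p) = S.indicator G x *
      fiberConst 𝕜 n α (sig (n + 1)) (tau (n + 1)) := by
    intro x
    simp only [hΦ]
    by_cases hx : x ∈ S
    · rw [integral_const_mul, (integral_normKernel hk hx).2]
    · simp [Set.indicator_of_notMem hx]
  have hn : ∀ x, ∫ p, ‖Φ (x, p)‖ = ‖S.indicator G x‖ * C := by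
    intro x
    simp only [hΦ, norm_mul]
    by_cases hx : x ∈ S
    · rw [integral_const_mul, hC _ hx]
    · simp [Set.indicator_of_notMem hx]
  have hΦi : Integrable Φ (volume.prod volume) := by
    refine (integrable_prod_iff hΦm).2 ⟨Filter.Eventually.of_forall fun x => ?_, ?_⟩
    · simp only [hΦ]
      by_cases hx : x ∈ S
      · exact (integral_normKernel hk hx).1.const_mul _
      · simp [Set.indicator_of_notMem hx]
    · simp only [hn]
      exact hGi.norm.mul_const C
  have hmp := measurePreserving_splitCoord (𝕜 := 𝕜) (n := n)
  have hemb := (splitCoord n 𝕜).measurableEmbedding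
  have hSm' := measurableSet_wedgeSection 𝕜 (n + 1)
  have heq : {x : Coord (n + 1) → 𝕜 | ofCoord x ∈ wedgeSection (n + 1) 𝕜}.indicator
      (fun x => genIntegrand (n + 1) lam sig tau (ofCoord x)) = fun x => Φ (splitCoord n 𝕜 x) :=
    funext (indicator_genIntegrand_succ hlam hsig htau)
  refine ⟨(integrable_indicator_iff hSm').1 ?_, ?_⟩
  · rw [heq]
    exact (hmp.integrable_comp_emb hemb).2 hΦi
  · rw [← integral_indicator hSm', heq, ← integral_indicator hSm]
    refine (hmp.integral_comp hemb Φ).trans ((integral_prod _ hΦi).trans ?_)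
    simp only [hi]
    rw [integral_mul_const]

/-- There are no coordinates and `R = 1`, so the integral is the value at one point. The exponents
of index `0`, shifted along with the others, are all that is left. -/
theorem integral_genIntegrand_zero {lam sig tau : ℕ → ℂ} (hlam : lam 1 = 0)
    (hsig : sig 1 = 0) (htau : tau 1 = 0) :
    IntegrableOn (fun x : Coord 0 → 𝕜 => genIntegrand 0 lam sig tau (ofCoord x))
        {x | ofCoord x ∈ wedgeSection 0 𝕜} ∧
      ∫ x : Coord 0 → 𝕜 in {x | ofCoord x ∈ wedgeSection 0 𝕜},
          genIntegrand 0 lam sig tau (ofCoord x) = 2 ^ (lam 0 - sig 0 - tau 0) := by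
  have hempty : IsEmpty (Coord 0) := ⟨fun p => by
    have h1 := p.2.1
    have h2 : (p.1.1 : ℕ) < p.1.2 := p.2.2
    have h3 := p.1.2.2
    omega⟩
  have hR : ∀ x : Coord 0 → 𝕜, ofCoord x = 1 := by
    intro x
    obtain ⟨-, h01, hc, hr⟩ := ofCoord_mem x
    ext i j
    fin_cases i <;> fin_cases j
    · simpa using hc 0
    · simpa using h01
    · simpa using hc 1
    · simpa using hr 1
  have hpos : ((1 : Matrix (Fin (2 * 0 + 2)) (Fin (2 * 0 + 2)) 𝕜) + 1).PosDef :=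
    PosDef.one.add PosDef.one
  have hset : {x : Coord 0 → 𝕜 | ofCoord x ∈ wedgeSection 0 𝕜} = Set.univ := by
    refine Set.eq_univ_of_forall fun x => ⟨ofCoord_mem x, ?_⟩
    rw [hR, conjTranspose_one]
    exact hpos
  have hlog : logDet (((1 : Matrix (Fin (2 * 0 + 2)) (Fin (2 * 0 + 2)) 𝕜) + 1).map (toComplex 𝕜)) =
      2 * Complex.log 2 := by
    have hdet : ((1 : Matrix (Fin (2 * 0 + 2)) (Fin (2 * 0 + 2)) 𝕜) + 1).det = 2 ^ 2 := by
      rw [one_add_one_eq_two, ← diagonal_ofNat, det_diagonal]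
      simp
    rw [logDet_of_posDef (posDef_map_toComplex hpos), det_map_toComplex, norm_toComplex, hdet,
      norm_pow, RCLike.norm_ofNat, Real.log_pow]
    simp
  have hval : ∀ x : Coord 0 → 𝕜,
      genIntegrand 0 lam sig tau (ofCoord x) = 2 ^ (lam 0 - sig 0 - tau 0) := by
    intro x
    have hconj : (starRingEnd ℂ) (Complex.log 2) = Complex.log 2 := by
      have : Complex.log 2 = (Real.log 2 : ℝ) := by simp
      rw [this, Complex.conj_ofReal]
    simp only [genIntegrand, hR, conjTranspose_one, zero_add, Finset.prod_range_one,
      detPow_div_detPowConj]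
    rw [logDet_upperLeft_self, hlog, hlam, hsig, htau, detPow, hlog, ← Complex.exp_add,
      Complex.cpow_def_of_ne_zero two_ne_zero, map_mul, Complex.conj_ofNat, hconj]
    congr 1
    push_cast
    ring
  rw [hset, setIntegral_univ, integrableOn_univ]
  simp only [hval]
  have hvol : (volume : Measure (Coord 0 → 𝕜)) = Measure.dirac isEmptyElim :=
    Measure.pi_of_empty _ _
  rw [hvol, integral_dirac]
  exact ⟨integrable_const _, rfl⟩

/-- The integral as a product of one-dimensional integrals. -/
theorem integral_genIntegrand (n : ℕ) : ∀ {lam sig tau : ℕ → ℂ}, lam (n + 1) = 0 →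
    sig (n + 1) = 0 → tau (n + 1) = 0 →
    (∀ j < n, FiberIntegrable 𝕜 j (lam (j + 1) - Module.finrank ℝ 𝕜 * (n + j + 1))
      (sig (j + 1) - 2 * (n - j - 1)) (tau (j + 1) - conjShift 𝕜 * (n - j - 1))) →
    IntegrableOn (fun x : Coord n → 𝕜 => genIntegrand n lam sig tau (ofCoord x))
        {x | ofCoord x ∈ wedgeSection n 𝕜} ∧
      ∫ x : Coord n → 𝕜 in {x | ofCoord x ∈ wedgeSection n 𝕜},
          genIntegrand n lam sig tau (ofCoord x) =
        2 ^ (lam 0 - sig 0 - tau 0 + Module.finrank ℝ 𝕜 * n) *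
          ∏ j ∈ Finset.range n, fiberConst 𝕜 j (lam (j + 1) - Module.finrank ℝ 𝕜 * (n + j + 1))
            (sig (j + 1) - 2 * (n - j - 1)) (tau (j + 1) - conjShift 𝕜 * (n - j - 1)) := by
  induction n with
  | zero =>
    intro lam sig tau hlam hsig htau _
    have h := integral_genIntegrand_zero (𝕜 := 𝕜) hlam hsig htau
    simpa using h
  | succ n ih =>
    intro lam sig tau hlam hsig htau hf
    have hs : ∀ (c : ℂ) (f : ℕ → ℂ), shiftTo n c f (n + 1) = 0 := fun c f =>
      if_neg (Nat.not_succ_le_self n)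
    have hs' : ∀ (c : ℂ) (f : ℕ → ℂ) (j : ℕ), j < n → shiftTo n c f (j + 1) = f (j + 1) - c :=
      fun c f j hj => if_pos hj
    have hs0 : ∀ (c : ℂ) (f : ℕ → ℂ), shiftTo n c f 0 = f 0 - c := fun c f => if_pos (Nat.zero_le n)
    have e1 : ∀ (c a : ℂ) (j : ℕ), a - c - c * (n + j + 1) = a - c * ((n + 1 : ℕ) + j + 1) := by
      intro c a j; push_cast; ring
    have e2 : ∀ (c a : ℂ) (j : ℕ), a - c - c * (n - j - 1) = a - c * ((n + 1 : ℕ) - j - 1) := by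
      intro c a j; push_cast; ring
    obtain ⟨h1, h2⟩ := ih (hs (Module.finrank ℝ 𝕜) lam) (hs 2 sig) (hs (conjShift 𝕜) tau) (by
      intro j hj
      rw [hs' _ _ _ hj, hs' _ _ _ hj, hs' _ _ _ hj, e1, e2, e2]
      exact hf j (by omega))
    have e3 : lam (n + 1) - Module.finrank ℝ 𝕜 * ((n + 1 : ℕ) + n + 1) =
        lam (n + 1) - 2 * Module.finrank ℝ 𝕜 * (n + 1) := by push_cast; ring
    have e4 : ∀ c a : ℂ, a - c * ((n + 1 : ℕ) - n - 1) = a := by intro c a; push_cast; ring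
    have hl := hf n (Nat.lt_succ_self n)
    rw [e3, e4, e4] at hl
    obtain ⟨h3, h4⟩ := integral_genIntegrand_succ hlam hsig htau h1 hl
    refine ⟨h3, ?_⟩
    rw [h4, h2, Finset.prod_range_succ, e3, e4, e4, ← mul_assoc]
    congr 2
    · congr 1
      -- Each step changes `lam 0 - sig 0 - tau 0` by `-d + 2 + 2 (d - 1) = d`, which accounts for
      -- the summand `d n` in the exponent.
      rw [hs0, hs0, hs0, conjShift]
      have hd : 1 ≤ Module.finrank ℝ 𝕜 := Module.finrank_pos
      push_cast [Nat.cast_sub hd]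
      ring
    · refine Finset.prod_congr rfl fun j hj => ?_
      have hj := Finset.mem_range.1 hj
      rw [hs' _ _ _ hj, hs' _ _ _ hj, hs' _ _ _ hj, e1, e2, e2]

end Induction

end MatrixBeta

namespace MatrixBeta

/-! ### Evaluation of the constants -/

section Evaluation

theorem prod_Icc_one_eq_prod_range {M : Type*} [CommMonoid M] (n : ℕ) (f : ℕ → M) :
    ∏ k ∈ Finset.Icc 1 n, f k = ∏ j ∈ Finset.range n, f (j + 1) := by
  induction n with
  | zero => simp
  | succ n ih => rw [Finset.prod_Icc_succ_top (by omega), ih, Finset.prod_range_succ]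

theorem sum_Icc_one_eq_sum_range {M : Type*} [AddCommMonoid M] (n : ℕ) (f : ℕ → M) :
    ∑ k ∈ Finset.Icc 1 n, f k = ∑ j ∈ Finset.range n, f (j + 1) := by
  induction n with
  | zero => simp
  | succ n ih => rw [Finset.sum_Icc_succ_top (by omega), ih, Finset.sum_range_succ]

theorem prod_two_cpow (s : Finset ℕ) (f : ℕ → ℂ) :
    ∏ j ∈ s, (2 : ℂ) ^ f j = 2 ^ ∑ j ∈ s, f j := by
  simp only [Complex.cpow_def_of_ne_zero two_ne_zero]
  rw [← Complex.exp_sum, Finset.mul_sum]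

theorem detPow_zero {m : Type*} [Fintype m] [DecidableEq m] (A : Matrix m m ℂ) :
    detPow A 0 = 1 := by simp [detPow]

theorem detPowConj_zero {m : Type*} [Fintype m] [DecidableEq m] (A : Matrix m m ℂ) (σ : ℂ) :
    detPowConj A σ 0 = detPow A σ := by simp [detPow, detPowConj]

theorem conjShift_real : conjShift ℝ = 0 := by simp [conjShift]

theorem conjShift_complex : conjShift ℂ = 2 := by
  rw [conjShift, Complex.finrank_real_complex]
  norm_num

/-- Setting the exponent of index `0` equal to that of index `1` removes the `2 × 2` block from the
product. This choice is the origin of the separate `λ₁ - σ₁` in the constant. -/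
theorem integrandReal_eq_genIntegrand (n : ℕ) (lam sig : ℕ → ℂ)
    (R : Matrix (Fin (2 * n + 2)) (Fin (2 * n + 2)) ℝ) :
    integrandReal n lam sig R =
      genIntegrand n (Function.update lam 0 (lam 1)) (Function.update sig 0 (sig 1)) 0 R := by
  have hι : (toComplex ℝ : ℝ → ℂ) = Complex.ofReal := funext toComplex_real
  rw [integrandReal, genIntegrand, Finset.prod_range_succ', prod_Icc_one_eq_prod_range, hι]
  simp [detPow_zero, detPowConj_zero, conjTranspose_eq_transpose_of_trivial]

theorem integrandComplex_eq_genIntegrand (n : ℕ) (lam sig tau : ℕ → ℂ)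
    (R : Matrix (Fin (2 * n + 2)) (Fin (2 * n + 2)) ℂ) :
    integrandComplex n lam sig tau R =
      genIntegrand n (Function.update lam 0 (lam 1)) (Function.update sig 0 (sig 1))
        (Function.update tau 0 (tau 1)) R := by
  have hι : ∀ {m l : Type} (A : Matrix m l ℂ), A.map (toComplex ℂ) = A := fun A => by
    ext i j
    exact toComplex_complex _
  rw [integrandComplex, genIntegrand, Finset.prod_range_succ', prod_Icc_one_eq_prod_range]
  simp [detPow_zero, detPowConj_zero, hι, Complex.finrank_real_complex]

theorem two_pow_mul_cpow (a : ℂ) (m : ℕ) : (1 / 2 ^ m : ℂ) * 2 ^ a = 2 ^ (a - m) := by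
  rw [Complex.cpow_sub _ _ two_ne_zero, Complex.cpow_natCast]
  ring

theorem fiberIntegrable_real {j : ℕ} {α σ : ℂ} (hα : -1 < α.re)
    (hs : (2 * j + 1 : ℝ) < (σ - α - 1).re) : FiberIntegrable ℝ j α σ 0 := by
  refine ⟨(integral_powKernel_real hα (lt_trans (by positivity) hs)).1, ?_⟩
  rw [Module.finrank_self, add_zero, Nat.cast_one, Nat.cast_one, one_mul]
  exact hs

theorem fiberConst_real {j : ℕ} {α σ : ℂ} (hα : -1 < α.re)
    (hs : (2 * j + 1 : ℝ) < (σ - α - 1).re) : fiberConst ℝ j α σ 0 =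
      2 ^ (α + j - 1) * ((Real.pi : ℂ) ^ (2 * j + 1) *
        (Complex.Gamma (α + 1) * Complex.Gamma (σ - α - 1 - (2 * j + 1)) / Complex.Gamma σ)) := by
  have hs0 : 0 < (σ - α - 1).re := lt_trans (by positivity) hs
  have hG := Complex.Gamma_ne_zero_of_re_pos hs0
  -- The three factors come from the Jacobian, the radial integral and the beta integral. The factor
  -- `Γ(σ - α - 1)` of the last two cancels.
  have h2 : (2 : ℂ) ^ (α + j - 1) = 1 / 2 ^ (j + 2) *
      (2 ^ ((2 * j + 1 : ℂ) - (σ - α - 1)) * 2 ^ (σ - 1)) := by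
    rw [← Complex.cpow_add _ _ two_ne_zero, two_pow_mul_cpow]
    congr 1
    push_cast
    ring
  rw [fiberConst, (integral_powKernel_real hα hs0).2, Module.finrank_self, add_zero, Nat.cast_one,
    one_mul, one_mul, pow_one, h2]
  field_simp

theorem fiberIntegrable_complex {j : ℕ} {α σ τ : ℂ} (hα : -1 < α.re)
    (hs : (2 * (2 * j + 1) : ℝ) < (σ + τ - α - 2).re) : FiberIntegrable ℂ j α σ τ := by
  refine ⟨(integral_powKernel_complex hα (lt_trans (by positivity) hs)).1, ?_⟩
  rw [Complex.finrank_real_complex, Nat.cast_ofNat, Nat.cast_ofNat]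
  exact hs

theorem fiberConst_complex {j : ℕ} {α σ τ : ℂ} (hα : -1 < α.re)
    (hs : (2 * (2 * j + 1) : ℝ) < (σ + τ - α - 2).re) : fiberConst ℂ j α σ τ =
      2 ^ (α - σ - τ + 2 * j) * ((Real.pi : ℂ) ^ (4 * j + 3) *
        (Complex.Gamma (α + 1) * Complex.Gamma (σ + τ - α - 2 - 2 * (2 * j + 1)) /
          (Complex.Gamma σ * Complex.Gamma τ))) := by
  have hs0 : 0 < (σ + τ - α - 2).re := lt_trans (by positivity) hs
  have hG := Complex.Gamma_ne_zero_of_re_pos hs0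
  -- Here the scalar integral contributes no power of `2`; it supplies the extra `π` in `π ^ (4j +
  -- 3)`.
  have h2 : (2 : ℂ) ^ (α - σ - τ + 2 * j) = (1 / 2 ^ (j + 2)) ^ 2 *
      2 ^ ((2 * (2 * j + 1) : ℂ) - (σ + τ - α - 2)) := by
    rw [_root_.one_div_pow, ← pow_mul, two_pow_mul_cpow]
    congr 1
    push_cast
    ring
  have hpi : (Real.pi : ℂ) ^ (4 * j + 3) = (Real.pi : ℂ) ^ (2 * (2 * j + 1)) * Real.pi := by
    rw [← pow_succ]
    congr 1
    ring
  rw [fiberConst, (integral_powKernel_complex hα hs0).2, Complex.finrank_real_complex,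
    Nat.cast_ofNat, h2, hpi, div_eq_mul_inv _ (Complex.Gamma σ * Complex.Gamma τ), mul_inv]
  field_simp

theorem integral_integrandReal (n : ℕ) (lam sig : ℕ → ℂ) (hlam : lam (n + 1) = 0)
    (hsig : sig (n + 1) = 0) (h : ∀ k ∈ Finset.Icc 1 n, (n : ℝ) + k - 1 < (lam k).re ∧
      (n : ℝ) - k < (sig k - lam k).re) :
    IntegrableOn (fun x : Coord n → ℝ => integrandReal n lam sig (ofCoord x))
        {x | ofCoord x ∈ wedgeSection n ℝ} volume ∧
      ∫ x : Coord n → ℝ in {x | ofCoord x ∈ wedgeSection n ℝ},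
          integrandReal n lam sig (ofCoord x) =
        (2 : ℂ) ^ (lam 1 - sig 1 + ∑ k ∈ Finset.Icc 1 n, lam k - (n : ℂ) * (n + 1)) *
          ∏ k ∈ Finset.Icc 1 n, (Real.pi : ℂ) ^ (2 * k - 1) *
            (Complex.Gamma (lam k - (n + k) + 1) * Complex.Gamma (sig k - lam k - (n - k)) /
              Complex.Gamma (sig k - 2 * (n - k))) := by
  have hα : ∀ j < n, -1 < (lam (j + 1) - (n + j + 1)).re := by
    intro j hj
    have := (h (j + 1) (Finset.mem_Icc.2 ⟨by omega, by omega⟩)).1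
    simp at this ⊢
    linarith
  have hs : ∀ j < n, (2 * j + 1 : ℝ) <
      (sig (j + 1) - 2 * (n - j - 1) - (lam (j + 1) - (n + j + 1)) - 1).re := by
    intro j hj
    have := (h (j + 1) (Finset.mem_Icc.2 ⟨by omega, by omega⟩)).2
    simp at this ⊢
    linarith
  -- With `k = j + 1`, the bound on `λ_k` says that the kernel is integrable near `h = 0`, and the
  -- bound on `σ_k - λ_k` is the convergence condition of the radial integral over the fiber.
  have key := integral_genIntegrand (𝕜 := ℝ) n (lam := Function.update lam 0 (lam 1))
    (sig := Function.update sig 0 (sig 1)) (tau := 0) (by simpa using hlam) (by simpa using hsig)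
    rfl (by
      intro j hj
      simpa [conjShift_real] using fiberIntegrable_real (hα j hj) (hs j hj))
  simp only [integrandReal_eq_genIntegrand]
  refine ⟨key.1, key.2.trans ?_⟩
  rw [prod_Icc_one_eq_prod_range, sum_Icc_one_eq_sum_range]
  have hprod : ∀ j ∈ Finset.range n,
      fiberConst ℝ j (Function.update lam 0 (lam 1) (j + 1) -
          (Module.finrank ℝ ℝ : ℂ) * (n + j + 1))
        (Function.update sig 0 (sig 1) (j + 1) - 2 * (n - j - 1))
        ((0 : ℕ → ℂ) (j + 1) - conjShift ℝ * (n - j - 1)) =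
      2 ^ (lam (j + 1) - n - 2) * ((Real.pi : ℂ) ^ (2 * (j + 1) - 1) *
        (Complex.Gamma (lam (j + 1) - (n + (j + 1 : ℕ)) + 1) *
          Complex.Gamma (sig (j + 1) - lam (j + 1) - (n - (j + 1 : ℕ))) /
            Complex.Gamma (sig (j + 1) - 2 * (n - (j + 1 : ℕ))))) := by
    intro j hj
    have hj := Finset.mem_range.1 hj
    rw [Function.update_of_ne (Nat.succ_ne_zero j), Function.update_of_ne (Nat.succ_ne_zero j),
      conjShift_real, Module.finrank_self, Nat.cast_one, one_mul, Pi.zero_apply, zero_mul, sub_zero,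
      fiberConst_real (hα j hj) (hs j hj)]
    push_cast
    congr 2
    · ring
    · congr 2 <;> ring_nf
  rw [Finset.prod_congr rfl hprod, Finset.prod_mul_distrib, prod_two_cpow, ← mul_assoc,
    ← Complex.cpow_add _ _ two_ne_zero]
  congr 2
  rw [Finset.sum_sub_distrib, Finset.sum_sub_distrib]
  simp
  ring

theorem integral_integrandComplex (n : ℕ) (lam sig tau : ℕ → ℂ) (hlam : lam (n + 1) = 0)
    (hsig : sig (n + 1) = 0) (htau : tau (n + 1) = 0)
    (h : ∀ k ∈ Finset.Icc 1 n, 2 * ((n : ℝ) + k) - 1 < (lam k).re ∧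
        2 * ((n : ℝ) - k) < (sig k + tau k - lam k).re) :
    IntegrableOn (fun x : Coord n → ℂ => integrandComplex n lam sig tau (ofCoord x))
        {x | ofCoord x ∈ wedgeSection n ℂ} volume ∧
      ∫ x : Coord n → ℂ in {x | ofCoord x ∈ wedgeSection n ℂ},
          integrandComplex n lam sig tau (ofCoord x) =
        (2 : ℂ) ^ (lam 1 - sig 1 - tau 1 + ∑ k ∈ Finset.Icc 1 n, (lam k - sig k - tau k) -
            2 * (n : ℂ)) *
          ∏ k ∈ Finset.Icc 1 n, (Real.pi : ℂ) ^ (4 * k - 1) *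
            (Complex.Gamma (lam k - 2 * (n + k) + 1) *
                Complex.Gamma (sig k + tau k - lam k - 2 * (n - k)) /
              (Complex.Gamma (sig k - 2 * (n - k)) * Complex.Gamma (tau k - 2 * (n - k)))) := by
  have hα : ∀ j < n, -1 < (lam (j + 1) - 2 * (n + j + 1)).re := by
    intro j hj
    have := (h (j + 1) (Finset.mem_Icc.2 ⟨by omega, by omega⟩)).1
    simp at this ⊢
    linarith
  have hs : ∀ j < n, (2 * (2 * j + 1) : ℝ) <
      (sig (j + 1) - 2 * (n - j - 1) + (tau (j + 1) - 2 * (n - j - 1)) -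
        (lam (j + 1) - 2 * (n + j + 1)) - 2).re := by
    intro j hj
    have := (h (j + 1) (Finset.mem_Icc.2 ⟨by omega, by omega⟩)).2
    simp at this ⊢
    linarith
  have key := integral_genIntegrand (𝕜 := ℂ) n (lam := Function.update lam 0 (lam 1))
    (sig := Function.update sig 0 (sig 1)) (tau := Function.update tau 0 (tau 1))
    (by simpa using hlam) (by simpa using hsig) (by simpa using htau) (by
      intro j hj
      simpa [conjShift_complex, Complex.finrank_real_complex] using
        fiberIntegrable_complex (hα j hj) (hs j hj))
  simp only [integrandComplex_eq_genIntegrand]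
  refine ⟨key.1, key.2.trans ?_⟩
  rw [prod_Icc_one_eq_prod_range, sum_Icc_one_eq_sum_range]
  have hprod : ∀ j ∈ Finset.range n,
      fiberConst ℂ j (Function.update lam 0 (lam 1) (j + 1) -
          (Module.finrank ℝ ℂ : ℂ) * (n + j + 1))
        (Function.update sig 0 (sig 1) (j + 1) - 2 * (n - j - 1))
        (Function.update tau 0 (tau 1) (j + 1) - conjShift ℂ * (n - j - 1)) =
      2 ^ (lam (j + 1) - sig (j + 1) - tau (j + 1) + (2 * n - 4 * j - 6)) *
        ((Real.pi : ℂ) ^ (4 * (j + 1) - 1) *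
        (Complex.Gamma (lam (j + 1) - 2 * (n + (j + 1 : ℕ)) + 1) *
          Complex.Gamma (sig (j + 1) + tau (j + 1) - lam (j + 1) - 2 * (n - (j + 1 : ℕ))) /
            (Complex.Gamma (sig (j + 1) - 2 * (n - (j + 1 : ℕ))) *
              Complex.Gamma (tau (j + 1) - 2 * (n - (j + 1 : ℕ)))))) := by
    intro j hj
    have hj := Finset.mem_range.1 hj
    rw [Function.update_of_ne (Nat.succ_ne_zero j), Function.update_of_ne (Nat.succ_ne_zero j),
      Function.update_of_ne (Nat.succ_ne_zero j), conjShift_complex, Complex.finrank_real_complex,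
      Nat.cast_ofNat, fiberConst_complex (hα j hj) (hs j hj)]
    push_cast
    congr 2
    · ring
    · congr 2 <;> ring_nf
  -- Combined with the `2 n` from the exponents of index `0`, this gives the `-2 n` of the stated
  -- constant. The auxiliary sum has a free upper limit `m` because `n` also occurs in the summand.
  have hsum : ∑ j ∈ Finset.range n, (2 * n - 4 * j - 6 : ℂ) = -(4 * n) := by
    have : ∀ m : ℕ, ∑ j ∈ Finset.range m, (2 * n - 4 * j - 6 : ℂ) =
        2 * n * m - 2 * m * (m - 1) - 6 * m := by
      intro m
      induction m with
      | zero => simp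
      | succ m ih => rw [Finset.sum_range_succ, ih]; push_cast; ring
    rw [this]
    ring
  rw [Finset.prod_congr rfl hprod, Finset.prod_mul_distrib, prod_two_cpow, ← mul_assoc,
    ← Complex.cpow_add _ _ two_ne_zero]
  congr 2
  rw [Finset.sum_add_distrib, hsum, Complex.finrank_real_complex]
  simp
  ring

end Evaluation

end MatrixBeta

theorem mainTheorem7 (n : ℕ) :
    (∀ lam sig : ℕ → ℂ, lam (n + 1) = 0 → sig (n + 1) = 0 →
      (∀ k ∈ Finset.Icc 1 n, (n : ℝ) + k - 1 < (lam k).re ∧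
        (n : ℝ) - k < (sig k - lam k).re) →
      IntegrableOn (fun x : MatrixBeta.Coord n → ℝ =>
          MatrixBeta.integrandReal n lam sig (MatrixBeta.ofCoord x))
        {x | MatrixBeta.ofCoord x ∈ MatrixBeta.wedgeSection n ℝ} volume ∧
      ∫ x : MatrixBeta.Coord n → ℝ in {x | MatrixBeta.ofCoord x ∈ MatrixBeta.wedgeSection n ℝ},
          MatrixBeta.integrandReal n lam sig (MatrixBeta.ofCoord x) =
        (2 : ℂ) ^ (lam 1 - sig 1 + ∑ k ∈ Finset.Icc 1 n, lam k - (n : ℂ) * (n + 1)) *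
          ∏ k ∈ Finset.Icc 1 n, (Real.pi : ℂ) ^ (2 * k - 1) *
            (Complex.Gamma (lam k - (n + k) + 1) * Complex.Gamma (sig k - lam k - (n - k)) /
              Complex.Gamma (sig k - 2 * (n - k)))) ∧
    (∀ lam sig tau : ℕ → ℂ, lam (n + 1) = 0 → sig (n + 1) = 0 → tau (n + 1) = 0 →
      (∀ k ∈ Finset.Icc 1 n, 2 * ((n : ℝ) + k) - 1 < (lam k).re ∧
        2 * ((n : ℝ) - k) < (sig k + tau k - lam k).re) →
      IntegrableOn (fun x : MatrixBeta.Coord n → ℂ =>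
          MatrixBeta.integrandComplex n lam sig tau (MatrixBeta.ofCoord x))
        {x | MatrixBeta.ofCoord x ∈ MatrixBeta.wedgeSection n ℂ} volume ∧
      ∫ x : MatrixBeta.Coord n → ℂ in {x | MatrixBeta.ofCoord x ∈ MatrixBeta.wedgeSection n ℂ},
          MatrixBeta.integrandComplex n lam sig tau (MatrixBeta.ofCoord x) =
        (2 : ℂ) ^ (lam 1 - sig 1 - tau 1 + ∑ k ∈ Finset.Icc 1 n, (lam k - sig k - tau k) -
            2 * (n : ℂ)) *
          ∏ k ∈ Finset.Icc 1 n, (Real.pi : ℂ) ^ (4 * k - 1) *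
            (Complex.Gamma (lam k - 2 * (n + k) + 1) *
                Complex.Gamma (sig k + tau k - lam k - 2 * (n - k)) /
              (Complex.Gamma (sig k - 2 * (n - k)) * Complex.Gamma (tau k - 2 * (n - k))))) := by
  exact ⟨MatrixBeta.integral_integrandReal n, MatrixBeta.integral_integrandComplex n⟩
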